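/- Let $k$ be a perfect field of characteristic $p>0$ and let $X$ be a smooth $k$-variety of dimension $n$. Write $\Omega^i_X=\wedge^i\Omega_{X/k}$, let $F:X\to X$ be the absolute Frobenius morphism (the identity on points, $a\mapsto a^p$ on functions), and let $F_*\Omega^\bullet_X$ be the de Rham complex of $X$ over $k$, regarded as a complex of $\mathcal O_X$-modules through $F$. Let $W_2(k)$ be the ring of Witt vectors of length two, with its projection $W_2(k)\to k$ and its Frobenius endomorphism $(a_0,a_1)\mapsto(a_0^p,a_1^p)$. Assume that the Frobenius morphism of $X$ lifts to $W_2(k)$: there are a flat scheme $X^{(2)}$ over $\operatorname{Spec}W_2(k)$ with an isomorphism $X\cong X^{(2)}\times_{\operatorname{Spec}W_2(k)}\operatorname{Spec}k$ over $k$, and a morphism $F^{(2)}:X^{(2)}\to X^{(2)}$ covering the Frobenius endomorphism of $W_2(k)$ and reducing to $F$ under this isomorphism. Then there is a quasi-isomorphism of complexes of $\mathcal O_X$-modules $$\sigma:\bigoplus_{i\ge 0}\Omega^i_X[-i]\longrightarrow F_*\Omega^\bullet_X ,$$ where the left-hand side has zero differentials, with the following properties. 1. The maps $\Omega^i_X\to\mathcal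 H^i(F_*\Omega^\bullet_X)$ induced by $\sigma$ on cohomology sheaves form the inverse Cartier operator $C^{-1}$, that is, the isomorphism of graded $\mathcal O_X$-algebras $\Omega^\bullet_X\to\mathcal H^\bullet(F_*\Omega^\bullet_X)$ with $C^{-1}(da)=[a^{p-1}da]$ for every local section $a$ of $\mathcal O_X$. 2. $\sigma$ is split: there is a morphism of complexes of $\mathcal O_X$-modules $\rho:F_*\Omega^\bullet_X\to\bigoplus_{i\ge 0}\Omega^i_X[-i]$ with $\rho\circ\sigma=\mathrm{id}$. Moreover $\rho$ can be taken to be given by the duality pairing $\Omega^i_X\otimes\Omega^{n-i}_X\to\Omega^n_X$: for $0\le i\le n$ and every section $\omega$ of $F_*\Omega^i_X$ over an open set $U$, $\rho_i(\omega)$ is the unique section of $\Omega^i_X$ over $U$ such that $$z\wedge\rho_i(\omega)=C(\sigma_{n-i}(z)\wedge\omega)$$ for all sections $z$ of $\Omega^{n-i}_X$ over open subsets of $U$. Here, for a closed form $\eta$ of degree $n$ with class $[\eta]$ in $\mathcal H^n(F_*\Omega^\bullet_X)$, $C(\eta)$ denotes the $n$-form with $C^{-1}(C(\eta))=[\eta]$.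 -/

import Mathlib

open CategoryTheory TopologicalSpace AlgebraicGeometry Opposite

universe u

noncomputable section

namespace DeRham

section Algebra

variable (k A : Type*) [CommRing k] [CommRing A] [Algebra k A]

/-- The algebra `⨁ᵢ Ωⁱ_{A/k}` of differential forms of a `k`-algebra `A`: the exterior algebra of
the module of Kähler differentials. The forms of degree `i` are `⋀[A]^i Ω[A⁄k]`. -/
abbrev Forms : Type _ := ExteriorAlgebra A (Ω[A⁄k])

variable {k A}

/-- Functions as forms of degree `0`. -/
def ofFun (a : A) : Forms k A := algebraMap A (Forms k A) a

variable (k) in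
/-- The exact form `da` of degree `1`. -/
def dFun (a : A) : Forms k A := ExteriorAlgebra.ι A (KaehlerDifferential.D k A a)

lemma ofFun_add (a b : A) : (ofFun (a + b) : Forms k A) = ofFun a + ofFun b := map_add _ _ _
lemma ofFun_mul (a b : A) : (ofFun (a * b) : Forms k A) = ofFun a * ofFun b := map_mul _ _ _

lemma ofFun_mul_comm (a : A) (x : Forms k A) : ofFun a * x = x * ofFun a := Algebra.commutes a x

lemma dFun_add (a b : A) : dFun k (a + b) = dFun k a + dFun k b := by simp [dFun]

lemma dFun_mul (a b : A) : dFun k (a * b) = ofFun a * dFun k b + ofFun b * dFun k a := by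
  simp [dFun, ofFun, Algebra.smul_def]

lemma dFun_const (c : k) : dFun k (algebraMap k A c) = 0 := by simp [dFun]

lemma dFun_sq (a : A) : dFun k a * dFun k a = 0 := ExteriorAlgebra.ι_sq_zero _

lemma ι_anticomm (m n : Ω[A⁄k]) :
    ExteriorAlgebra.ι A m * ExteriorAlgebra.ι A n = - (ExteriorAlgebra.ι A n * ExteriorAlgebra.ι A m) :=
  eq_neg_of_add_eq_zero_left (ExteriorAlgebra.ι_add_mul_swap m n)

lemma dFun_anticomm (a b : A) : dFun k a * dFun k b = - (dFun k b * dFun k a) := ι_anticomm _ _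

/-- Forms are sums of products of functions and of differentials of functions. -/
@[elab_as_elim]
lemma forms_induction {P : Forms k A → Prop} (hfun : ∀ a, P (ofFun a)) (hd : ∀ a, P (dFun k a))
    (hadd : ∀ x y, P x → P y → P (x + y)) (hmul : ∀ x y, P x → P y → P (x * y))
    (x : Forms k A) : P x := by
  induction x using ExteriorAlgebra.induction with
  | algebraMap r => exact hfun r
  | ι m =>
    have hm : m ∈ Submodule.span A (Set.range (KaehlerDifferential.D k A)) := by
      rw [KaehlerDifferential.span_range_derivation]; trivial
    induction hm using Submodule.span_induction with
    | mem m h => obtain ⟨a, rfl⟩ := h; exact hd a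
    | zero => simpa [ofFun] using hfun 0
    | add m n _ _ hm hn => rw [map_add]; exact hadd _ _ hm hn
    | smul a m _ hm => rw [map_smul, Algebra.smul_def]; exact hmul _ _ (hfun a) hm
  | mul x y hx hy => exact hmul x y hx hy
  | add x y hx hy => exact hadd x y hx hy

/-- The parity automorphism, `(-1)ⁱ` on forms of degree `i`. -/
def hat : Forms k A →ₐ[A] Forms k A := CliffordAlgebra.involute

@[simp] lemma hat_ofFun (a : A) : hat (ofFun a : Forms k A) = ofFun a := AlgHom.commutes _ _
@[simp] lemma hat_dFun (a : A) : hat (dFun k a) = - dFun k a := CliffordAlgebra.involute_ι _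
@[simp] lemma hat_hat (x : Forms k A) : hat (hat x) = x := CliffordAlgebra.involute_involute x

lemma hat_mul_dFun (x : Forms k A) (a : A) : hat x * dFun k a = dFun k a * x := by
  induction x using forms_induction with
  | hfun b => simp [ofFun_mul_comm]
  | hd b => rw [hat_dFun, dFun_anticomm a b, neg_mul]
  | hadd x y hx hy => rw [map_add, add_mul, mul_add, hx, hy]
  | hmul x y hx hy => rw [map_mul, mul_assoc, hy, ← mul_assoc, hx, mul_assoc]

variable (k A) in
/-- Auxiliary ring for the construction of the exterior derivative: pairs `(x, y)` of forms with
`(x, y) * (x', y') = (x * x', hat x * y' + y * x')`, so that `x ↦ (x, D x)` is multiplicative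
exactly if `D` is an antiderivation. -/
@[ext]
structure Tw where
  fst : Forms k A
  snd : Forms k A

namespace Tw

instance : Zero (Tw k A) := ⟨⟨0, 0⟩⟩
instance : One (Tw k A) := ⟨⟨1, 0⟩⟩
instance : Add (Tw k A) := ⟨fun x y => ⟨x.1 + y.1, x.2 + y.2⟩⟩
instance : Neg (Tw k A) := ⟨fun x => ⟨-x.1, -x.2⟩⟩
instance : Mul (Tw k A) := ⟨fun x y => ⟨x.1 * y.1, hat x.1 * y.2 + x.2 * y.1⟩⟩

@[simp] lemma zero_fst : (0 : Tw k A).1 = 0 := rfl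
@[simp] lemma zero_snd : (0 : Tw k A).2 = 0 := rfl
@[simp] lemma one_fst : (1 : Tw k A).1 = 1 := rfl
@[simp] lemma one_snd : (1 : Tw k A).2 = 0 := rfl
@[simp] lemma add_fst (x y : Tw k A) : (x + y).1 = x.1 + y.1 := rfl
@[simp] lemma add_snd (x y : Tw k A) : (x + y).2 = x.2 + y.2 := rfl
@[simp] lemma neg_fst (x : Tw k A) : (-x).1 = -x.1 := rfl
@[simp] lemma neg_snd (x : Tw k A) : (-x).2 = -x.2 := rfl
@[simp] lemma mul_fst (x y : Tw k A) : (x * y).1 = x.1 * y.1 := rfl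
@[simp] lemma mul_snd (x y : Tw k A) : (x * y).2 = hat x.1 * y.2 + x.2 * y.1 := rfl

instance : Ring (Tw k A) where
  add_assoc _ _ _ := by ext <;> simp [add_assoc]
  zero_add _ := by ext <;> simp
  add_zero _ := by ext <;> simp
  add_comm _ _ := by ext <;> simp [add_comm]
  neg_add_cancel _ := by ext <;> simp
  left_distrib _ _ _ := by ext <;> simp [mul_add]; abel
  right_distrib _ _ _ := by ext <;> simp [add_mul]; abel
  zero_mul _ := by ext <;> simp
  mul_zero _ := by ext <;> simp
  mul_assoc _ _ _ := by ext <;> simp [mul_assoc, mul_add, add_mul, add_assoc]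
  one_mul _ := by ext <;> simp
  mul_one _ := by ext <;> simp
  nsmul := nsmulRec
  zsmul := zsmulRec

/-- The ring homomorphism `a ↦ (a, da)`. -/
def ofFun : A →+* Tw k A where
  toFun a := ⟨DeRham.ofFun a, dFun k a⟩
  map_zero' := by ext <;> simp [DeRham.ofFun, dFun]
  map_one' := by ext <;> simp [DeRham.ofFun, dFun]
  map_add' a b := by ext <;> simp [DeRham.ofFun_add, dFun_add]
  map_mul' a b := by
    ext
    · simp [DeRham.ofFun_mul]
    · simp [dFun_mul, ofFun_mul_comm b]

instance : Algebra A (Tw k A) := ofFun.toAlgebra' fun a x => by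
  ext
  · exact ofFun_mul_comm a x.1
  · change hat (DeRham.ofFun a) * x.2 + dFun k a * x.1 = hat x.1 * dFun k a + x.2 * DeRham.ofFun a
    rw [hat_ofFun, hat_mul_dFun, ofFun_mul_comm, add_comm]

lemma smul_def (a : A) (x : Tw k A) : a • x = ofFun a * x := Algebra.smul_def a x
@[simp] lemma ofFun_fst (a : A) : (ofFun a : Tw k A).1 = DeRham.ofFun a := rfl
@[simp] lemma ofFun_snd (a : A) : (ofFun a : Tw k A).2 = dFun k a := rfl

instance : Module k (Tw k A) := Module.compHom _ (algebraMap k A)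
instance : IsScalarTower k A (Tw k A) := .of_algebraMap_smul fun _ _ => rfl

variable (k A) in
/-- The derivation `a ↦ (da, 0)`. -/
def der : Derivation k A (Tw k A) where
  toFun a := ⟨dFun k a, 0⟩
  map_add' a b := by ext <;> simp [dFun_add]
  map_smul' c a := by
    rw [← algebraMap_smul A c, RingHom.id_apply, ← algebraMap_smul A c, smul_def]
    ext <;> simp [dFun_mul, dFun_const]
  map_one_eq_zero' := by
    change (⟨dFun k 1, 0⟩ : Tw k A) = 0
    ext <;> simp [dFun]
  leibniz' a b := by
    change (⟨dFun k (a * b), 0⟩ : Tw k A) = a • ⟨dFun k b, 0⟩ + b • ⟨dFun k a, 0⟩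
    rw [smul_def, smul_def]
    ext
    · simp [dFun_mul]
    · simp [dFun_anticomm a b]

variable (k A) in
/-- The linear map `db ↦ (db, 0)`. -/
def lin : Ω[A⁄k] →ₗ[A] Tw k A := (der k A).liftKaehlerDifferential

lemma lin_D (a : A) : lin k A (KaehlerDifferential.D k A a) = ⟨dFun k a, 0⟩ :=
  (der k A).liftKaehlerDifferential_comp_D a

lemma lin_fst_and_commute (m : Ω[A⁄k]) : (lin k A m).1 = ExteriorAlgebra.ι A m ∧
    ∀ n : Ω[A⁄k], Commute (ExteriorAlgebra.ι A n) (lin k A m).2 := by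
  have hm : m ∈ Submodule.span A (Set.range (KaehlerDifferential.D k A)) := by
    rw [KaehlerDifferential.span_range_derivation]; trivial
  induction hm using Submodule.span_induction with
  | mem m h => obtain ⟨a, rfl⟩ := h; rw [lin_D]; exact ⟨rfl, fun n => Commute.zero_right _⟩
  | zero => simp
  | add m n _ _ hm hn =>
    rw [map_add, map_add, add_fst, add_snd, hm.1, hn.1]
    exact ⟨rfl, fun l => (hm.2 l).add_right (hn.2 l)⟩
  | smul a m _ hm =>
    rw [map_smul, map_smul, smul_def, mul_fst, mul_snd, ofFun_fst, ofFun_snd, hat_ofFun, hm.1]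
    refine ⟨(Algebra.smul_def _ _).symm, fun l => ?_⟩
    refine Commute.add_right (Commute.mul_right (ofFun_mul_comm a _).symm (hm.2 l)) ?_
    change _ * (_ * _) = (_ * _) * _
    rw [← mul_assoc, dFun, ι_anticomm l, mul_assoc, ι_anticomm m l, neg_mul, mul_neg, mul_assoc]

variable (k A) in
/-- The algebra homomorphism `x ↦ (x, dx)`. -/
def hom : Forms k A →ₐ[A] Tw k A := ExteriorAlgebra.lift A ⟨lin k A, fun m => by
  obtain ⟨h1, h2⟩ := lin_fst_and_commute m
  ext
  · simp [h1]
  · rw [mul_snd, h1, zero_snd, ← (h2 m).eq, hat, CliffordAlgebra.involute_ι, neg_mul,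
      neg_add_cancel]⟩

lemma hom_ofFun (a : A) : hom k A (DeRham.ofFun a) = ofFun a := (hom k A).commutes a

lemma hom_dFun (a : A) : hom k A (dFun k a) = ⟨dFun k a, 0⟩ := by
  rw [hom, dFun, ExteriorAlgebra.lift_ι_apply, lin_D, dFun]

lemma hom_fst (x : Forms k A) : (hom k A x).1 = x := by
  induction x using forms_induction with
  | hfun a => rw [hom_ofFun]; rfl
  | hd a => rw [hom_dFun]
  | hadd x y hx hy => rw [map_add, add_fst, hx, hy]
  | hmul x y hx hy => rw [map_mul, mul_fst, hx, hy]

end Tw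

/-- The exterior derivative. It is characterised by `extD (ofFun a) = dFun k a`,
`extD (dFun k a) = 0` and `extD (x * y) = hat x * extD y + extD x * y`. -/
def extD : Forms k A →+ Forms k A where
  toFun x := (Tw.hom k A x).2
  map_zero' := by simp
  map_add' x y := by simp

@[simp] lemma extD_ofFun (a : A) : extD (ofFun a : Forms k A) = dFun k a := by
  change (Tw.hom k A _).2 = _
  rw [Tw.hom_ofFun]; rfl

@[simp] lemma extD_dFun (a : A) : extD (dFun k a) = 0 := by
  change (Tw.hom k A _).2 = _
  rw [Tw.hom_dFun]

lemma extD_mul (x y : Forms k A) : extD (x * y) = hat x * extD y + extD x * y := by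
  change (Tw.hom k A _).2 = hat x * (Tw.hom k A _).2 + (Tw.hom k A _).2 * y
  rw [map_mul, Tw.mul_snd, Tw.hom_fst, Tw.hom_fst]

lemma extD_hat (x : Forms k A) : extD (hat x) = - hat (extD x) := by
  induction x using forms_induction with
  | hfun a => simp
  | hd a => simp
  | hadd x y hx hy => rw [map_add, map_add, hx, hy, map_add, map_add]; abel
  | hmul x y hx hy =>
    rw [map_mul, extD_mul, hx, hy, extD_mul, map_add, map_mul, map_mul, mul_neg, neg_mul]; abel

lemma extD_extD (x : Forms k A) : extD (extD x) = 0 := by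
  induction x using forms_induction with
  | hfun a => simp
  | hd a => simp
  | hadd x y hx hy => rw [map_add, map_add, hx, hy, add_zero]
  | hmul x y hx hy =>
    rw [extD_mul, map_add, extD_mul, extD_mul, hx, hy, hat_hat, extD_hat]; simp

lemma dFun_mem (a : A) : dFun k a ∈ ⋀[A]^1 (Ω[A⁄k]) := by
  rw [ExteriorAlgebra.exteriorPower, pow_one]; exact LinearMap.mem_range_self _ _

lemma ofFun_mem (a : A) : ofFun a ∈ ⋀[A]^0 (Ω[A⁄k]) := by
  rw [ExteriorAlgebra.exteriorPower, pow_zero]; exact Submodule.algebraMap_mem a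

lemma forms_mul_mem {i j : ℕ} {x y : Forms k A} (hx : x ∈ ⋀[A]^i (Ω[A⁄k]))
    (hy : y ∈ ⋀[A]^j (Ω[A⁄k])) : x * y ∈ ⋀[A]^(i + j) (Ω[A⁄k]) := by
  rw [ExteriorAlgebra.exteriorPower, pow_add]; exact Submodule.mul_mem_mul hx hy

lemma extD_ι_mem (m : Ω[A⁄k]) : extD (ExteriorAlgebra.ι A m) ∈ ⋀[A]^2 (Ω[A⁄k]) := by
  have hm : m ∈ Submodule.span A (Set.range (KaehlerDifferential.D k A)) := by
    rw [KaehlerDifferential.span_range_derivation]; trivial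
  induction hm using Submodule.span_induction with
  | mem m h =>
    obtain ⟨a, rfl⟩ := h
    change extD (dFun k a) ∈ _
    rw [extD_dFun]; exact zero_mem _
  | zero => simp
  | add m n _ _ hm hn => rw [map_add, map_add]; exact add_mem hm hn
  | smul a m _ hm =>
    have : ExteriorAlgebra.ι A (a • m) = ofFun a * ExteriorAlgebra.ι A m := by
      rw [map_smul, Algebra.smul_def]; rfl
    rw [this, extD_mul, hat_ofFun, extD_ofFun]
    refine add_mem (by simpa using forms_mul_mem (ofFun_mem a) hm) ?_
    exact forms_mul_mem (i := 1) (j := 1) (dFun_mem a) (by simp)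

lemma extD_mem {i : ℕ} {x : Forms k A} (hx : x ∈ ⋀[A]^i (Ω[A⁄k])) :
    extD x ∈ ⋀[A]^(i + 1) (Ω[A⁄k]) := by
  induction i generalizing x with
  | zero =>
    rw [ExteriorAlgebra.exteriorPower, pow_zero] at hx
    obtain ⟨a, rfl⟩ := Submodule.mem_one.1 hx
    exact (extD_ofFun (k := k) a).symm ▸ dFun_mem a
  | succ i ih =>
    rw [ExteriorAlgebra.exteriorPower, pow_succ'] at hx
    refine Submodule.mul_induction_on hx (fun m hm y hy => ?_) (fun x y hx hy => ?_)
    · obtain ⟨m, rfl⟩ := hm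
      rw [extD_mul]
      refine add_mem ?_ ?_
      · rw [hat, CliffordAlgebra.involute_ι, add_comm i 1, add_assoc]
        exact forms_mul_mem (i := 1) (by simp) (ih hy)
      · rw [add_assoc, add_comm i]
        exact forms_mul_mem (i := 2) (extD_ι_mem m) hy
    · rw [map_add]; exact add_mem hx hy

section Map

variable {B C : Type*} [CommRing B] [Algebra k B] [CommRing C] [Algebra k C]

/-- The homomorphism on forms induced by a homomorphism of `k`-algebras. -/
def formsMap (g : A →ₐ[k] B) : Forms k A →+* Forms k B :=
  letI := g.toRingHom.toAlgebra
  haveI : IsScalarTower k A B := .of_algebraMap_eq fun c => (g.commutes c).symm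
  (ExteriorAlgebra.lift A (A := Forms k B)
    ⟨(ExteriorAlgebra.ι B).restrictScalars A ∘ₗ KaehlerDifferential.map k k A B,
      fun _ => ExteriorAlgebra.ι_sq_zero _⟩).toRingHom

@[simp] lemma formsMap_ofFun (g : A →ₐ[k] B) (a : A) : formsMap g (ofFun a) = ofFun (g a) := by
  let _ := g.toRingHom.toAlgebra
  have : IsScalarTower k A B := .of_algebraMap_eq fun c => (g.commutes c).symm
  exact AlgHom.commutes _ a

@[simp] lemma formsMap_dFun (g : A →ₐ[k] B) (a : A) : formsMap g (dFun k a) = dFun k (g a) := by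
  let _ := g.toRingHom.toAlgebra
  have : IsScalarTower k A B := .of_algebraMap_eq fun c => (g.commutes c).symm
  refine (ExteriorAlgebra.lift_ι_apply _ _ _ _).trans ?_
  simp only [LinearMap.comp_apply, LinearMap.restrictScalars_apply, KaehlerDifferential.map_D]
  rfl

lemma formsMap_id (x : Forms k A) : formsMap (AlgHom.id k A) x = x := by
  induction x using forms_induction with
  | hfun a => simp
  | hd a => simp
  | hadd x y hx hy => rw [map_add, hx, hy]
  | hmul x y hx hy => rw [map_mul, hx, hy]

lemma formsMap_comp (g : A →ₐ[k] B) (h : B →ₐ[k] C) (x : Forms k A) :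
    formsMap (h.comp g) x = formsMap h (formsMap g x) := by
  induction x using forms_induction with
  | hfun a => simp
  | hd a => simp
  | hadd x y hx hy => simp only [map_add, hx, hy]
  | hmul x y hx hy => simp only [map_mul, hx, hy]

lemma formsMap_hat (g : A →ₐ[k] B) (x : Forms k A) : formsMap g (hat x) = hat (formsMap g x) := by
  induction x using forms_induction with
  | hfun a => simp
  | hd a => simp
  | hadd x y hx hy => simp only [map_add, hx, hy]
  | hmul x y hx hy => simp only [map_mul, hx, hy]

lemma formsMap_extD (g : A →ₐ[k] B) (x : Forms k A) :
    formsMap g (extD x) = extD (formsMap g x) := by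
  induction x using forms_induction with
  | hfun a => simp
  | hd a => simp
  | hadd x y hx hy => simp only [map_add, hx, hy]
  | hmul x y hx hy => simp only [map_mul, extD_mul, map_add, hx, hy, formsMap_hat]

lemma formsMap_ι (g : A →ₐ[k] B) (m : Ω[A⁄k]) :
    ∃ m' : Ω[B⁄k], formsMap g (ExteriorAlgebra.ι A m) = ExteriorAlgebra.ι B m' := by
  let _ := g.toRingHom.toAlgebra
  have : IsScalarTower k A B := .of_algebraMap_eq fun c => (g.commutes c).symm
  exact ⟨KaehlerDifferential.map k k A B m, ExteriorAlgebra.lift_ι_apply _ _ _ _⟩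

lemma formsMap_mem (g : A →ₐ[k] B) {i : ℕ} {x : Forms k A} (hx : x ∈ ⋀[A]^i (Ω[A⁄k])) :
    formsMap g x ∈ ⋀[B]^i (Ω[B⁄k]) := by
  induction i generalizing x with
  | zero =>
    rw [ExteriorAlgebra.exteriorPower, pow_zero] at hx
    obtain ⟨a, rfl⟩ := Submodule.mem_one.1 hx
    exact (formsMap_ofFun g a).symm ▸ ofFun_mem _
  | succ i ih =>
    rw [ExteriorAlgebra.exteriorPower, pow_succ'] at hx
    refine Submodule.mul_induction_on hx (fun m hm y hy => ?_) (fun x y hx hy => ?_)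
    · obtain ⟨m, rfl⟩ := hm
      rw [map_mul, add_comm]
      refine forms_mul_mem (i := 1) ?_ (ih hy)
      obtain ⟨m', hm⟩ := formsMap_ι g m
      rw [ExteriorAlgebra.exteriorPower, pow_one]
      exact ⟨m', hm.symm⟩
    · rw [map_add]; exact add_mem hx hy

lemma ofFun_smul (a : A) (x : Forms k A) : a • x = ofFun a * x := Algebra.smul_def a x

end Map

end Algebra

section Scheme

variable (k : Type u) [CommRing k] (X : Scheme.{u}) [X.Over (Spec (.of k))]

/-- The structure map `k → Γ(X, U)` of a scheme over `k`. -/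
def structHom (U : X.Opens) : CommRingCat.of k ⟶ Γ(X, U) :=
  (Scheme.ΓSpecIso (.of k)).inv ≫ (X ↘ Spec (.of k)).appTop ≫
    X.presheaf.map (homOfLE (le_top : U ≤ ⊤)).op

instance (U : X.Opens) : Algebra k Γ(X, U) := (structHom k X U).hom.toAlgebra

instance (x : X) : Algebra k (X.presheaf.stalk x) :=
  (structHom k X ⊤ ≫ X.presheaf.germ ⊤ x trivial).hom.toAlgebra

variable {X}

/-- Restriction of functions as a homomorphism of `k`-algebras. -/
def resHom {U V : X.Opens} (h : V ≤ U) : Γ(X, U) →ₐ[k] Γ(X, V) where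
  __ := (X.presheaf.map (homOfLE h).op).hom
  commutes' c := by
    change (structHom k X U ≫ X.presheaf.map (homOfLE h).op).hom c = (structHom k X V).hom c
    simp only [structHom, Category.assoc, ← Functor.map_comp]
    rfl

/-- Passing to germs of functions as a homomorphism of `k`-algebras. -/
def germHom (U : X.Opens) (x : X) (hx : x ∈ U) : Γ(X, U) →ₐ[k] X.presheaf.stalk x where
  __ := (X.presheaf.germ U x hx).hom
  commutes' c := by
    change (structHom k X U ≫ X.presheaf.germ U x hx).hom c =
      (structHom k X ⊤ ≫ X.presheaf.germ ⊤ x trivial).hom c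
    simp only [structHom, Category.assoc]
    rw [X.presheaf.germ_res, X.presheaf.germ_res (homOfLE (le_top : (⊤ : X.Opens) ≤ ⊤)) x (by trivial)]

lemma germHom_res {U V : X.Opens} (h : V ≤ U) (x : X) (hx : x ∈ V) :
    (germHom k V x hx).comp (resHom k h) = germHom k U x (h hx) := by
  ext s
  exact X.presheaf.germ_res_apply (homOfLE h) x hx s

lemma formsMap_germHom_res {U V : X.Opens} (h : V ≤ U) (x : X) (hx : x ∈ V)
    (t : Forms k Γ(X, U)) :
    formsMap (germHom k V x hx) (formsMap (resHom k h) t) = formsMap (germHom k U x (h hx)) t := by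
  rw [← formsMap_comp, germHom_res]

variable (X)

/-- Families `s` of elements `s x` of the exterior algebras of `Ω[𝒪_{X,x}⁄k]`, for `x ∈ U`, that
are, locally on `U`, the germs of a form of degree `i` over the ring of functions on an open set.
These are the sections over `U` of the sheaf associated with `V ↦ ⋀ⁱ Ω[Γ(X, V)⁄k]`. -/
def isForm (i : ℕ) : TopCat.LocalPredicate fun x : X => Forms k (X.presheaf.stalk x) where
  pred {U} s := ∀ x : U, ∃ (V : X.Opens) (_ : x.1 ∈ V) (t : Forms k Γ(X, V)),
    t ∈ ⋀[Γ(X, V)]^i (Ω[Γ(X, V)⁄k]) ∧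
      ∀ (y : X) (hU : y ∈ U) (hV : y ∈ V), s ⟨y, hU⟩ = formsMap (germHom k V y hV) t
  res {U V} f s h x := by
    obtain ⟨W, hx, t, ht, hs⟩ := h (f x)
    exact ⟨W, hx, t, ht, fun y hU hW => hs y (f.le hU) hW⟩
  locality {U} s h x := by
    obtain ⟨V, hxV, f, hs⟩ := h x
    obtain ⟨W, hx, t, ht, hs⟩ := hs ⟨x, hxV⟩
    refine ⟨V ⊓ W, ⟨hxV, hx⟩, formsMap (resHom k inf_le_right) t,
      formsMap_mem _ ht, fun y hU hy => ?_⟩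
    rw [formsMap_germHom_res]
    exact hs y hy.1 hy.2

variable {X}

lemma isForm_common {i j : ℕ} {U : X.Opens} {s s' : ∀ x : U, Forms k (X.presheaf.stalk x.1)}
    (h : (isForm k X i).pred s) (h' : (isForm k X j).pred s') (x : U) :
    ∃ (V : X.Opens) (_ : x.1 ∈ V) (t t' : Forms k Γ(X, V)),
      t ∈ ⋀[Γ(X, V)]^i (Ω[Γ(X, V)⁄k]) ∧ t' ∈ ⋀[Γ(X, V)]^j (Ω[Γ(X, V)⁄k]) ∧
      ∀ (y : X) (hU : y ∈ U) (hV : y ∈ V), s ⟨y, hU⟩ = formsMap (germHom k V y hV) t ∧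
        s' ⟨y, hU⟩ = formsMap (germHom k V y hV) t' := by
  obtain ⟨V, hx, t, ht, hs⟩ := h x
  obtain ⟨V', hx', t', ht', hs'⟩ := h' x
  refine ⟨V ⊓ V', ⟨hx, hx'⟩, formsMap (resHom k inf_le_left) t, formsMap (resHom k inf_le_right) t',
    formsMap_mem _ ht, formsMap_mem _ ht', fun y hU hV => ?_⟩
  rw [formsMap_germHom_res, formsMap_germHom_res]
  exact ⟨hs y hU hV.1, hs' y hU hV.2⟩

lemma isForm_mul {i j : ℕ} {U : X.Opens} {s s' : ∀ x : U, Forms k (X.presheaf.stalk x.1)}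
    (h : (isForm k X i).pred s) (h' : (isForm k X j).pred s') :
    (isForm k X (i + j)).pred fun x : U => s x * s' x := by
  intro x
  obtain ⟨V, hx, t, t', ht, ht', hs⟩ := isForm_common k h h' x
  exact ⟨V, hx, t * t', forms_mul_mem ht ht', fun y hU hV => by
    rw [map_mul, ← (hs y hU hV).1, ← (hs y hU hV).2]⟩

lemma isForm_extD {i : ℕ} {U : X.Opens} {s : ∀ x : U, Forms k (X.presheaf.stalk x.1)}
    (h : (isForm k X i).pred s) : (isForm k X (i + 1)).pred fun x : U => extD (s x) := by
  intro x
  obtain ⟨V, hx, t, ht, hs⟩ := h x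
  exact ⟨V, hx, extD t, extD_mem ht, fun y hU hV => by rw [formsMap_extD, ← hs y hU hV]⟩

/-- A function on `U` as a family of germs. -/
def funGerm {U : X.Opens} (a : Γ(X, U)) (x : U) : Forms k (X.presheaf.stalk x.1) :=
  ofFun (X.presheaf.germ U x.1 x.2 a)

lemma isForm_fun {U : X.Opens} (a : Γ(X, U)) : (isForm k X 0).pred (funGerm k a) := fun x =>
  ⟨U, x.2, ofFun a, ofFun_mem a, fun y hU _ => (formsMap_ofFun (germHom k U y hU) a).symm⟩

variable (X) in
/-- The sections over `U` of the sheaf of differential forms of degree `i`. -/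
def formSections (i : ℕ) (U : X.Opens) :
    AddSubgroup (∀ x : U, Forms k (X.presheaf.stalk x.1)) where
  carrier := {s | (isForm k X i).pred s}
  zero_mem' x := ⟨U, x.2, 0, zero_mem _, fun y hU hV => by simp⟩
  add_mem' {s s'} h h' x := by
    obtain ⟨V, hx, t, t', ht, ht', hs⟩ := isForm_common k h h' x
    exact ⟨V, hx, t + t', add_mem ht ht', fun y hU hV => by
      rw [map_add, ← (hs y hU hV).1, ← (hs y hU hV).2]; rfl⟩
  neg_mem' {s} h x := by
    obtain ⟨V, hx, t, ht, hs⟩ := h x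
    exact ⟨V, hx, -t, neg_mem ht, fun y hU hV => by rw [map_neg, ← hs y hU hV]; rfl⟩

instance (i : ℕ) (U : X.Opens) : Module Γ(X, U) (formSections k X i U) where
  smul a s := ⟨fun x => funGerm k a x * s.1 x, by
    have := isForm_mul k (isForm_fun k a) s.2
    rwa [zero_add] at this⟩
  one_smul s := by
    ext x
    change ofFun _ * s.1 x = s.1 x
    rw [map_one, ofFun, map_one, one_mul]
  mul_smul a b s := by
    ext x
    change ofFun _ * s.1 x = ofFun _ * (ofFun _ * s.1 x)
    rw [map_mul, ofFun_mul, mul_assoc]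
  smul_zero a := by
    ext x
    exact mul_zero _
  smul_add a s t := by
    ext x
    exact mul_add _ _ _
  add_smul a b s := by
    ext x
    change ofFun _ * s.1 x = ofFun _ * s.1 x + ofFun _ * s.1 x
    rw [map_add, ofFun_add, add_mul]
  zero_smul s := by
    ext x
    change ofFun _ * s.1 x = 0
    rw [map_zero, ofFun, map_zero, zero_mul]

/-- Restriction of differential forms. -/
def formRes (i : ℕ) {U V : X.Opens} (h : V ≤ U) : formSections k X i U →+ formSections k X i V where
  toFun s := ⟨fun x => s.1 ⟨x.1, h x.2⟩, (isForm k X i).res (homOfLE h) s.1 s.2⟩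
  map_zero' := rfl
  map_add' _ _ := rfl

lemma formRes_smul (i : ℕ) {U V : X.Opens} (h : V ≤ U) (a : Γ(X, U)) (s : formSections k X i U) :
    formRes k i h (a • s) = X.presheaf.map (homOfLE h).op a • formRes k i h s := by
  refine Subtype.ext (funext fun x => ?_)
  have := X.presheaf.germ_res_apply (homOfLE h) x.1 x.2 a
  exact congrArg (fun b => ofFun b * s.1 ⟨x.1, h x.2⟩) this.symm

variable (X) in
/-- The presheaf of abelian groups underlying the sheaf of differential forms of degree `i`. -/
def formsPresheaf (i : ℕ) : TopCat.Presheaf Ab.{u} X where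
  obj U := AddCommGrpCat.of (formSections k X i U.unop)
  map {U V} f := AddCommGrpCat.ofHom (formRes k i f.unop.le)

lemma formsPresheaf_isSheaf (i : ℕ) : (formsPresheaf k X i).IsSheaf :=
  (TopCat.Presheaf.isSheaf_iff_isSheaf_comp (forget AddCommGrpCat) _).2
    (TopCat.subsheafToTypes (isForm k X i)).2

instance (i : ℕ) (U : (Opens X)ᵒᵖ) :
    Module (X.ringCatSheaf.obj.obj U) ((formsPresheaf k X i).obj U) :=
  inferInstanceAs (Module Γ(X, U.unop) (formSections k X i U.unop))

variable (X) in
/-- The `𝒪_X`-module `Ωⁱ_X` of differential forms of degree `i` relative to `k`. -/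
def Omega (i : ℕ) : X.Modules where
  val := .ofPresheaf (formsPresheaf k X i) fun _ _ f a s => formRes_smul k i f.unop.le a s
  isSheaf := formsPresheaf_isSheaf k i

/-- The wedge product of differential forms. -/
def wedge {i j : ℕ} {U : X.Opens} (s : formSections k X i U) (t : formSections k X j U) :
    formSections k X (i + j) U :=
  ⟨fun x => s.1 x * t.1 x, isForm_mul k s.2 t.2⟩

/-- The de Rham differential on forms of degree `i`. -/
def extDer (i : ℕ) {U : X.Opens} : formSections k X i U →+ formSections k X (i + 1) U where
  toFun s := ⟨fun x => extD (s.1 x), isForm_extD k s.2⟩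
  map_zero' := Subtype.ext (funext fun _ => map_zero _)
  map_add' _ _ := Subtype.ext (funext fun _ => map_add _ _ _)

/-- A function as a form of degree `0`. -/
def funForm {U : X.Opens} (a : Γ(X, U)) : formSections k X 0 U := ⟨funGerm k a, isForm_fun k a⟩

/-- The form `da` of degree `1`. -/
def dForm {U : X.Opens} (a : Γ(X, U)) : formSections k X 1 U := extDer k 0 (funForm k a)

end Scheme

section Frobenius

variable (k : Type u) [Field k] (p : ℕ) [CharP k p]

lemma dFun_pow_char {A : Type u} [CommRing A] [Algebra k A] (a : A) : dFun k (a ^ p) = 0 := by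
  have h : ∀ m : Ω[A⁄k], p • m = 0 := fun m => by
    rw [← Nat.cast_smul_eq_nsmul k, CharP.cast_eq_zero, zero_smul]
  rw [dFun, Derivation.leibniz_pow, h, map_zero]

lemma extD_pow_mul {A : Type u} [CommRing A] [Algebra k A] (a : A) (x : Forms k A) :
    extD (ofFun (a ^ p) * x) = ofFun (a ^ p) * extD x := by
  rw [extD_mul, hat_ofFun, extD_ofFun, dFun_pow_char, zero_mul, add_zero]

lemma extDer_pow_smul (X : Scheme.{u}) [X.Over (Spec (.of k))] (i : ℕ) {U : X.Opens} (a : Γ(X, U)) (s : formSections k X i U) :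
    extDer k i (a ^ p • s) = a ^ p • extDer k i s := by
  refine Subtype.ext (funext fun x => ?_)
  change extD (ofFun (X.presheaf.germ U x.1 x.2 (a ^ p)) * s.1 x) =
    ofFun (X.presheaf.germ U x.1 x.2 (a ^ p)) * extD (s.1 x)
  rw [map_pow, extD_pow_mul]

variable [Fact p.Prime]

lemma add_pow_of_algebra {A : Type u} [CommRing A] [Algebra k A] (a b : A) :
    (a + b) ^ p = a ^ p + b ^ p := by
  cases subsingleton_or_nontrivial A
  · exact Subsingleton.elim _ _
  · have : CharP A p := charP_of_injective_algebraMap (algebraMap k A).injective p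
    exact add_pow_char a b p

/-- The `p`-th power map of an algebra over a field of characteristic `p`. -/
def frobHom (A : Type u) [CommRing A] [Algebra k A] : A →+* A where
  toFun a := a ^ p
  map_one' := one_pow p
  map_mul' a b := mul_pow a b p
  map_zero' := zero_pow (Fact.out : p.Prime).ne_zero
  map_add' := add_pow_of_algebra k p

variable (X : Scheme.{u}) [X.Over (Spec (.of k))]

/-- The absolute Frobenius morphism: the identity on points and `a ↦ a ^ p` on functions. -/
def absFrob : X ⟶ X where
  base := 𝟙 _
  c :=
    { app U := CommRingCat.ofHom (frobHom k p Γ(X, U.unop))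
      naturality U V f := by
        ext a
        exact (map_pow (X.presheaf.map f).hom a p).symm }
  prop x := by
    refine ⟨fun a ha => ?_⟩
    obtain ⟨U, hx, s, rfl⟩ := X.presheaf.exists_germ_eq a
    erw [PresheafedSpace.stalkMap_germ_apply] at ha
    replace ha : IsUnit (X.presheaf.germ U x hx (s ^ p)) := ha
    rw [map_pow] at ha
    exact (isUnit_pow_iff (Fact.out : p.Prime).ne_zero).1 ha

lemma absFrob_preimage (U : X.Opens) : absFrob k p X ⁻¹ᵁ U = U := rfl

lemma absFrob_app (U : X.Opens) (a : Γ(X, U)) : (absFrob k p X).app U a = a ^ p := rfl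

/-- The differential `F_* Ωⁱ_X ⟶ F_* Ωⁱ⁺¹_X`, which is `𝒪_X`-linear. -/
def frobExtDer (i : ℕ) :
    (Scheme.Modules.pushforward (absFrob k p X)).obj (Omega k X i) ⟶
      (Scheme.Modules.pushforward (absFrob k p X)).obj (Omega k X (i + 1)) where
  val := PresheafOfModules.homMk
    (M₁ := ((Scheme.Modules.pushforward (absFrob k p X)).obj (Omega k X i)).val)
    (M₂ := ((Scheme.Modules.pushforward (absFrob k p X)).obj (Omega k X (i + 1))).val)
    { app U := AddCommGrpCat.ofHom (extDer k i (U := U.unop))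
      naturality _ _ _ := rfl }
    fun _ a s => extDer_pow_smul k p X i a s

lemma frobExtDer_comp (i : ℕ) : frobExtDer k p X i ≫ frobExtDer k p X (i + 1) = 0 := by
  refine Scheme.Modules.hom_ext _ _ fun U => ?_
  ext s
  exact Subtype.ext (funext fun x => extD_extD _)

/-- The complex `F_* Ω^•_X` of `𝒪_X`-modules. -/
def frobDeRham : CochainComplex X.Modules ℕ :=
  CochainComplex.of (fun i => (Scheme.Modules.pushforward (absFrob k p X)).obj (Omega k X i))
    (frobExtDer k p X) (frobExtDer_comp k p X)

/-- The complex `⨁ᵢ Ωⁱ_X[-i]`: it is `Ωⁱ_X` in degree `i` and has zero differentials. -/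
def hodgeComplex : CochainComplex X.Modules ℕ where
  X i := Omega k X i
  d _ _ := 0

variable {X}

/-- Differential forms over `U` as sections of the sheaf `Ωⁱ_X`. -/
def sec {i : ℕ} {U : X.Opens} : formSections k X i U ≃+ Γ(Omega k X i, U) := AddEquiv.refl _

/-- Differential forms over `U` as sections of the sheaf `F_* Ωⁱ_X`. -/
def frobSec {i : ℕ} {U : X.Opens} : formSections k X i U ≃+ Γ((frobDeRham k p X).X i, U) :=
  AddEquiv.refl _

variable {k p} in
/-- `σ` in degree `i`, as a map on differential forms over `U`. -/
def onForms (σ : hodgeComplex k X ⟶ frobDeRham k p X) {i : ℕ} {U : X.Opens}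
    (ω : formSections k X i U) : formSections k X i U :=
  (frobSec k p).symm ((σ.f i).app U (sec k ω))

variable {k p} in
/-- `ρ` in degree `i`, as a map on differential forms over `U`. -/
def onFrobForms (ρ : frobDeRham k p X ⟶ hodgeComplex k X) {i : ℕ} {U : X.Opens}
    (ω : formSections k X i U) : formSections k X i U :=
  (sec k).symm ((ρ.f i).app U (frobSec k p ω))

/-- The form `ω` is closed and its class in the cohomology sheaf `ℋⁱ(F_* Ω^•_X)` is `c`. -/
def HasClass {i : ℕ} {U : X.Opens} (ω : formSections k X i U)
    (c : Γ((frobDeRham k p X).homology i, U)) : Prop :=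
  ∃ z : Γ((frobDeRham k p X).cycles i, U),
    ((frobDeRham k p X).iCycles i).app U z = frobSec k p ω ∧
    ((frobDeRham k p X).homologyπ i).app U z = c

variable {k p} in
/-- The map `Ωⁱ_X ⟶ ℋⁱ(F_* Ω^•_X)` on cohomology sheaves induced by
`σ : ⨁ᵢ Ωⁱ_X[-i] ⟶ F_* Ω^•_X`: the cohomology of the source in degree `i` is `Ωⁱ_X`. -/
def cohomologyMap (σ : hodgeComplex k X ⟶ frobDeRham k p X) (i : ℕ) :
    Omega k X i ⟶ (frobDeRham k p X).homology i :=
  (frobDeRham k p X).liftCycles (σ.f i) (i + 1) (by simp)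
    ((σ.comm i (i + 1)).trans Limits.zero_comp) ≫ (frobDeRham k p X).homologyπ i

/-- The inverse Cartier operator: the isomorphism of graded `𝒪_X`-algebras
`Ω^•_X ⟶ ℋ^•(F_* Ω^•_X)` with `da ↦ [a ^ (p - 1) da]`. -/
structure IsInverseCartier (γ : ∀ i, Omega k X i ⟶ (frobDeRham k p X).homology i) : Prop where
  isIso (i : ℕ) : IsIso (γ i)
  one (U : X.Opens) : HasClass k p (funForm k 1) ((γ 0).app U (sec k (funForm k 1)))
  wedge {i j : ℕ} {U : X.Opens} (ω ω' : formSections k X i U) (η η' : formSections k X j U) :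
    HasClass k p ω' ((γ i).app U (sec k ω)) → HasClass k p η' ((γ j).app U (sec k η)) →
      HasClass k p (wedge k ω' η') ((γ (i + j)).app U (sec k (wedge k ω η)))
  d (U : X.Opens) (a : Γ(X, U)) :
    HasClass k p (a ^ (p - 1) • dForm k a) ((γ 1).app U (sec k (dForm k a)))

variable {k p} in
/-- In dimension `n`, the map `ρ` is the one given by duality: for `ω ∈ F_* Ωⁱ_X(U)`, the form
`ρ(ω) ∈ Ωⁱ_X(U)` is the unique one such that `C(σ(z) ∧ ω) = z ∧ ρ(ω)` for all local sections `z`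
of `Ωⁿ⁻ⁱ_X` over open subsets of `U`, where `C` is the Cartier operator, the inverse of `γ n` on
cohomology classes. -/
def IsGivenByDuality (n : ℕ) (γ : ∀ i, Omega k X i ⟶ (frobDeRham k p X).homology i)
    (σ : hodgeComplex k X ⟶ frobDeRham k p X) (ρ : frobDeRham k p X ⟶ hodgeComplex k X) : Prop :=
  ∀ (i j : ℕ), j + i = n → ∀ (U : X.Opens) (ω η : formSections k X i U),
    η = onFrobForms ρ ω ↔ ∀ (V : X.Opens) (h : V ≤ U) (z : formSections k X j V),
      HasClass k p (wedge k (onForms σ z) (formRes k i h ω))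
        ((γ (j + i)).app V (sec k (wedge k z (formRes k i h η))))

end Frobenius

section Lift

variable (k : Type u) [Field k] (p : ℕ) [Fact p.Prime] [CharP k p]

/-- The projection `W₂(k) → k`, `(a₀, a₁) ↦ a₀`. -/
def wittResidue : TruncatedWittVector p 2 k →+* k where
  toFun a := a.coeff 0
  map_one' := by
    rw [← map_one (WittVector.truncate 2), WittVector.coeff_truncate]
    exact WittVector.one_coeff_zero p k
  map_mul' a b := by
    obtain ⟨a, rfl⟩ := WittVector.truncate_surjective p 2 k a
    obtain ⟨b, rfl⟩ := WittVector.truncate_surjective p 2 k b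
    rw [← map_mul]
    simp only [WittVector.coeff_truncate]
    exact WittVector.mul_coeff_zero a b
  map_zero' := TruncatedWittVector.coeff_zero p 2 k 0
  map_add' a b := by
    obtain ⟨a, rfl⟩ := WittVector.truncate_surjective p 2 k a
    obtain ⟨b, rfl⟩ := WittVector.truncate_surjective p 2 k b
    rw [← map_add]
    simp only [WittVector.coeff_truncate]
    exact WittVector.add_coeff_zero a b

lemma mk_pow_truncate (a : WittVector p k) :
    TruncatedWittVector.mk p (fun i => (WittVector.truncate 2 a).coeff i ^ p) =
      WittVector.truncate 2 (WittVector.frobenius a) := by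
  ext i
  rw [TruncatedWittVector.coeff_mk, WittVector.coeff_truncate, WittVector.coeff_truncate,
    WittVector.coeff_frobenius_charP]

/-- The Frobenius endomorphism `(a₀, a₁) ↦ (a₀ ^ p, a₁ ^ p)` of `W₂(k)`. -/
def wittFrob : TruncatedWittVector p 2 k →+* TruncatedWittVector p 2 k where
  toFun a := TruncatedWittVector.mk p fun i => a.coeff i ^ p
  map_one' := by
    rw [← map_one (WittVector.truncate 2), mk_pow_truncate, map_one]
  map_mul' a b := by
    obtain ⟨a, rfl⟩ := WittVector.truncate_surjective p 2 k a
    obtain ⟨b, rfl⟩ := WittVector.truncate_surjective p 2 k b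
    rw [← map_mul, mk_pow_truncate, mk_pow_truncate, mk_pow_truncate, map_mul, map_mul]
  map_zero' := by
    rw [← map_zero (WittVector.truncate 2), mk_pow_truncate, map_zero]
  map_add' a b := by
    obtain ⟨a, rfl⟩ := WittVector.truncate_surjective p 2 k a
    obtain ⟨b, rfl⟩ := WittVector.truncate_surjective p 2 k b
    rw [← map_add, mk_pow_truncate, mk_pow_truncate, mk_pow_truncate, map_add, map_add]

variable (X : Scheme.{u}) [X.Over (Spec (.of k))]

/-- The Frobenius morphism of `X` lifts to `W₂(k)`: there are a flat scheme `X₂` over `W₂(k)` with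
`X ≅ X₂ ×_{Spec W₂(k)} Spec k` and a morphism `F₂ : X₂ ⟶ X₂` that covers the Frobenius of `W₂(k)`
and reduces to the absolute Frobenius morphism of `X`. -/
def FrobeniusLifts : Prop :=
  ∃ (X₂ : Scheme.{u}) (f₂ : X₂ ⟶ Spec (.of (TruncatedWittVector p 2 k))) (ι : X ⟶ X₂)
    (F₂ : X₂ ⟶ X₂), Flat f₂ ∧
    IsPullback ι (X ↘ Spec (.of k)) f₂ (Spec.map (CommRingCat.ofHom (wittResidue k p))) ∧
    F₂ ≫ f₂ = f₂ ≫ Spec.map (CommRingCat.ofHom (wittFrob k p)) ∧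
    ι ≫ F₂ = absFrob k p X ≫ ι

end Lift

end DeRham

end

open DeRham

/-!
A lift of the Frobenius divides the Frobenius by `p` on differentials. If `Φ` lifts the Frobenius of
a ring `A` to a ring `B` that is flat modulo `p²`, and `Φ b = bᵖ + p c`, then `Φ* (db)` is `p` times
`bᵖ⁻¹ db + dc`, and `da ↦ aᵖ⁻¹ da + dc` is a well-defined Frobenius-semilinear endomorphism `ψ` of
`Ω[A⁄k]` (`IsFrobeniusLift.exists_semilinear`). Applied to the local rings of `X`, this gives a family
of semilinear maps (`exists_isFrobeniusFamily_of_frobeniusLifts`), and `σ` is its exterior power `⋀ψ`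
(`twist`, `splitting`). As `ψ(da)` is closed and cohomologous to `aᵖ⁻¹ da`, the map `⋀ψ` takes closed
values and induces the multiplicative map `C⁻¹` on cohomology.

That `C⁻¹` is an isomorphism is shown on the local rings, in coordinates `x₁, …, xₙ`: functions whose
differentials are a basis of `Ω[A⁄k]` and which generate `A` together with its `p`-th powers. There `ψ`
can be replaced by the map `τ` with `τ(dxᵢ) = xᵢᵖ⁻¹ dxᵢ`. For the Lie derivative `L` along `xᵢ ∂/∂xᵢ`,
the operator `1 - Lᵖ⁻¹` is the projection to the forms of weight divisible by `p` and, by Cartan's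
formula, is homotopic to the identity. The composition of these projections for all `i` projects the
de Rham complex to the image of `⋀τ` (`Coordinates.exists_projection`), on which the differential
vanishes, and `⋀τ` is injective. Hence `⋀ψ` is bijective on cohomology
(`Coordinates.exists_sub_twist_mem`, `Coordinates.eq_zero_of_twist_mem`).

For a form `ω` of degree `i` the map `z ↦ C(⋀ψ(z) ∧ ω)` is linear on forms of degree `n - i`, because
`C` is inverse to a Frobenius-semilinear map. As the wedge pairing is perfect, it is `z ↦ z ∧ η` for a
unique form `η` (`Coordinates.exists_isDual`, `IsDual.unique`), and `ρ(ω) = η`. By the multiplicativity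
of `⋀ψ` the dual of `⋀ψ(ω)` is `ω`, and the dual of an exact form is `0` because `⋀ψ` takes closed
values, so that `ρ` is a morphism of complexes that splits `σ`.

The sections of `Ωⁱ_X` are families of forms on the local rings, and everything above is done on the
local rings. It extends to sections because equality and exactness of forms spread out from a point to
a neighborhood (`IsLocalForm.eventually_eq`, `IsLocalForm.exists_extD`). On the side of sheaves, a form
represents the class of `σ(ω)` if and only if it is closed and differs from `σ(ω)` by an exact form on
each local ring (`hasClass_iff`).
-/

noncomputable section

namespace DeRham

/-! ### The wedge pairing on the exterior algebra of a free module -/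

section Pairing

open Module

variable {R M : Type*} [CommRing R] [AddCommGroup M] [Module R M] {n : ℕ}

lemma basis_mem_exteriorPower (b : Basis (Fin n) R M) (s : Finset (Fin n)) :
    b.ExteriorAlgebra s ∈ ⋀[R]^s.card M := by
  have := ExteriorAlgebra.basis_eq_coe_basis b (Set.powersetCard.ofCard (s := s) rfl)
  exact this ▸ Subtype.mem _

lemma repr_eq_zero_of_mem (b : Basis (Fin n) R M) {i : ℕ} {x : ExteriorAlgebra R M}
    (hx : x ∈ ⋀[R]^i M) {s : Finset (Fin n)} (hs : s.card ≠ i) :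
    b.ExteriorAlgebra.repr x s = 0 := by
  have h : ∀ y : ⋀[R]^i M, b.ExteriorAlgebra.repr (y : ExteriorAlgebra R M) s = 0 := by
    have : (b.ExteriorAlgebra.coord s).comp (⋀[R]^i M).subtype = 0 :=
      (b.exteriorPower i).ext fun t => by
        have ht : (t : Finset (Fin n)) ≠ s := fun h => hs (h ▸ Set.powersetCard.card_eq t)
        rw [LinearMap.comp_apply, Submodule.subtype_apply, ← ExteriorAlgebra.basis_eq_coe_basis,
          Basis.coord_apply, Basis.repr_self, Finsupp.single_eq_of_ne ht.symm]
        rfl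
    exact fun y => congrArg (fun f => f y) this
  exact h ⟨x, hx⟩

lemma exists_basis_mul_of_disjoint (b : Basis (Fin n) R M) {s t : Finset (Fin n)}
    (h : Disjoint s t) : ∃ u : ℤˣ, b.ExteriorAlgebra s * b.ExteriorAlgebra t =
      (u : ℤ) • b.ExteriorAlgebra (s ∪ t) := by
  have h1 := ExteriorAlgebra.basis_mul_of_disjoint b (Set.powersetCard.ofCard (s := s) rfl)
    (Set.powersetCard.ofCard (s := t) rfl) h
  generalize Equiv.Perm.sign (Set.powersetCard.permOfDisjoint
    (s := Set.powersetCard.ofCard (s := s) rfl) (t := Set.powersetCard.ofCard (s := t) rfl) h) = u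
    at h1
  refine ⟨u, h1.trans ?_⟩
  rw [Units.smul_def]
  congr 2
  exact Finset.disjUnion_eq_union s t h

/-- The coefficient of `b₁ ∧ ⋯ ∧ bₙ`. -/
def topCoeff (b : Basis (Fin n) R M) : ExteriorAlgebra R M →ₗ[R] R :=
  b.ExteriorAlgebra.coord Finset.univ

lemma topCoeff_eq_zero (b : Basis (Fin n) R M) {i : ℕ} {x : ExteriorAlgebra R M}
    (hx : x ∈ ⋀[R]^i M) (hi : i ≠ n) : topCoeff b x = 0 :=
  repr_eq_zero_of_mem b hx (by simpa using hi.symm)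

lemma eq_topCoeff_smul (b : Basis (Fin n) R M) {x : ExteriorAlgebra R M} (hx : x ∈ ⋀[R]^n M) :
    x = topCoeff b x • b.ExteriorAlgebra Finset.univ := by
  refine b.ExteriorAlgebra.repr.injective (Finsupp.ext fun s => ?_)
  by_cases hs : s = Finset.univ
  · subst hs; simp [topCoeff]
  · rw [repr_eq_zero_of_mem b hx fun h => hs (Finset.card_eq_iff_eq_univ s |>.1 (by simpa using h))]
    simp [Ne.symm hs]

lemma exteriorPower_eq_zero (b : Basis (Fin n) R M) {i : ℕ} {x : ExteriorAlgebra R M}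
    (hx : x ∈ ⋀[R]^i M) (hi : n < i) : x = 0 := by
  refine b.ExteriorAlgebra.repr.injective (Finsupp.ext fun s => ?_)
  rw [repr_eq_zero_of_mem b hx fun h => ?_]
  · simp
  · have := s.card_le_univ
    rw [Fintype.card_fin] at this
    omega

lemma topCoeff_basis_mul (b : Basis (Fin n) R M) {s t : Finset (Fin n)} (h : t ≠ sᶜ) :
    topCoeff b (b.ExteriorAlgebra s * b.ExteriorAlgebra t) = 0 := by
  by_cases hd : Disjoint s t
  · obtain ⟨u, hu⟩ := exists_basis_mul_of_disjoint b hd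
    rw [hu, map_zsmul, topCoeff, Basis.coord_apply, Basis.repr_self, Finsupp.single_eq_of_ne,
      smul_zero]
    intro h'
    refine h (eq_compl_comm.1 (IsCompl.eq_compl ⟨hd, ?_⟩))
    rw [codisjoint_iff]
    exact h'.symm
  · rw [show b.ExteriorAlgebra s * b.ExteriorAlgebra t = 0 from
      ExteriorAlgebra.basis_mul_of_not_disjoint b (Set.powersetCard.ofCard (s := s) rfl)
        (Set.powersetCard.ofCard (s := t) rfl) hd, map_zero]

lemma topCoeff_basis_mul_compl (b : Basis (Fin n) R M) (s : Finset (Fin n)) :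
    ∃ u : ℤˣ, topCoeff b (b.ExteriorAlgebra s * b.ExteriorAlgebra sᶜ) = ((u : ℤ) : R) := by
  obtain ⟨u, hu⟩ := exists_basis_mul_of_disjoint b (disjoint_compl_right (a := s))
  refine ⟨u, ?_⟩
  rw [hu, Finset.union_compl, map_zsmul, topCoeff, Basis.coord_apply, Basis.repr_self,
    Finsupp.single_eq_same, zsmul_eq_mul, mul_one]

/-- The pairing `(z, w) ↦ topCoeff (z * w)` is perfect: it represents each linear form. -/
lemma exists_topCoeff_mul_eq (b : Basis (Fin n) R M) (l : ExteriorAlgebra R M →ₗ[R] R) :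
    ∃ w, ∀ z, topCoeff b (z * w) = l z := by
  choose u hu using topCoeff_basis_mul_compl b
  refine ⟨∑ t : Finset (Fin n), (((u t : ℤ) : R) * l (b.ExteriorAlgebra t)) •
    b.ExteriorAlgebra tᶜ, fun z => ?_⟩
  have : (topCoeff b).comp (LinearMap.mulRight R (∑ t : Finset (Fin n),
      (((u t : ℤ) : R) * l (b.ExteriorAlgebra t)) • b.ExteriorAlgebra tᶜ)) = l := by
    refine b.ExteriorAlgebra.ext fun s => ?_
    rw [LinearMap.comp_apply, LinearMap.mulRight_apply, Finset.mul_sum, map_sum,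
      Finset.sum_eq_single s]
    · rw [mul_smul_comm, map_smul, hu, smul_eq_mul, mul_right_comm, ← Int.cast_mul,
        ← Units.val_mul, Int.units_mul_self]
      simp
    · intro t _ hts
      rw [mul_smul_comm, map_smul, topCoeff_basis_mul b fun h => hts (compl_injective h), smul_zero]
    · simp
  exact congrArg (fun f => f z) this

/-- The pairing `(z, w) ↦ topCoeff (z * w)` is nondegenerate in the second variable. -/
lemma eq_zero_of_topCoeff_mul (b : Basis (Fin n) R M) {w : ExteriorAlgebra R M}
    (h : ∀ z, topCoeff b (z * w) = 0) : w = 0 := by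
  refine b.ExteriorAlgebra.repr.injective (Finsupp.ext fun s => ?_)
  obtain ⟨u, hu⟩ := topCoeff_basis_mul_compl b sᶜ
  rw [compl_compl] at hu
  have h1 := h (b.ExteriorAlgebra sᶜ)
  rw [← b.ExteriorAlgebra.sum_repr w, Finset.mul_sum, map_sum, Finset.sum_eq_single s] at h1
  · rw [mul_smul_comm, map_smul, hu, smul_eq_mul] at h1
    have h2 := congrArg (fun r => r * ((u : ℤ) : R)) h1
    simp only [mul_assoc, ← Int.cast_mul, ← Units.val_mul, Int.units_mul_self] at h2
    simpa using h2
  · intro t _ hts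
    rw [mul_smul_comm, map_smul, topCoeff_basis_mul b fun h => hts ?_, smul_zero]
    rw [h, compl_compl]
  · simp

end Pairing

/-! ### Ring homomorphisms of forms induced by Frobenius-semilinear maps -/

section Twist

variable {k : Type u} [Field k] {p : ℕ} [CharP k p] [Fact p.Prime]
variable {A : Type u} [CommRing A] [Algebra k A]

/-- The ring of forms of `A`, to be regarded as an `A`-algebra through the Frobenius of `A`. -/
def FrobForms (k : Type u) (_ : ℕ) (A : Type u) [CommRing k] [CommRing A] [Algebra k A] : Type u :=
  Forms k A

instance : Ring (FrobForms k p A) := inferInstanceAs (Ring (Forms k A))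

instance : Algebra A (FrobForms k p A) :=
  ((algebraMap A (Forms k A)).comp (frobHom k p A)).toAlgebra' fun a x =>
    Algebra.commutes (R := A) (A := Forms k A) (a ^ p) x

/-- The ring homomorphism `⋀ψ` on forms that is the Frobenius on functions and `ψ` on forms of
degree `1`. -/
def twist (ψ : Ω[A⁄k] →ₛₗ[frobHom k p A] Ω[A⁄k]) : Forms k A →+* Forms k A :=
  (ExteriorAlgebra.lift A (A := FrobForms k p A)
    ⟨{ toFun m := (ExteriorAlgebra.ι A (ψ m) : Forms k A)
       map_add' m m' := by rw [map_add, map_add]; rfl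
       map_smul' a m := by
        exact (congrArg _ (map_smulₛₗ ψ a m)).trans
          (((ExteriorAlgebra.ι A).map_smul _ _).trans (Algebra.smul_def _ _)) },
      fun m => ExteriorAlgebra.ι_sq_zero (ψ m)⟩).toRingHom

variable (ψ ψ' : Ω[A⁄k] →ₛₗ[frobHom k p A] Ω[A⁄k])

@[simp] lemma twist_ofFun (a : A) : twist ψ (ofFun a) = ofFun (a ^ p) :=
  AlgHom.commutes (R := A) (A := Forms k A) (B := FrobForms k p A) _ a

@[simp] lemma twist_ι (m : Ω[A⁄k]) :
    twist ψ (ExteriorAlgebra.ι A m) = ExteriorAlgebra.ι A (ψ m) :=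
  ExteriorAlgebra.lift_ι_apply A (A := FrobForms k p A) _ _ m

lemma twist_dFun (a : A) :
    twist ψ (dFun k a) = ExteriorAlgebra.ι A (ψ (KaehlerDifferential.D k A a)) := twist_ι _ _

lemma twist_hat (x : Forms k A) : twist ψ (hat x) = hat (twist ψ x) := by
  induction x using forms_induction with
  | hfun a => simp
  | hd a =>
    rw [hat_dFun, map_neg, twist_dFun]
    exact (CliffordAlgebra.involute_ι _).symm
  | hadd x y hx hy => simp only [map_add, hx, hy]
  | hmul x y hx hy => simp only [map_mul, hx, hy]

lemma twist_mem {i : ℕ} {x : Forms k A} (hx : x ∈ ⋀[A]^i (Ω[A⁄k])) :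
    twist ψ x ∈ ⋀[A]^i (Ω[A⁄k]) := by
  induction i generalizing x with
  | zero =>
    rw [ExteriorAlgebra.exteriorPower, pow_zero] at hx
    obtain ⟨a, rfl⟩ := Submodule.mem_one.1 hx
    exact (twist_ofFun ψ a).symm ▸ ofFun_mem _
  | succ i ih =>
    rw [ExteriorAlgebra.exteriorPower, pow_succ'] at hx
    refine Submodule.mul_induction_on hx (fun m hm y hy => ?_) (fun x y hx hy => ?_)
    · obtain ⟨m, rfl⟩ := hm
      rw [map_mul, add_comm]
      refine forms_mul_mem (i := 1) ?_ (ih hy)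
      rw [ExteriorAlgebra.exteriorPower, pow_one, twist_ι]
      exact ⟨_, rfl⟩
    · rw [map_add]; exact add_mem hx hy

/-- A semilinear map with prescribed values on a basis. -/
lemma exists_semilinear_of_basis {n : ℕ} (b : Module.Basis (Fin n) A (Ω[A⁄k]))
    (v : Fin n → Ω[A⁄k]) :
    ∃ ψ : Ω[A⁄k] →ₛₗ[frobHom k p A] Ω[A⁄k], ∀ i, ψ (b i) = v i := by
  refine ⟨
    { toFun m := ∑ i, (b.repr m i) ^ p • v i
      map_add' m m' := by
        simp only [map_add, Finsupp.add_apply, add_pow_of_algebra k p, add_smul,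
          Finset.sum_add_distrib]
      map_smul' a m := by
        simp only [map_smul, Finsupp.smul_apply, smul_eq_mul, mul_pow, Finset.smul_sum, mul_smul]
        rfl }, fun i => ?_⟩
  change ∑ j, (b.repr (b i) j) ^ p • v j = _
  rw [Finset.sum_eq_single i]
  · simp
  · intro j _ hj
    rw [Module.Basis.repr_self, Finsupp.single_eq_of_ne hj, zero_pow (Fact.out : p.Prime).ne_zero,
      zero_smul]
  · simp

/-- The module of Kähler differentials, to be regarded as an `A`-module through the Frobenius. -/
def FrobOmega (k : Type u) (_ : ℕ) (A : Type u) [CommRing k] [CommRing A] [Algebra k A] : Type u :=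
  Ω[A⁄k]

instance : AddCommGroup (FrobOmega k p A) := inferInstanceAs (AddCommGroup (Ω[A⁄k]))
instance : Module A (FrobOmega k p A) := Module.compHom (Ω[A⁄k]) (frobHom k p A)
instance : Module k (FrobOmega k p A) := Module.compHom (FrobOmega k p A) (algebraMap k A)
instance : IsScalarTower k A (FrobOmega k p A) := .of_algebraMap_smul fun _ _ => rfl

/-- Frobenius-semilinear derivations factor through the Kähler differentials. They kill the
constants as these are `p`-th powers. -/
lemma exists_semilinear_of_derivation [PerfectField k] (φ : A →+ Ω[A⁄k])
    (hφ : ∀ a b, φ (a * b) = a ^ p • φ b + b ^ p • φ a) :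
    ∃ ψ : Ω[A⁄k] →ₛₗ[frobHom k p A] Ω[A⁄k], ∀ a, ψ (KaehlerDifferential.D k A a) = φ a := by
  have hp0 : ∀ m : Ω[A⁄k], p • m = 0 := fun m => by
    rw [← Nat.cast_smul_eq_nsmul k, CharP.cast_eq_zero, zero_smul]
  have hone : φ 1 = 0 := by simpa using hφ 1 1
  have hpow : ∀ (a : A) (m : ℕ), φ (a ^ (m + 1)) = (m + 1) • (a ^ p) ^ m • φ a := by
    intro a m
    induction m with
    | zero => simp
    | succ m ih =>
      rw [pow_succ, hφ, ih, succ_nsmul _ (m + 1), smul_comm _ (m + 1), add_comm, smul_smul,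
        ← pow_succ', ← pow_mul, ← pow_mul, mul_comm p]
  have hconst : ∀ c : k, φ (algebraMap k A c) = 0 := by
    intro c
    have : ExpChar k p := .prime Fact.out
    obtain ⟨e, rfl⟩ := surjective_frobenius k p c
    obtain ⟨m, hm⟩ := Nat.exists_eq_succ_of_ne_zero (Fact.out : p.Prime).ne_zero
    rw [frobenius_def, map_pow]
    conv_lhs => rw [show p = m + 1 from hm, hpow, ← Nat.succ_eq_add_one, ← hm, hp0]
  let δ : Derivation k A (FrobOmega k p A) :=
    { toFun := φ
      map_add' := φ.map_add
      map_smul' c a := by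
        rw [Algebra.smul_def, hφ, hconst, smul_zero, add_zero]; rfl
      map_one_eq_zero' := hone
      leibniz' := hφ }
  refine ⟨
    { toFun := δ.liftKaehlerDifferential
      map_add' := δ.liftKaehlerDifferential.map_add
      map_smul' a m := δ.liftKaehlerDifferential.map_smul a m }, fun a => ?_⟩
  exact δ.liftKaehlerDifferential_comp_D a

variable {ψ ψ'}

lemma span_induction_kaehler {P : Ω[A⁄k] → Prop} (s : Set (Ω[A⁄k])) (hs : Submodule.span A s = ⊤)
    (h : ∀ m ∈ s, P m) (hzero : P 0) (hadd : ∀ m m', P m → P m' → P (m + m'))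
    (hsmul : ∀ (a : A) m, P m → P (a • m)) (m : Ω[A⁄k]) : P m := by
  have hm : m ∈ Submodule.span A s := hs ▸ Submodule.mem_top
  induction hm using Submodule.span_induction with
  | mem m hm => exact h m hm
  | zero => exact hzero
  | add m m' _ _ hm hm' => exact hadd m m' hm hm'
  | smul a m _ hm => exact hsmul a m hm

/-- If `ψ` takes closed values on a spanning set, then `⋀ψ` takes values in the closed forms. -/
lemma extD_twist (s : Set (Ω[A⁄k])) (hs : Submodule.span A s = ⊤)
    (h : ∀ m ∈ s, extD (ExteriorAlgebra.ι A (ψ m)) = 0) (x : Forms k A) :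
    extD (twist ψ x) = 0 := by
  have h1 : ∀ m, extD (ExteriorAlgebra.ι A (ψ m)) = 0 := by
    refine span_induction_kaehler s hs h (by simp) (fun m m' hm hm' => ?_) fun a m hm => ?_
    · rw [map_add, map_add, map_add, hm, hm', add_zero]
    · rw [map_smulₛₗ, map_smul, ofFun_smul]
      exact (extD_pow_mul k p a _).trans (by rw [hm, mul_zero])
  induction x using forms_induction with
  | hfun a => simp [dFun_pow_char]
  | hd a => rw [twist_dFun, h1]
  | hadd x y hx hy => rw [map_add, map_add, hx, hy, add_zero]
  | hmul x y hx hy => rw [map_mul, extD_mul, hx, hy, mul_zero, zero_mul, add_zero]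

/-- The group of exact forms. -/
abbrev exactForms (k A : Type*) [CommRing k] [CommRing A] [Algebra k A] :
    AddSubgroup (Forms k A) := extD.range

lemma mul_mem_exactForms {x y : Forms k A} (hx : extD x = 0) (hy : y ∈ exactForms k A) :
    x * y ∈ exactForms k A := by
  obtain ⟨z, rfl⟩ := hy
  exact ⟨hat x * z, by rw [extD_mul, extD_hat, hx, hat_hat]; simp⟩

lemma mul_mem_exactForms' {x y : Forms k A} (hx : x ∈ exactForms k A) (hy : extD y = 0) :
    x * y ∈ exactForms k A := by
  obtain ⟨z, rfl⟩ := hx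
  exact ⟨z * y, by rw [extD_mul, hy]; simp⟩

/-- Products of cohomologous closed forms are cohomologous. -/
lemma mul_sub_mul_mem_exactForms {x x' y y' : Forms k A} (hx : extD x = 0) (hy' : extD y' = 0)
    (h : x - x' ∈ exactForms k A) (h' : y - y' ∈ exactForms k A) :
    x * y - x' * y' ∈ exactForms k A := by
  have : x * y - x' * y' = x * (y - y') + (x - x') * y' := by noncomm_ring
  rw [this]
  exact add_mem (mul_mem_exactForms hx h') (mul_mem_exactForms' h hy')

/-- If `ψ` and `ψ'` have cohomologous closed values on a spanning set, then so have `⋀ψ` and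
`⋀ψ'`. -/
lemma twist_sub_twist_mem (s : Set (Ω[A⁄k])) (hs : Submodule.span A s = ⊤)
    (hψ : ∀ x, extD (twist ψ x) = 0) (hψ' : ∀ x, extD (twist ψ' x) = 0)
    (h : ∀ m ∈ s, ExteriorAlgebra.ι A (ψ m) - ExteriorAlgebra.ι A (ψ' m) ∈ exactForms k A)
    (x : Forms k A) : twist ψ x - twist ψ' x ∈ exactForms k A := by
  have h1 : ∀ m, ExteriorAlgebra.ι A (ψ m) - ExteriorAlgebra.ι A (ψ' m) ∈ exactForms k A := by
    refine span_induction_kaehler s hs h (by simp) (fun m m' hm hm' => ?_) fun a m hm => ?_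
    · rw [map_add, map_add, map_add, map_add, add_sub_add_comm]
      exact add_mem hm hm'
    · rw [map_smulₛₗ, map_smulₛₗ ψ', map_smul, map_smul, ← smul_sub, ofFun_smul]
      refine mul_mem_exactForms ?_ hm
      rw [extD_ofFun]
      exact dFun_pow_char k p a
  induction x using forms_induction with
  | hfun a => simp
  | hd a => rw [twist_dFun, twist_dFun]; exact h1 _
  | hadd x y hx hy => rw [map_add, map_add, add_sub_add_comm]; exact add_mem hx hy
  | hmul x y hx hy =>
    rw [map_mul, map_mul]
    exact mul_sub_mul_mem_exactForms (hψ x) (hψ' y) hx hy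

end Twist

/-! ### Contraction and Lie derivative -/

section Lie

variable {k A : Type*} [CommRing k] [CommRing A] [Algebra k A]

/-- Contraction of forms with the vector field given by a linear form on `Ω[A⁄k]`. -/
def contr (f : Module.Dual A (Ω[A⁄k])) : Forms k A →ₗ[A] Forms k A :=
  CliffordAlgebra.contractLeft f

variable (f : Module.Dual A (Ω[A⁄k]))

@[simp] lemma contr_ofFun (a : A) : contr f (ofFun a) = 0 :=
  CliffordAlgebra.contractLeft_algebraMap _ _ _

@[simp] lemma contr_dFun (a : A) :
    contr f (dFun k a) = ofFun (f (KaehlerDifferential.D k A a)) :=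
  CliffordAlgebra.contractLeft_ι _ _ _

lemma contr_mul (x y : Forms k A) : contr f (x * y) = contr f x * y + hat x * contr f y := by
  induction x using forms_induction generalizing y with
  | hfun a =>
    rw [contr_ofFun, zero_mul, zero_add, hat_ofFun]
    exact CliffordAlgebra.contractLeft_algebraMap_mul _ _ _
  | hd a =>
    rw [contr_dFun, hat_dFun, neg_mul, ← sub_eq_add_neg, ← ofFun_smul]
    exact CliffordAlgebra.contractLeft_ι_mul _ _ _
  | hadd x x' hx hx' => simp only [add_mul, map_add, hx, hx']; abel
  | hmul x x' hx hx' =>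
    rw [mul_assoc, hx, hx', hx, map_mul]; noncomm_ring

lemma contr_hat (x : Forms k A) : contr f (hat x) = - hat (contr f x) := by
  induction x using forms_induction with
  | hfun a => simp
  | hd a => simp
  | hadd x x' hx hx' => simp only [map_add, hx, hx']; abel
  | hmul x x' hx hx' =>
    simp only [map_mul, contr_mul, hx, hx', map_add]; noncomm_ring

/-- The Lie derivative of forms, by Cartan's formula. -/
def lieDer : AddMonoid.End (Forms k A) :=
  extD.comp (contr f).toAddMonoidHom + (contr f).toAddMonoidHom.comp extD

lemma lieDer_apply (x : Forms k A) : lieDer f x = extD (contr f x) + contr f (extD x) := rfl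

lemma lieDer_mul (x y : Forms k A) : lieDer f (x * y) = lieDer f x * y + x * lieDer f y := by
  simp only [lieDer_apply, contr_mul, extD_mul, map_add, hat_hat, extD_hat, contr_hat]
  noncomm_ring

lemma lieDer_one : lieDer f (1 : Forms k A) = 0 := by
  have h := lieDer_mul f 1 1
  rwa [one_mul, one_mul, mul_one, left_eq_add] at h

lemma lieDer_extD (x : Forms k A) : lieDer f (extD x) = extD (lieDer f x) := by
  simp only [lieDer_apply, extD_extD, map_add, map_zero, zero_add, add_zero]

lemma lieDer_pow_extD (m : ℕ) (x : Forms k A) :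
    (lieDer f ^ m) (extD x) = extD ((lieDer f ^ m) x) := by
  induction m generalizing x with
  | zero => rfl
  | succ m ih =>
    rw [pow_succ]
    change (lieDer f ^ m) (lieDer f (extD x)) = _
    rw [lieDer_extD, ih]
    rfl

/-- By Cartan's formula, Lie derivatives of closed forms are exact. -/
lemma lieDer_pow_mem_exactForms (m : ℕ) {x : Forms k A} (hx : extD x = 0) :
    (lieDer f ^ (m + 1)) x ∈ exactForms k A := by
  refine ⟨contr f ((lieDer f ^ m) x), ?_⟩
  rw [pow_succ']
  change _ = lieDer f ((lieDer f ^ m) x)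
  rw [lieDer_apply, ← lieDer_pow_extD, hx, map_zero, map_zero, add_zero]

lemma lieDer_pow_eigen {x : Forms k A} {w : ℕ} (hx : lieDer f x = w • x) (m : ℕ) :
    (lieDer f ^ m) x = w ^ m • x := by
  induction m with
  | zero => simp
  | succ m ih =>
    rw [pow_succ']
    change lieDer f ((lieDer f ^ m) x) = _
    rw [ih, map_nsmul, hx, smul_smul, pow_succ]

lemma lieDer_mul_eigen {x y : Forms k A} {v w : ℕ} (hx : lieDer f x = v • x)
    (hy : lieDer f y = w • y) : lieDer f (x * y) = (v + w) • (x * y) := by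
  rw [lieDer_mul, hx, hy, smul_mul_assoc, mul_smul_comm, add_smul]

lemma lieDer_pow_one_eigen {x : Forms k A} (hx : lieDer f x = x) (m : ℕ) :
    lieDer f (x ^ m) = m • x ^ m := by
  induction m with
  | zero => rw [pow_zero, zero_smul, lieDer_one]
  | succ m ih =>
    rw [pow_succ]
    exact lieDer_mul_eigen f ih (by rw [hx, one_smul])

variable (p : ℕ)

/-- The operator `1 - Lᵖ⁻¹`, the projection to the forms of weight divisible by `p`. -/
def weightProj : AddMonoid.End (Forms k A) := 1 - lieDer f ^ (p - 1)

lemma weightProj_apply (x : Forms k A) : weightProj f p x = x - (lieDer f ^ (p - 1)) x := rfl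

lemma weightProj_extD (x : Forms k A) : weightProj f p (extD x) = extD (weightProj f p x) := by
  rw [weightProj_apply, weightProj_apply, lieDer_pow_extD, map_sub]

variable [Fact p.Prime]

lemma sub_weightProj_mem {x : Forms k A} (hx : extD x = 0) :
    x - weightProj f p x ∈ exactForms k A := by
  obtain ⟨m, hm⟩ := Nat.exists_eq_add_of_le' (Fact.out : p.Prime).two_le
  rw [weightProj_apply, sub_sub_cancel, hm]
  exact lieDer_pow_mem_exactForms f m hx

omit [Fact p.Prime] in
lemma weightProj_mul {x : Forms k A} (hx : lieDer f x = 0) (y : Forms k A) :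
    weightProj f p (x * y) = x * weightProj f p y := by
  have : ∀ m : ℕ, (lieDer f ^ m) (x * y) = x * (lieDer f ^ m) y := by
    intro m
    induction m with
    | zero => rfl
    | succ m ih =>
      rw [pow_succ']
      change lieDer f ((lieDer f ^ m) (x * y)) = x * lieDer f ((lieDer f ^ m) y)
      rw [ih, lieDer_mul, hx, zero_mul, zero_add]
  rw [weightProj_apply, weightProj_apply, this, mul_sub]

lemma weightProj_of_dvd (hp : ∀ x : Forms k A, p • x = 0) {x : Forms k A} {w : ℕ}
    (hx : lieDer f x = w • x) (hw : p ∣ w) : weightProj f p x = x := by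
  have h : w ^ (p - 1) • x = 0 := by
    obtain ⟨c, hc⟩ := hw.trans (dvd_pow_self w (Nat.sub_pos_of_lt
      (Fact.out : p.Prime).one_lt).ne')
    rw [hc, mul_smul, hp]
  rw [weightProj_apply, lieDer_pow_eigen f hx, h, sub_zero]

lemma weightProj_of_not_dvd (hp : ∀ x : Forms k A, p • x = 0) {x : Forms k A} {w : ℕ}
    (hx : lieDer f x = w • x) (hw : ¬ p ∣ w) : weightProj f p x = 0 := by
  have h : w ^ (p - 1) ≡ 1 [MOD p] := by
    rw [← Nat.totient_prime Fact.out]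
    exact Nat.ModEq.pow_totient (((Fact.out : p.Prime).coprime_iff_not_dvd.2 hw).symm)
  have h1 : 1 ≤ w ^ (p - 1) := Nat.one_le_iff_ne_zero.2 fun h0 => hw (by
    rw [eq_zero_of_pow_eq_zero h0]; exact dvd_zero p)
  obtain ⟨c, hc⟩ := (Nat.modEq_iff_dvd' h1).1 h.symm
  rw [weightProj_apply, lieDer_pow_eigen f hx,
    show w ^ (p - 1) = 1 + p * c by omega, add_smul, one_smul, mul_smul, hp, add_zero, sub_self]

end Lie

/-! ### Homogeneous components of forms -/

section Degree

variable {k A : Type*} [CommRing k] [CommRing A] [Algebra k A]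

/-- The homogeneous component of degree `i` of a form. -/
def degProj (i : ℕ) : Forms k A →+ Forms k A where
  toFun x := DirectSum.decompose (fun i => ⋀[A]^i (Ω[A⁄k])) x i
  map_zero' := by simp
  map_add' x y := by simp

lemma degProj_mem (i : ℕ) (x : Forms k A) : degProj i x ∈ ⋀[A]^i (Ω[A⁄k]) :=
  Subtype.mem (DirectSum.decompose (fun i => ⋀[A]^i (Ω[A⁄k])) x i)

lemma degProj_same {i : ℕ} {x : Forms k A} (hx : x ∈ ⋀[A]^i (Ω[A⁄k])) : degProj i x = x :=
  DirectSum.decompose_of_mem_same (fun i => ⋀[A]^i (Ω[A⁄k])) hx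

lemma degProj_ne {i j : ℕ} {x : Forms k A} (hx : x ∈ ⋀[A]^j (Ω[A⁄k])) (h : j ≠ i) :
    degProj i x = 0 :=
  DirectSum.decompose_of_mem_ne (fun i => ⋀[A]^i (Ω[A⁄k])) hx h

@[elab_as_elim]
lemma homogeneous_induction {P : Forms k A → Prop} (hzero : P 0)
    (hadd : ∀ x y, P x → P y → P (x + y)) (hom : ∀ i, ∀ x ∈ ⋀[A]^i (Ω[A⁄k]), P x)
    (x : Forms k A) : P x := by
  induction x using DirectSum.Decomposition.inductionOn fun i => ⋀[A]^i (Ω[A⁄k]) with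
  | zero => exact hzero
  | add x y hx hy => exact hadd x y hx hy
  | homogeneous x => exact hom _ _ x.2

lemma degProj_map {B k' : Type*} [CommRing k'] [CommRing B] [Algebra k' B] (d : ℕ)
    (T : Forms k A →+ Forms k' B)
    (hT : ∀ i, ∀ x ∈ ⋀[A]^i (Ω[A⁄k]), T x ∈ ⋀[B]^(i + d) (Ω[B⁄k'])) (i : ℕ) (x : Forms k A) :
    degProj (i + d) (T x) = T (degProj i x) := by
  induction x using homogeneous_induction with
  | hzero => simp
  | hadd x y hx hy => simp only [map_add, hx, hy]
  | hom j x hx =>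
    by_cases h : j = i
    · subst h; rw [degProj_same hx, degProj_same (hT _ _ hx)]
    · rw [degProj_ne hx h, degProj_ne (hT _ _ hx) (by omega), map_zero]

lemma degProj_succ_extD (i : ℕ) (x : Forms k A) :
    degProj (i + 1) (extD x) = extD (degProj i x) :=
  degProj_map 1 extD (fun _ _ hx => extD_mem hx) i x

lemma degProj_zero_extD (x : Forms k A) : degProj 0 (extD x) = 0 := by
  induction x using homogeneous_induction with
  | hzero => simp
  | hadd x y hx hy => simp only [map_add, hx, hy, add_zero]
  | hom j x hx => exact degProj_ne (extD_mem hx) (by omega)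

lemma degProj_formsMap {B : Type*} [CommRing B] [Algebra k B] (g : A →ₐ[k] B) (i : ℕ)
    (x : Forms k A) : degProj i (formsMap g x) = formsMap g (degProj i x) :=
  degProj_map 0 (formsMap g).toAddMonoidHom (fun _ _ hx => formsMap_mem g hx) i x

lemma degProj_mem_exactForms (i : ℕ) {x : Forms k A} (hx : x ∈ exactForms k A) :
    degProj i x ∈ exactForms k A := by
  obtain ⟨y, rfl⟩ := hx
  cases i with
  | zero => rw [degProj_zero_extD]; exact zero_mem _
  | succ i => rw [degProj_succ_extD]; exact ⟨_, rfl⟩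

/-- Differentials have no component of degree `0`. -/
lemma eq_zero_of_mem_exactForms_zero {x : Forms k A} (hx : x ∈ exactForms k A)
    (hi : x ∈ ⋀[A]^0 (Ω[A⁄k])) : x = 0 := by
  obtain ⟨y, rfl⟩ := hx
  rw [← degProj_same hi, degProj_zero_extD]

lemma degProj_twist {k : Type u} [Field k] {p : ℕ} [CharP k p] [Fact p.Prime]
    {A : Type u} [CommRing A] [Algebra k A] (ψ : Ω[A⁄k] →ₛₗ[frobHom k p A] Ω[A⁄k])
    (i : ℕ) (x : Forms k A) : degProj i (twist ψ x) = twist ψ (degProj i x) :=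
  degProj_map 0 (twist ψ).toAddMonoidHom (fun _ _ hx => twist_mem ψ hx) i x

end Degree

/-! ### The Cartier isomorphism in coordinates -/

/-- Coordinates of an algebra `A` over a field of characteristic `p`: elements whose differentials
are a basis of the differentials of `A` and that generate `A` over the ring of `p`-th powers. -/
structure Coordinates (k : Type u) (p : ℕ) (A : Type u) [CommRing k] [CommRing A] [Algebra k A]
    (n : ℕ) where
  /-- The coordinate functions. -/
  x : Fin n → A
  /-- The basis given by the differentials of the coordinate functions. -/
  basis : Module.Basis (Fin n) A (Ω[A⁄k])
  basis_apply (i : Fin n) : basis i = KaehlerDifferential.D k A (x i)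
  mem_closure (a : A) : a ∈ Subring.closure (Set.range (fun b : A => b ^ p) ∪ Set.range x)

namespace Coordinates

variable {k : Type u} [Field k] {p : ℕ} [CharP k p] [Fact p.Prime]
variable {A : Type u} [CommRing A] [Algebra k A] {n : ℕ} (c : Coordinates k p A n)

/-- The vector field `xᵢ ∂/∂xᵢ`. -/
def euler (i : Fin n) : Module.Dual A (Ω[A⁄k]) := c.x i • c.basis.coord i

lemma dFun_pow_mul_dFun {k A : Type*} [CommRing k] [CommRing A] [Algebra k A] (a : A) (m : ℕ) :
    dFun k (a ^ m) * dFun k a = 0 := by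
  induction m with
  | zero => simp [dFun]
  | succ m ih =>
    rw [pow_succ, dFun_mul, add_mul, mul_assoc, mul_assoc, ih, dFun_sq, mul_zero, mul_zero,
      add_zero]

omit [CharP k p] [Fact p.Prime] in
lemma euler_D (i j : Fin n) :
    c.euler i (KaehlerDifferential.D k A (c.x j)) = if i = j then c.x j else 0 := by
  rw [← c.basis_apply, euler, LinearMap.smul_apply, Module.Basis.coord_apply,
    Module.Basis.repr_self]
  split_ifs with h
  · subst h; simp
  · simp [Ne.symm h]

omit [CharP k p] [Fact p.Prime] in
lemma lieDer_x (i j : Fin n) : lieDer (c.euler i) (ofFun (c.x j)) =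
    if i = j then ofFun (c.x j) else 0 := by
  rw [lieDer_apply, contr_ofFun, map_zero, zero_add, extD_ofFun, contr_dFun, euler_D]
  split_ifs <;> simp [ofFun]

omit [CharP k p] [Fact p.Prime] in
lemma lieDer_dx (i j : Fin n) : lieDer (c.euler i) (dFun k (c.x j)) =
    if i = j then dFun k (c.x j) else 0 := by
  rw [← extD_ofFun, lieDer_extD, lieDer_x]
  split_ifs <;> simp

omit [CharP k p] [Fact p.Prime] in
lemma span_range_dx :
    Submodule.span A (Set.range fun i => KaehlerDifferential.D k A (c.x i)) = ⊤ := by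
  simp_rw [← c.basis_apply]
  exact c.basis.span_eq

variable {τ : Ω[A⁄k] →ₛₗ[frobHom k p A] Ω[A⁄k]}
  (hτ : ∀ i, τ (KaehlerDifferential.D k A (c.x i)) =
    c.x i ^ (p - 1) • KaehlerDifferential.D k A (c.x i))

include hτ

lemma twist_dx (i : Fin n) :
    twist τ (dFun k (c.x i)) = ofFun (c.x i) ^ (p - 1) * dFun k (c.x i) := by
  rw [twist_dFun, hτ, map_smul, ofFun_smul, ofFun, map_pow]; rfl

omit hτ [Fact p.Prime] in
lemma char_smul_forms (x : Forms k A) : p • x = 0 := by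
  have : Algebra k (Forms k A) := Algebra.compHom _ (algebraMap k A)
  rw [← Nat.cast_smul_eq_nsmul A, ← map_natCast (algebraMap k A), CharP.cast_eq_zero, map_zero,
    zero_smul]

omit hτ [CharP k p] [Fact p.Prime] in
lemma lieDer_dx_weight (i : Fin n) (a : ℕ) :
    lieDer (c.euler i) (ofFun (c.x i) ^ a * dFun k (c.x i)) =
      (a + 1) • (ofFun (c.x i) ^ a * dFun k (c.x i)) :=
  lieDer_mul_eigen _ (lieDer_pow_one_eigen _ (by simp [lieDer_x]) a) (by simp [lieDer_dx])

/-- The image of `⋀τ` has weight `0` for all Euler fields. -/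
lemma lieDer_twist (i : Fin n) (z : Forms k A) : lieDer (c.euler i) (twist τ z) = 0 := by
  have h1 : ∀ m, lieDer (c.euler i) (ExteriorAlgebra.ι A (τ m)) = 0 := by
    refine span_induction_kaehler _ c.span_range_dx ?_ (by simp) (fun m m' hm hm' => ?_)
      fun a m hm => ?_
    · rintro _ ⟨j, rfl⟩
      rw [← twist_ι]
      change lieDer _ (twist τ (dFun k (c.x j))) = 0
      rw [twist_dx c hτ]
      by_cases h : i = j
      · subst h
        rw [lieDer_dx_weight c, Nat.sub_add_cancel (Fact.out : p.Prime).one_le,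
          char_smul_forms]
      · have h1 : lieDer (c.euler i) (ofFun (c.x j)) = 0 • ofFun (c.x j) := by
          simp [lieDer_x, h]
        have h2 : ∀ a : ℕ, lieDer (c.euler i) (ofFun (c.x j) ^ a) = 0 := by
          intro a
          induction a with
          | zero => rw [pow_zero, lieDer_one]
          | succ a ih => rw [pow_succ, lieDer_mul, ih, h1]; simp
        rw [lieDer_mul, h2, lieDer_dx]
        simp [h]
    · rw [map_add, map_add, map_add, hm, hm', add_zero]
    · rw [map_smulₛₗ, map_smul, ofFun_smul, lieDer_mul, hm, mul_zero, add_zero, lieDer_apply]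
      change (extD (contr _ (ofFun (a ^ p))) + contr _ (extD (ofFun (a ^ p)))) * _ = _
      rw [contr_ofFun, extD_ofFun, dFun_pow_char]
      simp
  induction z using forms_induction with
  | hfun a => rw [twist_ofFun, lieDer_apply, contr_ofFun, extD_ofFun, dFun_pow_char]; simp
  | hd a => rw [twist_dFun, h1]
  | hadd x y hx hy => rw [map_add, map_add, hx, hy, add_zero]
  | hmul x y hx hy => rw [map_mul, lieDer_mul, hx, hy, mul_zero, zero_mul, add_zero]

omit hτ in
variable (τ) in
/-- The ring of forms generated by the image of `⋀τ`, the coordinates in a set `J` and their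
differentials. -/
def partialForms (J : Finset (Fin n)) : Subring (Forms k A) :=
  Subring.closure (Set.range (twist τ) ∪
    {y | ∃ j ∈ J, y = ofFun (c.x j) ∨ y = dFun k (c.x j)})

omit hτ in
lemma twist_mem_partialForms (J : Finset (Fin n)) (z : Forms k A) :
    twist τ z ∈ c.partialForms τ J := Subring.subset_closure (.inl ⟨z, rfl⟩)

omit hτ in
lemma partialForms_univ : c.partialForms τ Finset.univ = ⊤ := by
  refine eq_top_iff.2 fun y _ => ?_
  have hx : ∀ a : A, ofFun a ∈ c.partialForms τ Finset.univ := fun a => by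
    refine Subring.closure_induction (p := fun a _ => ofFun a ∈ c.partialForms τ Finset.univ)
      ?_ ?_ ?_ ?_ ?_ ?_ (c.mem_closure a)
    · rintro _ (⟨b, rfl⟩ | ⟨j, rfl⟩)
      · change ofFun (b ^ p) ∈ _
        rw [← twist_ofFun τ]; exact c.twist_mem_partialForms _ _
      · exact Subring.subset_closure (.inr ⟨j, Finset.mem_univ j, .inl rfl⟩)
    · rw [ofFun, map_zero]; exact zero_mem _
    · rw [ofFun, map_one]; exact one_mem _
    · intro a b _ _ ha hb; rw [ofFun_add]; exact add_mem ha hb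
    · intro a _ ha; rw [ofFun, map_neg]; exact neg_mem ha
    · intro a b _ _ ha hb; rw [ofFun_mul]; exact mul_mem ha hb
  have hm : ∀ m, ExteriorAlgebra.ι A m ∈ c.partialForms τ Finset.univ := by
    refine span_induction_kaehler _ c.span_range_dx ?_ ?_ (fun m m' hm hm' => ?_) fun a m hm => ?_
    · rintro _ ⟨j, rfl⟩
      exact Subring.subset_closure (.inr ⟨j, Finset.mem_univ j, .inr rfl⟩)
    · rw [map_zero]; exact zero_mem _
    · rw [map_add]; exact add_mem hm hm'
    · rw [map_smul, ofFun_smul]; exact mul_mem (hx a) hm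
  induction y using forms_induction with
  | hfun a => exact hx a
  | hd a => exact hm _
  | hadd x y hx hy => exact add_mem (hx trivial) (hy trivial)
  | hmul x y hx hy => exact mul_mem (hx trivial) (hy trivial)

omit hτ in
lemma hat_mem_partialForms (J : Finset (Fin n)) {r : Forms k A} (hr : r ∈ c.partialForms τ J) :
    hat r ∈ c.partialForms τ J := by
  induction hr using Subring.closure_induction with
  | mem y hy =>
    obtain ⟨z, rfl⟩ | ⟨j, hj, rfl | rfl⟩ := hy
    · rw [← twist_hat]; exact c.twist_mem_partialForms _ _
    · rw [hat_ofFun]; exact Subring.subset_closure (.inr ⟨j, hj, .inl rfl⟩)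
    · rw [hat_dFun]; exact neg_mem (Subring.subset_closure (.inr ⟨j, hj, .inr rfl⟩))
  | zero => rw [map_zero]; exact zero_mem _
  | one => rw [map_one]; exact one_mem _
  | add x y _ _ hx hy => rw [map_add]; exact add_mem hx hy
  | neg x _ hx => rw [map_neg]; exact neg_mem hx
  | mul x y _ _ hx hy => rw [map_mul]; exact mul_mem hx hy

lemma lieDer_partialForms {J : Finset (Fin n)} {i : Fin n} (hi : i ∉ J) {r : Forms k A}
    (hr : r ∈ c.partialForms τ J) : lieDer (c.euler i) r = 0 := by
  induction hr using Subring.closure_induction with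
  | mem y hy =>
    obtain ⟨z, rfl⟩ | ⟨j, hj, rfl | rfl⟩ := hy
    · exact c.lieDer_twist hτ i z
    · rw [lieDer_x, if_neg]; rintro rfl; exact hi hj
    · rw [lieDer_dx, if_neg]; rintro rfl; exact hi hj
  | zero => exact map_zero _
  | one => simpa using c.lieDer_twist hτ i 1
  | add x y _ _ hx hy => rw [map_add, hx, hy, add_zero]
  | neg x _ hx => rw [map_neg, hx, neg_zero]
  | mul x y _ _ hx hy => rw [lieDer_mul, hx, hy, zero_mul, mul_zero, add_zero]

omit hτ in
/-- Adjoining `x` and `dx` for one more coordinate `x` only requires the multiples of `xᵃ` and of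
`xᵃ dx` from the left. -/
lemma partialForms_insert_le (J : Finset (Fin n)) (i : Fin n) {y : Forms k A}
    (hy : y ∈ c.partialForms τ (insert i J)) :
    y ∈ AddSubgroup.closure {s | ∃ r ∈ c.partialForms τ J, ∃ a : ℕ,
      s = r * ofFun (c.x i) ^ a ∨ s = r * (ofFun (c.x i) ^ a * dFun k (c.x i))} := by
  set G := {s | ∃ r ∈ c.partialForms τ J, ∃ a : ℕ,
      s = r * ofFun (c.x i) ^ a ∨ s = r * (ofFun (c.x i) ^ a * dFun k (c.x i))} with hG
  have hR : ∀ r ∈ c.partialForms τ J, ∀ s ∈ G, r * s ∈ G := by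
    rintro r hr _ ⟨r', hr', a, rfl | rfl⟩
    · exact ⟨r * r', mul_mem hr hr', a, .inl (mul_assoc _ _ _).symm⟩
    · exact ⟨r * r', mul_mem hr hr', a, .inr (mul_assoc _ _ _).symm⟩
  have hgen : ∀ y, y ∈ Set.range (twist τ) ∪
      {y | ∃ j ∈ insert i J, y = ofFun (c.x j) ∨ y = dFun k (c.x j)} →
      ∀ s ∈ G, y * s ∈ AddSubgroup.closure G := by
    rintro _ (⟨z, rfl⟩ | ⟨j, hj, h⟩) s hs
    · exact AddSubgroup.subset_closure (hR _ (c.twist_mem_partialForms J z) s hs)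
    rcases Finset.mem_insert.1 hj with rfl | hj
    · obtain ⟨r, hr, a, hs⟩ := hs
      rcases h with rfl | rfl <;> rcases hs with rfl | rfl
      · refine AddSubgroup.subset_closure ⟨r, hr, a + 1, .inl ?_⟩
        rw [pow_succ', ← mul_assoc, ofFun_mul_comm, mul_assoc]
      · refine AddSubgroup.subset_closure ⟨r, hr, a + 1, .inr ?_⟩
        rw [pow_succ', ← mul_assoc, ofFun_mul_comm, mul_assoc, mul_assoc]
      · refine AddSubgroup.subset_closure ⟨hat r, c.hat_mem_partialForms J hr, a, .inr ?_⟩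
        rw [← mul_assoc, ← hat_mul_dFun, mul_assoc, ← hat_mul_dFun, map_pow, hat_ofFun]
      · have : dFun k (c.x j) * (r * (ofFun (c.x j) ^ a * dFun k (c.x j))) = 0 := by
          rw [← mul_assoc, ← mul_assoc, ← hat_mul_dFun, mul_assoc (hat r), ← hat_mul_dFun, mul_assoc,
            mul_assoc, dFun_sq, mul_zero, mul_zero]
        rw [this]; exact zero_mem _
    · exact AddSubgroup.subset_closure
        (hR _ (Subring.subset_closure (.inr ⟨j, hj, h⟩)) s hs)
  have hmul : ∀ y ∈ c.partialForms τ (insert i J), ∀ s ∈ AddSubgroup.closure G,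
      y * s ∈ AddSubgroup.closure G := by
    intro y hy
    induction hy using Subring.closure_induction with
    | mem y hy =>
      intro s hs
      induction hs using AddSubgroup.closure_induction with
      | mem s hs => exact hgen y hy s hs
      | zero => rw [mul_zero]; exact zero_mem _
      | add s t _ _ hs ht => rw [mul_add]; exact add_mem hs ht
      | neg s _ hs => rw [mul_neg]; exact neg_mem hs
    | zero => intro s _; rw [zero_mul]; exact zero_mem _
    | one => intro s hs; rwa [one_mul]
    | add x y _ _ hx hy => intro s hs; rw [add_mul]; exact add_mem (hx s hs) (hy s hs)
    | neg x _ hx => intro s hs; rw [neg_mul]; exact neg_mem (hx s hs)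
    | mul x y _ _ hx hy => intro s hs; rw [mul_assoc]; exact hx _ (hy s hs)
  have h1 : (1 : Forms k A) ∈ AddSubgroup.closure G :=
    AddSubgroup.subset_closure ⟨1, one_mem _, 0, .inl (by simp)⟩
  simpa using hmul y hy 1 h1

/-- The projection to weights divisible by `p` removes a coordinate `x` and its differential: it
leaves the multiples of `x ^ (p * b)` and of `x ^ (p * b) * (x ^ (p - 1) * dx)`. -/
lemma weightProj_mem_partialForms {J : Finset (Fin n)} {i : Fin n} (hi : i ∉ J) {y : Forms k A}
    (hy : y ∈ c.partialForms τ (insert i J)) :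
    weightProj (c.euler i) p y ∈ c.partialForms τ J := by
  replace hy := c.partialForms_insert_le J i hy
  have hp := char_smul_forms (k := k) (p := p) (A := A)
  have hpow : ∀ b : ℕ, (ofFun (c.x i) : Forms k A) ^ (p * b) ∈ c.partialForms τ J := fun b => by
    have : (ofFun (c.x i) : Forms k A) ^ (p * b) = twist τ (ofFun (c.x i ^ b)) := by
      rw [twist_ofFun, ← pow_mul, mul_comm b, ofFun, ofFun, map_pow]
    rw [this]; exact c.twist_mem_partialForms J _
  induction hy using AddSubgroup.closure_induction with
  | mem s hs =>
    obtain ⟨r, hr, a, rfl | rfl⟩ := hs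
    · rw [weightProj_mul _ _ (c.lieDer_partialForms hτ hi hr)]
      refine mul_mem hr ?_
      have hw := lieDer_pow_one_eigen (c.euler i) (x := ofFun (c.x i)) (by simp [lieDer_x]) a
      by_cases h : p ∣ a
      · rw [weightProj_of_dvd _ p hp hw h]
        obtain ⟨b, rfl⟩ := h
        exact hpow b
      · rw [weightProj_of_not_dvd _ p hp hw h]; exact zero_mem _
    · rw [weightProj_mul _ _ (c.lieDer_partialForms hτ hi hr)]
      refine mul_mem hr ?_
      have hw := c.lieDer_dx_weight i a
      by_cases h : p ∣ a + 1
      · rw [weightProj_of_dvd _ p hp hw h]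
        obtain ⟨b, hb⟩ := h
        obtain ⟨b, rfl⟩ : ∃ b', b = b' + 1 := Nat.exists_eq_succ_of_ne_zero (by
          rintro rfl; simp at hb)
        have ha : a = p * b + (p - 1) := by
          have := (Fact.out : p.Prime).one_le
          rw [Nat.mul_succ] at hb; omega
        rw [ha, pow_add, mul_assoc, ← c.twist_dx hτ]
        exact mul_mem (hpow b) (c.twist_mem_partialForms J _)
      · rw [weightProj_of_not_dvd _ p hp hw h]; exact zero_mem _
  | zero => rw [map_zero]; exact zero_mem _
  | add s t _ _ hs ht => rw [map_add]; exact add_mem hs ht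
  | neg s _ hs => rw [map_neg]; exact neg_mem hs

/-- The composition of the projections to weights divisible by `p` is homotopic to the identity
and projects to the image of `⋀τ`. -/
lemma exists_projection (J : Finset (Fin n)) : ∃ Q : AddMonoid.End (Forms k A),
    (∀ x, Q (extD x) = extD (Q x)) ∧ (∀ x, extD x = 0 → x - Q x ∈ exactForms k A) ∧
    (∀ z, Q (twist τ z) = twist τ z) ∧ ∀ y ∈ c.partialForms τ J, Q y ∈ Set.range (twist τ) := by
  induction J using Finset.induction_on with
  | empty =>
    refine ⟨1, fun _ => rfl, fun x _ => ?_, fun _ => rfl, fun y hy => ?_⟩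
    · rw [AddMonoid.End.coe_one, id, sub_self]; exact zero_mem _
    · have : c.partialForms τ ∅ = (twist τ).range := by
        rw [partialForms]
        simp only [Finset.notMem_empty, false_and, exists_false, Set.ofPred_false, Set.union_empty]
        exact Subring.closure_eq (twist τ).range
      rw [this] at hy
      exact hy
  | insert i J hi ih =>
    obtain ⟨Q, h1, h2, h3, h4⟩ := ih
    refine ⟨Q * weightProj (c.euler i) p, fun x => ?_, fun x hx => ?_, fun z => ?_, fun y hy => ?_⟩
    · change Q (weightProj _ p (extD x)) = extD (Q (weightProj _ p x))
      rw [weightProj_extD, h1]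
    · change x - Q (weightProj _ p x) ∈ _
      rw [← sub_add_sub_cancel x (weightProj (c.euler i) p x)]
      refine add_mem (sub_weightProj_mem _ p hx) (h2 _ ?_)
      rw [← weightProj_extD, hx, map_zero]
    · change Q (weightProj _ p (twist τ z)) = _
      rw [weightProj_of_dvd _ p (char_smul_forms (k := k)) (w := 0) (by
        rw [c.lieDer_twist hτ, zero_smul]) (dvd_zero p), h3]
    · exact h4 _ (c.weightProj_mem_partialForms hτ hi hy)

lemma extD_twist_eq_zero (x : Forms k A) : extD (twist τ x) = 0 := by
  refine extD_twist _ c.span_range_dx ?_ x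
  rintro _ ⟨j, rfl⟩
  rw [hτ, map_smul, ofFun_smul]
  change extD (ofFun _ * dFun k _) = 0
  rw [extD_mul, extD_dFun, extD_ofFun, mul_zero, zero_add]
  exact dFun_pow_mul_dFun _ _

variable [IsDomain A]

omit hτ [CharP k p] [Fact p.Prime] in
lemma x_ne_zero (i : Fin n) : c.x i ≠ 0 := fun h =>
  c.basis.ne_zero i (by rw [c.basis_apply, h, map_zero])

omit [IsDomain A] hτ in
lemma twist_ιMulti (ψ : Ω[A⁄k] →ₛₗ[frobHom k p A] Ω[A⁄k]) {m : ℕ} (v : Fin m → Ω[A⁄k]) :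
    twist ψ (ExteriorAlgebra.ιMulti A m v) = ExteriorAlgebra.ιMulti A m (ψ ∘ v) := by
  rw [ExteriorAlgebra.ιMulti_apply, ExteriorAlgebra.ιMulti_apply, map_list_prod, List.map_ofFn]
  congr 2
  exact funext fun i => twist_ι ψ _

/-- The map `⋀τ` is diagonal with respect to the wedge products of the `dxᵢ`. -/
lemma twist_basis (s : Finset (Fin n)) : ∃ g : A, g ≠ 0 ∧
    twist τ (c.basis.ExteriorAlgebra s) = g • c.basis.ExteriorAlgebra s := by
  rw [ExteriorAlgebra.basis_apply]
  unfold ExteriorAlgebra.ιMulti_family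
  generalize hv : (c.basis ∘ _ : Fin s.card → _) = v
  obtain ⟨e, rfl⟩ : ∃ e : Fin s.card → Fin n, v = c.basis ∘ e := ⟨_, hv.symm⟩
  refine ⟨∏ j, c.x (e j) ^ (p - 1),
    Finset.prod_ne_zero_iff.2 fun j _ => pow_ne_zero _ (c.x_ne_zero _), ?_⟩
  rw [twist_ιMulti, ← AlternatingMap.map_smul_univ]
  congr 1
  funext j
  simp only [Function.comp_apply, c.basis_apply, hτ]

lemma twist_injective : Function.Injective (twist τ) := by
  refine (injective_iff_map_eq_zero _).2 fun z hz => ?_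
  choose g hg0 hg using c.twist_basis hτ
  refine c.basis.ExteriorAlgebra.repr.injective (Finsupp.ext fun s => ?_)
  rw [← c.basis.ExteriorAlgebra.sum_repr z, map_sum] at hz
  have h : ∀ s, twist τ (c.basis.ExteriorAlgebra.repr z s • c.basis.ExteriorAlgebra s) =
      (c.basis.ExteriorAlgebra.repr z s ^ p * g s) • c.basis.ExteriorAlgebra s := fun s => by
    rw [ofFun_smul, map_mul, twist_ofFun, hg, ← ofFun_smul, smul_smul]
  simp only [h] at hz
  have h1 := Fintype.linearIndependent_iff.1 c.basis.ExteriorAlgebra.linearIndependent _ hz s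
  rw [map_zero]
  exact eq_zero_of_pow_eq_zero ((mul_eq_zero.1 h1).resolve_right (hg0 s))

omit hτ

variable {ψ : Ω[A⁄k] →ₛₗ[frobHom k p A] Ω[A⁄k]} (hclosed : ∀ x, extD (twist ψ x) = 0)
  (hψ : ∀ a : A, ExteriorAlgebra.ι A (ψ (KaehlerDifferential.D k A a)) -
    ofFun (a ^ (p - 1)) * dFun k a ∈ exactForms k A)

include c hclosed hψ

omit [IsDomain A] in
/-- On cohomology `⋀ψ` agrees with `⋀τ` for the semilinear map `τ` with `τ(dxᵢ) = xᵢᵖ⁻¹ dxᵢ`. -/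
lemma twist_sub_mem_exactForms (hτ : ∀ i, τ (KaehlerDifferential.D k A (c.x i)) =
    c.x i ^ (p - 1) • KaehlerDifferential.D k A (c.x i)) (z : Forms k A) :
    twist ψ z - twist τ z ∈ exactForms k A := by
  refine twist_sub_twist_mem _ c.span_range_dx hclosed (c.extD_twist_eq_zero hτ) ?_ z
  rintro _ ⟨j, rfl⟩
  rw [hτ, map_smul, ofFun_smul]
  exact hψ _

omit [IsDomain A] in
/-- Surjectivity of the inverse Cartier operator: a closed form is cohomologous to its projection
`⋀τ(z)`, and hence to `⋀ψ(z)`. -/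
lemma exists_sub_twist_mem {x : Forms k A} (hx : extD x = 0) :
    ∃ z, x - twist ψ z ∈ exactForms k A := by
  obtain ⟨τ, hτ⟩ := exists_semilinear_of_basis (p := p) c.basis
    fun i => c.x i ^ (p - 1) • KaehlerDifferential.D k A (c.x i)
  simp only [c.basis_apply] at hτ
  obtain ⟨Q, -, h2, -, h4⟩ := c.exists_projection hτ Finset.univ
  obtain ⟨z, hz⟩ := h4 x (c.partialForms_univ ▸ trivial)
  refine ⟨z, ?_⟩
  have := sub_mem (h2 x hx) (c.twist_sub_mem_exactForms hclosed hψ hτ z)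
  rwa [← hz, sub_sub_sub_cancel_right] at this

/-- Injectivity of the inverse Cartier operator: if `⋀ψ(z)`, and hence `⋀τ(z)`, is exact, then
`⋀τ(z)` is also the differential of the projection of a form. The differential vanishes there. -/
lemma eq_zero_of_twist_mem {z : Forms k A} (hz : twist ψ z ∈ exactForms k A) : z = 0 := by
  obtain ⟨τ, hτ⟩ := exists_semilinear_of_basis (p := p) c.basis
    fun i => c.x i ^ (p - 1) • KaehlerDifferential.D k A (c.x i)
  simp only [c.basis_apply] at hτ
  obtain ⟨Q, h1, -, h3, h4⟩ := c.exists_projection hτ Finset.univ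
  have := sub_mem hz (c.twist_sub_mem_exactForms hclosed hψ hτ z)
  rw [sub_sub_cancel] at this
  obtain ⟨y, hy⟩ := this
  obtain ⟨w, hw⟩ := h4 y (c.partialForms_univ ▸ trivial)
  refine c.twist_injective hτ ?_
  rw [map_zero, ← h3, ← hy, h1, ← hw, c.extD_twist_eq_zero hτ]

end Coordinates

/-! ### Duality -/

section Duality

variable {k : Type u} [Field k] {p : ℕ} [CharP k p] [Fact p.Prime]
variable {A : Type u} [CommRing A] [Algebra k A]

/-- The form `η` of degree `i` is dual to `ω`: for all `z` of complementary degree `n - i`, the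
forms `⋀ψ(z) ∧ ω` and `⋀ψ(z ∧ η)` are cohomologous. If `⋀ψ` induces the inverse Cartier operator,
this means `C(⋀ψ(z) ∧ ω) = z ∧ η`. -/
def IsDual (ψ : Ω[A⁄k] →ₛₗ[frobHom k p A] Ω[A⁄k]) (n i : ℕ) (ω η : Forms k A) : Prop :=
  η ∈ ⋀[A]^i (Ω[A⁄k]) ∧ ∀ j, j + i = n → ∀ z ∈ ⋀[A]^j (Ω[A⁄k]),
    twist ψ z * ω - twist ψ (z * η) ∈ exactForms k A

variable {ψ : Ω[A⁄k] →ₛₗ[frobHom k p A] Ω[A⁄k]} {n i : ℕ} {ω ω' η η' : Forms k A}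

lemma IsDual.zero : IsDual ψ n i 0 0 :=
  ⟨zero_mem _, fun j _ z _ => by simp⟩

lemma IsDual.add (h : IsDual ψ n i ω η) (h' : IsDual ψ n i ω' η') :
    IsDual ψ n i (ω + ω') (η + η') :=
  ⟨add_mem h.1 h'.1, fun j hj z hz => by
    have := add_mem (h.2 j hj z hz) (h'.2 j hj z hz)
    rwa [← add_sub_add_comm, ← mul_add, ← map_add, ← mul_add] at this⟩

lemma IsDual.pow_mul (h : IsDual ψ n i ω η) (a : A) :
    IsDual ψ n i (ofFun (a ^ p) * ω) (ofFun a * η) :=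
  ⟨by simpa using forms_mul_mem (ofFun_mem a) h.1, fun j hj z hz => by
    have h1 : ofFun (a ^ p) * (twist ψ z * ω - twist ψ (z * η)) ∈ exactForms k A :=
      mul_mem_exactForms (by rw [extD_ofFun, dFun_pow_char]) (h.2 j hj z hz)
    have h2 : twist ψ z * (ofFun (a ^ p) * ω) - twist ψ (z * (ofFun a * η)) =
        ofFun (a ^ p) * (twist ψ z * ω - twist ψ (z * η)) := by
      rw [← mul_assoc z, ← ofFun_mul_comm a z, ← mul_assoc, ← ofFun_mul_comm, mul_assoc (ofFun a),
        map_mul, twist_ofFun, mul_sub, mul_assoc]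
    rwa [h2]⟩

lemma isDual_extD (hclosed : ∀ x, extD (twist ψ x) = 0) (ω : Forms k A) :
    IsDual ψ n i (extD ω) 0 :=
  ⟨zero_mem _, fun j _ z _ => by
    rw [mul_zero, map_zero, sub_zero]; exact mul_mem_exactForms (hclosed z) ⟨ω, rfl⟩⟩

lemma isDual_twist (hω : ω ∈ ⋀[A]^i (Ω[A⁄k])) : IsDual ψ n i (twist ψ ω) ω :=
  ⟨hω, fun j _ z _ => by rw [map_mul, sub_self]; exact zero_mem _⟩

variable (c : Coordinates k p A n)

/-- Duality can be checked on the wedge products of the differentials of the coordinates. -/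
lemma Coordinates.isDual_of_basis (hη : η ∈ ⋀[A]^i (Ω[A⁄k]))
    (h : ∀ s : Finset (Fin n), s.card + i = n → twist ψ (c.basis.ExteriorAlgebra s) * ω -
      twist ψ (c.basis.ExteriorAlgebra s * η) ∈ exactForms k A) : IsDual ψ n i ω η := by
  refine ⟨hη, fun j hj z hz => ?_⟩
  rw [← c.basis.ExteriorAlgebra.sum_repr z, map_sum, Finset.sum_mul, Finset.sum_mul, map_sum,
    ← Finset.sum_sub_distrib]
  refine sum_mem fun s _ => ?_
  by_cases hs : s.card = j
  · rw [ofFun_smul, map_mul, mul_assoc, mul_assoc, map_mul, ← mul_sub, twist_ofFun]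
    exact mul_mem_exactForms (by rw [extD_ofFun, dFun_pow_char]) (h s (by omega))
  · rw [repr_eq_zero_of_mem _ hz hs]; simp

lemma topCoeff_mul_degProj (b : Module.Basis (Fin n) A (Ω[A⁄k])) {j : ℕ} (hj : j + i = n)
    {z : Forms k A} (hz : z ∈ ⋀[A]^j (Ω[A⁄k])) (w : Forms k A) :
    topCoeff b (z * degProj i w) = topCoeff b (z * w) := by
  induction w using homogeneous_induction with
  | hzero => simp
  | hadd x y hx hy => simp only [map_add, mul_add, hx, hy]
  | hom l w hw =>
    by_cases h : l = i
    · subst h; rw [degProj_same hw]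
    · rw [degProj_ne hw h, mul_zero, map_zero, topCoeff_eq_zero b (forms_mul_mem hz hw) (by omega)]

variable [IsDomain A] (hclosed : ∀ x, extD (twist ψ x) = 0)
  (hψ : ∀ a : A, ExteriorAlgebra.ι A (ψ (KaehlerDifferential.D k A a)) -
    ofFun (a ^ (p - 1)) * dFun k a ∈ exactForms k A)

include c hclosed hψ

/-- The dual form is unique: by the injectivity of the inverse Cartier operator, it is determined
by its wedge products with the forms of complementary degree. -/
lemma IsDual.unique (h : IsDual ψ n i ω η) (h' : IsDual ψ n i ω η') : η = η' := by
  rw [← sub_eq_zero]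
  refine eq_zero_of_topCoeff_mul c.basis fun z => ?_
  induction z using homogeneous_induction with
  | hzero => simp
  | hadd x y hx hy => rw [add_mul, map_add, hx, hy, add_zero]
  | hom j z hz =>
    by_cases hj : j + i = n
    · have := sub_mem (h'.2 j hj z hz) (h.2 j hj z hz)
      rw [sub_sub_sub_cancel_left, ← map_sub, ← mul_sub] at this
      rw [c.eq_zero_of_twist_mem hclosed hψ this, map_zero]
    · exact topCoeff_eq_zero _ (forms_mul_mem hz (sub_mem h.1 h'.1)) hj

/-- The Cartier operator on forms of top degree: `u ↦ g` if the component of degree `n` of `u` is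
cohomologous to the image of `g dx₁ ∧ ⋯ ∧ dxₙ`. -/
lemma Coordinates.existsUnique_topCartier (u : Forms k A) :
    ∃! g : A, degProj n u - twist ψ (g • c.basis.ExteriorAlgebra Finset.univ) ∈
      exactForms k A := by
  have hcl : extD (degProj n u) = 0 :=
    exteriorPower_eq_zero c.basis (extD_mem (degProj_mem n u)) (Nat.lt_succ_self n)
  obtain ⟨z, hz⟩ := c.exists_sub_twist_mem hclosed hψ hcl
  refine ⟨topCoeff c.basis (degProj n z), ?_, fun g' hg' => ?_⟩
  · have := degProj_mem_exactForms n hz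
    rwa [map_sub, degProj_twist, degProj_same (degProj_mem n u),
      eq_topCoeff_smul c.basis (degProj_mem n z)] at this
  · have := sub_mem (degProj_mem_exactForms n hz) hg'
    rw [map_sub, degProj_twist, degProj_same (degProj_mem n u), sub_sub_sub_cancel_left,
      eq_topCoeff_smul c.basis (degProj_mem n z), ← map_sub, ← sub_smul] at this
    have := c.eq_zero_of_twist_mem hclosed hψ this
    have h2 := congrArg (topCoeff c.basis) this
    have h3 : topCoeff c.basis (c.basis.ExteriorAlgebra Finset.univ) = 1 := by simp [topCoeff]
    rw [map_smul, map_zero, h3, smul_eq_mul, mul_one] at h2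
    exact sub_eq_zero.1 h2

/-- The dual form exists: `z ↦ C(⋀ψ(z) ∧ ω)` is linear, hence it is represented by a form under the
perfect wedge pairing. -/
lemma Coordinates.exists_isDual (hω : ω ∈ ⋀[A]^i (Ω[A⁄k])) : ∃ η, IsDual ψ n i ω η := by
  choose C hC hC' using c.existsUnique_topCartier hclosed hψ
  simp only at hC hC'
  have hadd : ∀ u v, C (u + v) = C u + C v := fun u v => (hC' _ _ (by
    have := add_mem (hC u) (hC v)
    rwa [← add_sub_add_comm, ← map_add, ← map_add, ← add_smul] at this)).symm
  have hsmul : ∀ (a : A) (u), C (ofFun (a ^ p) * u) = a * C u := fun a u => (hC' _ _ (by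
    have : ofFun (a ^ p) * _ ∈ exactForms k A :=
      mul_mem_exactForms (by rw [extD_ofFun, dFun_pow_char]) (hC u)
    have h2 : degProj n (ofFun (a ^ p) * u) = ofFun (a ^ p) * degProj n u :=
      degProj_map 0 (AddMonoidHom.mulLeft (ofFun (a ^ p) : Forms k A)) (fun i x hx => by
        simpa using forms_mul_mem (ofFun_mem (a ^ p)) hx) n u
    rwa [h2, mul_smul, ofFun_smul, map_mul, twist_ofFun, ← mul_sub])).symm
  let l : Forms k A →ₗ[A] A :=
    { toFun z := C (twist ψ z * ω)
      map_add' z z' := by rw [map_add, add_mul, hadd]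
      map_smul' a z := by
        rw [ofFun_smul, map_mul, twist_ofFun, mul_assoc, hsmul]; rfl }
  obtain ⟨w, hw⟩ := exists_topCoeff_mul_eq c.basis l
  refine ⟨degProj i w, degProj_mem i w, fun j hj z hz => ?_⟩
  have h1 : z * degProj i w = C (twist ψ z * ω) • c.basis.ExteriorAlgebra Finset.univ := by
    have : z * degProj i w ∈ ⋀[A]^n (Ω[A⁄k]) := hj ▸ forms_mul_mem hz (degProj_mem i w)
    rw [eq_topCoeff_smul c.basis this, topCoeff_mul_degProj _ hj hz, hw]
    rfl
  have h2 : degProj n (twist ψ z * ω) = twist ψ z * ω :=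
    degProj_same (hj ▸ forms_mul_mem (twist_mem ψ hz) hω)
  have h3 := hC (twist ψ z * ω)
  rwa [h2, ← h1] at h3

end Duality

/-! ### Existence of coordinates -/

section Existence

open scoped TensorProduct

variable {k : Type u} [Field k] {p : ℕ} [CharP k p] [Fact p.Prime]
variable {A : Type u} [CommRing A] [Algebra k A] {n : ℕ}

/-- An unramified algebra of finite type that contains the `p`-th powers of its elements in the
image of the base is a quotient of the base: by unramifiedness the kernel of multiplication on
`A ⊗ A` is generated by an idempotent, which is nilpotent, so the extension is an epimorphism. -/
lemma algebraMap_surjective_of_pow_mem (R : Subalgebra k A) [Algebra.FiniteType R A]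
    [Algebra.FormallyUnramified R A] (h : ∀ a : A, a ^ p ∈ R) (a : A) : a ∈ R := by
  have hint : Algebra.IsIntegral R A := ⟨fun a => by
    refine IsIntegral.of_pow (Fact.out : p.Prime).pos ?_
    exact isIntegral_algebraMap (R := R) (x := ⟨a ^ p, h a⟩)⟩
  have : Module.Finite R A := Algebra.IsIntegral.finite
  obtain ⟨t, ht1, ht2⟩ := (Algebra.FormallyUnramified.iff_exists_tensorProduct
    (R := R) (S := A)).1 inferInstance
  have hnil : KaehlerDifferential.ideal R A ≤ nilradical (A ⊗[R] A) := by
    rw [← KaehlerDifferential.span_range_eq_ideal, Ideal.span_le]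
    rintro _ ⟨s, rfl⟩
    refine mem_nilradical.2 ⟨p, ?_⟩
    have h1 := add_pow_of_algebra k p ((1 : A) ⊗ₜ[R] s - s ⊗ₜ[R] (1 : A)) (s ⊗ₜ[R] (1 : A))
    rw [sub_add_cancel, Algebra.TensorProduct.tmul_pow, Algebra.TensorProduct.tmul_pow, one_pow]
      at h1
    have h2 : (1 : A) ⊗ₜ[R] (s ^ p) = (s ^ p) ⊗ₜ[R] (1 : A) := by
      have : s ^ p = (⟨s ^ p, h s⟩ : R) • (1 : A) := by
        rw [Algebra.smul_def, mul_one]; rfl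
      rw [this, TensorProduct.tmul_smul, TensorProduct.smul_tmul']
    rw [h2] at h1
    exact right_eq_add.1 h1
  have ht : IsUnit t := by
    have : t - 1 ∈ KaehlerDifferential.ideal R A := by
      rw [KaehlerDifferential.ideal, RingHom.mem_ker]
      change Algebra.TensorProduct.lmul' R (t - 1) = 0
      rw [map_sub, ht2, map_one, sub_self]
    have := (mem_nilradical.1 (hnil this)).isUnit_one_add
    rwa [add_sub_cancel] at this
  have hepi : Algebra.IsEpi R A := by
    rw [Algebra.isEpi_iff_forall_one_tmul_eq]
    intro s
    exact sub_eq_zero.1 ((ht.mul_left_eq_zero).1 (ht1 s))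
  obtain ⟨r, hr⟩ := Algebra.isEpi_iff_surjective_algebraMap_of_finite.1 hepi a
  exact hr ▸ r.2

/-- In an algebra of finite type over a perfect field, functions whose differentials are a basis
are coordinates. -/
def Coordinates.ofFiniteType [PerfectField k] [Algebra.FiniteType k A] (x : Fin n → A)
    (b : Module.Basis (Fin n) A (Ω[A⁄k])) (hb : ∀ i, b i = KaehlerDifferential.D k A (x i)) :
    Coordinates k p A n where
  x := x
  basis := b
  basis_apply := hb
  mem_closure a := by
    set R := Algebra.adjoin k (Set.range (fun b : A => b ^ p) ∪ Set.range x) with hR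
    have : Algebra.FiniteType R A := .of_restrictScalars_finiteType k R A
    -- `A` is unramified over `R = k[Aᵖ, x₁, …, xₙ]` because the `dxᵢ` generate `Ω[A⁄k]`.
    have hsurj := KaehlerDifferential.map_surjective_of_surjective k R A A Function.surjective_id
    have hunr : Algebra.FormallyUnramified R A := by
      refine ⟨subsingleton_of_forall_eq 0 fun y => ?_⟩
      obtain ⟨m, rfl⟩ := hsurj y
      refine span_induction_kaehler (P := fun m => KaehlerDifferential.map k R A A m = 0)
        (Set.range b) b.span_eq ?_ (map_zero _)
        (fun m m' hm hm' => ?_) (fun a m hm => ?_) m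
      · rintro _ ⟨i, rfl⟩
        simp only [hb, KaehlerDifferential.map_D]
        exact (KaehlerDifferential.D R A).map_algebraMap
          ⟨x i, Algebra.subset_adjoin (.inr ⟨i, rfl⟩)⟩
      · rw [map_add, hm, hm', add_zero]
      · rw [map_smul, hm, smul_zero]
    have ha : a ∈ R := algebraMap_surjective_of_pow_mem (p := p) R
      (fun a => Algebra.subset_adjoin (.inl ⟨a, rfl⟩)) a
    induction ha using Algebra.adjoin_induction with
    | mem y hy => exact Subring.subset_closure hy
    | algebraMap c =>
      -- Constants are `p`-th powers because `k` is perfect.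
      have : ExpChar k p := .prime Fact.out
      obtain ⟨e, rfl⟩ := surjective_frobenius k p c
      rw [frobenius_def, map_pow]
      exact Subring.subset_closure (.inl ⟨_, rfl⟩)
    | add y z _ _ hy hz => exact add_mem hy hz
    | mul y z _ _ hy hz => exact mul_mem hy hz

lemma nonempty_coordinates [PerfectField k] [Algebra.IsStandardSmoothOfRelativeDimension n k A] :
    Nonempty (Coordinates k p A n) := by
  obtain ⟨ι, σ, _, _, P, hP⟩ := Algebra.IsStandardSmoothOfRelativeDimension.out
    (n := n) (R := k) (S := A)
  have : Algebra.FiniteType k A := by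
    have := Algebra.IsStandardSmoothOfRelativeDimension.isStandardSmooth (R := k) (S := A) n
    infer_instance
  have hcard : Nat.card ((Set.range P.map)ᶜ : Set ι) = n := by
    have := Fintype.ofFinite ι
    have := Fintype.ofFinite σ
    rw [← hP, Algebra.Presentation.dimension, Nat.card_coe_set_eq, Set.ncard_compl,
      Set.ncard_range_of_injective P.map_inj]
  let e : ((Set.range P.map)ᶜ : Set ι) ≃ Fin n := Finite.equivFinOfCardEq hcard
  exact ⟨.ofFiniteType (fun i => P.val (e.symm i)) (P.basisKaehler.reindex e) fun i => by simp⟩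

/-- Coordinates stay coordinates in localizations. -/
def Coordinates.localize (c : Coordinates k p A n) {B : Type u} [CommRing B] [Algebra k B]
    [Algebra A B] [IsScalarTower k A B] (M : Submonoid A) [IsLocalization M B] :
    Coordinates k p B n where
  x i := algebraMap A B (c.x i)
  basis := c.basis.ofIsLocalizedModule B M (KaehlerDifferential.map k k A B)
  basis_apply i := by
    rw [Module.Basis.ofIsLocalizedModule_apply, c.basis_apply, KaehlerDifferential.map_D]
  mem_closure b := by
    obtain ⟨⟨a, s⟩, h⟩ := IsLocalization.surj M b
    have hA : ∀ a : A, algebraMap A B a ∈ Subring.closure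
        (Set.range (fun b : B => b ^ p) ∪ Set.range fun i => algebraMap A B (c.x i)) := by
      intro a
      refine Subring.closure_induction (p := fun a _ => algebraMap A B a ∈ Subring.closure
        (Set.range (fun b : B => b ^ p) ∪ Set.range fun i => algebraMap A B (c.x i)))
        ?_ ?_ ?_ ?_ ?_ ?_ (c.mem_closure a)
      · rintro _ (⟨b, rfl⟩ | ⟨j, rfl⟩)
        · exact Subring.subset_closure (.inl ⟨algebraMap A B b, (map_pow _ _ _).symm⟩)
        · exact Subring.subset_closure (.inr ⟨j, rfl⟩)
      · rw [map_zero]; exact zero_mem _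
      · rw [map_one]; exact one_mem _
      · intro a b _ _ ha hb; rw [map_add]; exact add_mem ha hb
      · intro a _ ha; rw [map_neg]; exact neg_mem ha
      · intro a b _ _ ha hb; rw [map_mul]; exact mul_mem ha hb
    obtain ⟨u, hu⟩ := IsLocalization.map_units B s
    -- `a / s = a * s ^ (p - 1) * (1 / s) ^ p`
    have hb : b = algebraMap A B (a * s ^ (p - 1)) * (↑u⁻¹ : B) ^ p := by
      have hp : (u : B) ^ (p - 1) * (↑u⁻¹ : B) ^ p = ↑u⁻¹ := by
        conv_lhs => rw [← Nat.sub_add_cancel (Fact.out : p.Prime).one_le, pow_succ]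
        rw [Nat.add_sub_cancel, ← mul_assoc, ← mul_pow, Units.mul_inv, one_pow, one_mul]
      rw [map_mul, map_pow, ← hu, mul_assoc, hp, ← h, ← hu, mul_assoc, Units.mul_inv, mul_one]
    rw [hb]
    exact mul_mem (hA _) (Subring.subset_closure (.inl ⟨_, rfl⟩))

end Existence

/-! ### Lifts of the Frobenius -/

section WittVectors

variable {k : Type u} [Field k] {p : ℕ} [Fact p.Prime] [CharP k p]

/-- In characteristic `p`, multiplication by `p` on Witt vectors is `(a₀, a₁) ↦ (0, a₀ᵖ)`. -/
lemma coeff_mul_natCast (a : TruncatedWittVector p 2 k) :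
    (a * p).coeff 0 = 0 ∧ (a * p).coeff 1 = a.coeff 0 ^ p := by
  obtain ⟨a, rfl⟩ := WittVector.truncate_surjective p 2 k a
  have : WittVector.truncate 2 a * (p : TruncatedWittVector p 2 k) =
      WittVector.truncate 2 (a * (p : WittVector p k)) := by
    rw [map_mul, map_natCast]
  rw [this]
  simp only [WittVector.coeff_truncate]
  exact ⟨WittVector.mul_charP_coeff_zero a, WittVector.mul_charP_coeff_succ a 0⟩

lemma wittResidue_eq_zero_of_mul {a : TruncatedWittVector p 2 k} (h : a * p = 0) :
    wittResidue k p a = 0 := by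
  have := (coeff_mul_natCast a).2
  rw [h, TruncatedWittVector.coeff_zero] at this
  exact eq_zero_of_pow_eq_zero this.symm

lemma natCast_mul_natCast_witt : (p : TruncatedWittVector p 2 k) * p = 0 := by
  ext i
  rw [TruncatedWittVector.coeff_zero]
  have h0 : (p : TruncatedWittVector p 2 k).coeff 0 = 0 := by
    simpa using (coeff_mul_natCast (1 : TruncatedWittVector p 2 k)).1
  fin_cases i
  · exact (coeff_mul_natCast _).1
  · refine (coeff_mul_natCast _).2.trans ?_
    rw [h0, zero_pow (Fact.out : p.Prime).ne_zero]

omit [CharP k p] in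
lemma wittResidue_surjective : Function.Surjective (wittResidue k p) := fun a =>
  ⟨TruncatedWittVector.mk p fun _ => a,
    TruncatedWittVector.coeff_mk (p := p) (fun _ : Fin 2 => a) 0⟩

lemma exists_eq_mul_of_wittResidue_eq_zero [PerfectField k] {a : TruncatedWittVector p 2 k}
    (h : wittResidue k p a = 0) : ∃ b : TruncatedWittVector p 2 k, a = b * p := by
  have : ExpChar k p := .prime Fact.out
  obtain ⟨e, he⟩ := surjective_frobenius k p (a.coeff 1)
  refine ⟨TruncatedWittVector.mk p fun _ => e, ?_⟩
  obtain ⟨h0, h1⟩ := coeff_mul_natCast (TruncatedWittVector.mk p fun _ : Fin 2 => e)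
  ext i
  fin_cases i
  · exact (show a.coeff 0 = 0 from h).trans h0.symm
  · refine Eq.trans ?_ h1.symm
    rw [TruncatedWittVector.coeff_mk]
    exact he.symm

end WittVectors

/-- A lift of the Frobenius of a ring `A` of characteristic `p` modulo `p²`: a ring `B` with
`B ⧸ p = A` that is flat modulo `p²`, in the sense that the annihilator of `p` is the ideal
generated by `p`, and an endomorphism `Φ` of `B` that reduces to the `p`-th power map. -/
structure IsFrobeniusLift (p : ℕ) {B A : Type*} [CommRing B] [CommRing A] (q : B →+* A)
    (Φ : B →+* B) : Prop where
  surjective : Function.Surjective q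
  ker (b : B) : q b = 0 → ∃ c, b = p * c
  ann (b : B) : p * b = 0 → q b = 0
  sq : (p : B) * p = 0
  comm (b : B) : q (Φ b) = q b ^ p

section FrobeniusLift

lemma derivation_aeval {A M : Type*} [CommRing A] [AddCommGroup M] [Module A M]
    (D : Derivation ℤ A M) {m : ℕ} (v : Fin m → A) (P : MvPolynomial (Fin m) ℤ) :
    D (MvPolynomial.aeval v P) =
      ∑ i, MvPolynomial.aeval v (MvPolynomial.pderiv i P) • D (v i) := by
  induction P using MvPolynomial.induction_on with
  | C a => simp
  | add P Q hP hQ => simp only [map_add, hP, hQ, add_smul, Finset.sum_add_distrib]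
  | mul_X P j hP =>
    rw [map_mul, D.leibniz, hP, MvPolynomial.aeval_X, Finset.smul_sum]
    simp only [Derivation.leibniz, MvPolynomial.pderiv_X, map_add, smul_eq_mul, map_mul,
      MvPolynomial.aeval_X, add_smul, Finset.sum_add_distrib, mul_smul]
    congr 1
    rw [Finset.sum_eq_single j]
    · simp
    · intro i _ hi
      simp [hi.symm]
    · simp

/-- The polynomial `S = ((x + y)ᵖ - xᵖ - yᵖ) / p` has integral coefficients, and its differential is
`(x + y)ᵖ⁻¹ d(x + y) - xᵖ⁻¹ dx - yᵖ⁻¹ dy` in every ring. -/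
lemma exists_add_pow_prime (p : ℕ) [Fact p.Prime] : ∃ S : MvPolynomial (Fin 2) ℤ,
    (∀ {B : Type u} [CommRing B] (x y : B),
      (x + y) ^ p = x ^ p + y ^ p + p * MvPolynomial.aeval ![x, y] S) ∧
    (∀ {A M : Type u} [CommRing A] [AddCommGroup M] [Module A M] (D : Derivation ℤ A M) (x y : A),
      D (MvPolynomial.aeval ![x, y] S) = (x + y) ^ (p - 1) • (D x + D y) -
        x ^ (p - 1) • D x - y ^ (p - 1) • D y) := by
  have hp : p.Prime := Fact.out
  obtain ⟨r, hr⟩ := exists_add_pow_prime_eq hp (MvPolynomial.X 0 : MvPolynomial (Fin 2) ℤ)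
    (MvPolynomial.X 1)
  set S := MvPolynomial.X 0 * MvPolynomial.X 1 * r with hS
  have hr : (MvPolynomial.X 0 + MvPolynomial.X 1 : MvPolynomial (Fin 2) ℤ) ^ p =
      MvPolynomial.X 0 ^ p + MvPolynomial.X 1 ^ p + (p : MvPolynomial (Fin 2) ℤ) * S := by
    rw [hr, hS]; ring
  have hp0 : (p : MvPolynomial (Fin 2) ℤ) ≠ 0 := by exact_mod_cast hp.ne_zero
  refine ⟨S, fun {B} _ x y => ?_, fun {A M} _ _ _ D x y => ?_⟩
  · have := congrArg (MvPolynomial.aeval ![x, y]) hr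
    simpa using this
  · -- The partial derivatives are computed over `ℤ`, where `p` can be cancelled.
    have h : ∀ i, MvPolynomial.pderiv i S =
        (MvPolynomial.X 0 + MvPolynomial.X 1) ^ (p - 1) - MvPolynomial.X i ^ (p - 1) := by
      intro i
      have := congrArg (MvPolynomial.pderiv i) hr
      rw [Derivation.leibniz_pow, map_add, map_add, map_add, Derivation.leibniz_pow,
        Derivation.leibniz_pow, Derivation.leibniz, Derivation.map_natCast] at this
      refine mul_left_cancel₀ hp0 ?_
      revert i
      refine Fin.forall_fin_two.2 ⟨fun this => ?_, fun this => ?_⟩ <;>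
        · simp [MvPolynomial.pderiv_X] at this
          linear_combination -this
    rw [derivation_aeval, Fin.sum_univ_two, h, h]
    simp only [map_sub, map_pow, map_add, MvPolynomial.aeval_X, Matrix.cons_val_zero,
      Matrix.cons_val_one, sub_smul, smul_add]
    abel

variable {k : Type u} [Field k] {p : ℕ} [CharP k p] [Fact p.Prime]
variable {A B : Type u} [CommRing A] [Algebra k A] [CommRing B] {q : B →+* A} {Φ : B →+* B}

omit [Fact p.Prime] in
lemma D_pow_char (a : A) : KaehlerDifferential.D k A (a ^ p) = 0 := by
  rw [Derivation.leibniz_pow, ← Nat.cast_smul_eq_nsmul k, CharP.cast_eq_zero, zero_smul]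

omit [Fact p.Prime] in
lemma D_pow_mul (a b : A) : KaehlerDifferential.D k A (a ^ p * b) =
    a ^ p • KaehlerDifferential.D k A b := by
  rw [Derivation.leibniz, D_pow_char, smul_zero, add_zero]

namespace IsFrobeniusLift

variable (h : IsFrobeniusLift p q Φ)

include h

omit [Fact p.Prime] in
lemma exists_eq (b : B) : ∃ c, Φ b = b ^ p + p * c := by
  obtain ⟨c, hc⟩ := h.ker (Φ b - b ^ p) (by rw [map_sub, h.comm, map_pow, sub_self])
  exact ⟨c, by rw [← hc, add_sub_cancel]⟩

omit [Fact p.Prime] in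
/-- For two lifts `b`, `b'` of the same element, the functions `c`, `c'` with `Φ b = bᵖ + p c` and
`Φ b' = b'ᵖ + p c'` differ by a `p`-th power modulo `p`, so that they have the same differential. -/
lemma D_eq {b b' c c' : B} (hb : q b = q b') (hc : Φ b = b ^ p + p * c)
    (hc' : Φ b' = b' ^ p + p * c') :
    KaehlerDifferential.D k A (q c) = KaehlerDifferential.D k A (q c') := by
  obtain ⟨e, he⟩ := h.ker (b - b') (by rw [map_sub, hb, sub_self])
  obtain ⟨e', he'⟩ := h.exists_eq e
  have h1 : b ^ p - b' ^ p = 0 := by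
    obtain ⟨y, hy⟩ := dvd_sub_pow_of_dvd_sub (p := p) ⟨e, he⟩ 1
    rw [pow_one] at hy
    rw [hy, pow_succ, pow_one, h.sq, zero_mul]
  have h2 : Φ b - Φ b' = p * Φ e := by rw [← map_sub, he, map_mul, map_natCast]
  have h3 : q (c - c' - e ^ p) = 0 := h.ann _ (by
    linear_combination h2 + (p : B) * he' - hc + hc' - h1 + e' * h.sq)
  rw [map_sub, map_sub, map_pow, sub_eq_zero, sub_eq_iff_eq_add] at h3
  rw [h3, map_add, D_pow_char, zero_add]

/-- A lift `Φ` of the Frobenius induces the semilinear map `Φ* / p` on differentials: if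
`Φ b = bᵖ + p c` and `a`, `c'` are the reductions of `b`, `c`, then `da ↦ aᵖ⁻¹ da + dc'`. -/
theorem exists_semilinear [PerfectField k] :
    ∃ ψ : Ω[A⁄k] →ₛₗ[frobHom k p A] Ω[A⁄k], ∀ b c, Φ b = b ^ p + p * c →
      ψ (KaehlerDifferential.D k A (q b)) = q b ^ (p - 1) • KaehlerDifferential.D k A (q b) +
        KaehlerDifferential.D k A (q c) := by
  choose l hl using h.surjective
  choose c hc using h.exists_eq
  set D := KaehlerDifferential.D k A with hD
  have hφ : ∀ {b b' e}, q b = q b' → Φ b' = b' ^ p + p * e → D (q (c b)) = D (q e) :=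
    fun hb he => h.D_eq hb (hc _) he
  -- For the lift `l a + l b` of `a + b`, the function `c` is `c (l a) + c (l b) - S (l a, l b)`.
  have hadd : ∀ a b, (a + b) ^ (p - 1) • D (a + b) + D (q (c (l (a + b)))) =
      (a ^ (p - 1) • D a + D (q (c (l a)))) + (b ^ (p - 1) • D b + D (q (c (l b)))) := by
    intro a b
    obtain ⟨S, hS1, hS2⟩ := exists_add_pow_prime.{u} p
    have h1 : Φ (l a + l b) = (l a + l b) ^ p +
        p * (c (l a) + c (l b) - MvPolynomial.aeval ![l a, l b] S) := by
      rw [map_add, hc, hc, hS1]; ring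
    have h2 : q (MvPolynomial.aeval ![l a, l b] S) = MvPolynomial.aeval ![a, b] S := by
      have := MvPolynomial.map_aeval ![l a, l b] q S
      rw [this, MvPolynomial.aeval_def, MvPolynomial.coe_eval₂Hom,
        Subsingleton.elim (q.comp (algebraMap ℤ B)) (algebraMap ℤ A)]
      congr 1
      funext i; fin_cases i <;> simp [hl]
    rw [hφ (by rw [hl, map_add, hl, hl]) h1, map_sub, map_add, map_sub, map_add, h2,
      show D (MvPolynomial.aeval ![a, b] S) = _ from hS2 (D.restrictScalars ℤ) a b, map_add]
    simp only [Derivation.coe_restrictScalars]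
    abel
  -- For the lift `l a * l b` of `a * b`, the function `c` is `(l a)ᵖ c (l b) + (l b)ᵖ c (l a)` modulo
  -- multiples of `p`.
  have hmul : ∀ a b, (a * b) ^ (p - 1) • D (a * b) + D (q (c (l (a * b)))) =
      a ^ p • (b ^ (p - 1) • D b + D (q (c (l b)))) +
        b ^ p • (a ^ (p - 1) • D a + D (q (c (l a)))) := by
    intro a b
    have h1 : Φ (l a * l b) = (l a * l b) ^ p + p * (l a ^ p * c (l b) + l b ^ p * c (l a)) := by
      rw [map_mul, hc, hc]
      linear_combination c (l a) * c (l b) * h.sq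
    have hp : ∀ x : A, x ^ p = x ^ (p - 1) * x := fun x => by
      rw [← pow_succ, Nat.sub_add_cancel (Fact.out : p.Prime).one_le]
    rw [hφ (by rw [hl, map_mul, hl, hl]) h1, map_add q, map_mul q, map_mul q, map_pow, map_pow, hl, hl,
      map_add D, D_pow_mul, D_pow_mul, Derivation.leibniz, mul_pow, smul_add, smul_add, smul_add,
      smul_smul, smul_smul, smul_smul, smul_smul,
      show a ^ (p - 1) * b ^ (p - 1) * a = a ^ p * b ^ (p - 1) by rw [hp a]; ring,
      show a ^ (p - 1) * b ^ (p - 1) * b = b ^ p * a ^ (p - 1) by rw [hp b]; ring]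
    abel
  obtain ⟨ψ, hψ⟩ := exists_semilinear_of_derivation (p := p)
    (AddMonoidHom.mk' (fun a => a ^ (p - 1) • D a + D (q (c (l a)))) hadd) hmul
  refine ⟨ψ, fun b e he => ?_⟩
  rw [hψ, AddMonoidHom.mk'_apply, hφ (hl _) he]

end IsFrobeniusLift

end FrobeniusLift

/-! ### Lifts of the Frobenius of a scheme -/

section Pushout

variable {R A B C : CommRingCat.{u}} {f : R ⟶ A} {g : R ⟶ B} {i : A ⟶ C} {j : B ⟶ C} {p : ℕ}

/-- The base change of `A` along the quotient map of `R` by `p` is the quotient of `A` by `p`. -/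
lemma exists_eq_mul_of_isPushout (h : IsPushout f g i j) (hg : Function.Surjective g)
    (hker : ∀ r, g r = 0 → ∃ s, r = s * p) {a : A} (ha : i a = 0) : ∃ b, a = p * b := by
  let I : Ideal A := Ideal.span {(p : A)}
  let q : A →+* A ⧸ I := Ideal.Quotient.mk I
  have hq : ∀ r : R, r ∈ RingHom.ker g.hom → (q.comp f.hom) r = 0 := by
    intro r hr
    obtain ⟨s, rfl⟩ := hker r hr
    rw [map_mul, map_natCast, RingHom.comp_apply]
    have : q (p : A) = 0 := Ideal.Quotient.eq_zero_iff_mem.2 (Ideal.mem_span_singleton_self _)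
    rw [← map_natCast q, this, mul_zero]
  let l : B →+* A ⧸ I := RingHom.liftOfSurjective g.hom hg ⟨q.comp f.hom, hq⟩
  have hl : f ≫ CommRingCat.ofHom q = g ≫ CommRingCat.ofHom l := by
    ext r
    exact (RingHom.liftOfSurjective_comp_apply g.hom hg ⟨q.comp f.hom, hq⟩ r).symm
  have h1 := congrArg (fun φ : A ⟶ CommRingCat.of (A ⧸ I) => φ a) (h.inl_desc _ _ hl)
  have h2 : q a = 0 := h1.symm.trans (by
    rw [CommRingCat.comp_apply, ha, map_zero])
  obtain ⟨b, hb⟩ := Ideal.mem_span_singleton.1 (Ideal.Quotient.eq_zero_iff_mem.1 h2)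
  exact ⟨b, hb⟩

/-- Multiplication by `p` on a flat `R`-module is injective up to the annihilator of `p` in `R`: by
the equational criterion, a solution of `p a = 0` is a combination of elements `r` with `r p = 0`. -/
lemma eq_zero_of_flat (h : f ≫ i = g ≫ j) (hf : f.hom.Flat) (hg : ∀ r : R, r * p = 0 → g r = 0)
    {a : A} (ha : p * a = 0) : i a = 0 := by
  let := f.hom.toAlgebra
  have : Module.Flat R A := hf
  have h1 : ∑ _x : Unit, (p : R) • a = 0 := by
    rw [Finset.univ_unique, Finset.sum_singleton, Algebra.smul_def, map_natCast, ha]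
  obtain ⟨m, r, y, hy, hr⟩ := Module.Flat.isTrivialRelation_of_sum_smul_eq_zero
    (f := fun _ : Unit => (p : R)) (x := fun _ => a) h1
  rw [show a = _ from hy (), map_sum]
  refine Finset.sum_eq_zero fun l _ => ?_
  have h2 := hr l
  rw [Finset.univ_unique, Finset.sum_singleton, mul_comm] at h2
  have h3 : i (f (r () l)) = j (g (r () l)) := congrArg (fun φ : R ⟶ C => φ (r () l)) h
  rw [Algebra.smul_def, map_mul]
  change i (f (r () l)) * _ = 0
  rw [h3, hg _ h2, map_zero, zero_mul]

end Pushout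

section Germs

lemma germ_eq_of_map_eq {X : Scheme.{u}} {U V W : X.Opens} (iU : W ⟶ U) (iV : W ⟶ V)
    {s : Γ(X, U)} {t : Γ(X, V)} (h : X.presheaf.map iU.op s = X.presheaf.map iV.op t) {x : X}
    (hx : x ∈ W) : X.presheaf.germ U x (iU.le hx) s = X.presheaf.germ V x (iV.le hx) t := by
  rw [← X.presheaf.germ_res_apply iU x hx, ← X.presheaf.germ_res_apply iV x hx, h]

lemma exists_preimage_le {X Y : Scheme.{u}} (f : X ⟶ Y) [IsClosedImmersion f] {x : X}
    {W : X.Opens} (hx : x ∈ W) : ∃ V : Y.Opens, f x ∈ V ∧ f ⁻¹ᵁ V ≤ W := by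
  obtain ⟨V, hV, he⟩ := f.isClosedEmbedding.isInducing.isOpen_iff.1 W.2
  exact ⟨⟨V, hV⟩, show x ∈ f ⁻¹' V from he ▸ hx, fun y hy => show y ∈ W.1 from he ▸ hy⟩

end Germs

section Lifts

variable {k : Type u} [Field k] {p : ℕ} [Fact p.Prime] [CharP k p]
variable {X X₂ : Scheme.{u}} {ι : X ⟶ X₂} {s : X ⟶ Spec (.of k)}
  {f₂ : X₂ ⟶ Spec (.of (TruncatedWittVector p 2 k))}

/-- On affine open sets of a flat scheme over `W₂(k)`, where `p² = 0`, both the kernel of reduction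
and the annihilator of `p` are the ideal generated by `p`. -/
lemma reduction_of_isAffineOpen [PerfectField k] [Flat f₂]
    (h : IsPullback ι s f₂ (Spec.map (CommRingCat.ofHom (wittResidue k p)))) {V : X₂.Opens}
    (hV : IsAffineOpen V) (r : Γ(X₂, V)) :
    (ι.app V r = 0 → ∃ t, r = p * t) ∧ (p * r = 0 → ι.app V r = 0) ∧
      (p : Γ(X₂, V)) * p = 0 := by
  have hp : IsPushout _ _ _ _ := (isIso_pushoutSection_iff h (US := ⊤) (UT := ⊤) (UX := V)
    (UY := ι ⁻¹ᵁ V) le_top le_top (by simp)).1 (isIso_pushoutSection_of_isAffineOpen _ _ _ _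
      (isAffineOpen_top _) (isAffineOpen_top _) hV)
  rw [← Scheme.Hom.app_eq_appLE] at hp
  set g := (Spec.map (CommRingCat.ofHom (wittResidue k p))).appLE ⊤ ⊤ le_top with hg
  let e := Scheme.ΓSpecIso (.of (TruncatedWittVector p 2 k))
  let e' := Scheme.ΓSpecIso (.of k)
  have hge : ∀ w, g (e.inv w) = e'.inv (wittResidue k p w) := by
    intro w
    have := Scheme.ΓSpecIso_inv_naturality (CommRingCat.ofHom (wittResidue k p))
    have h1 : g = (Spec.map (CommRingCat.ofHom (wittResidue k p))).appTop := by
      rw [hg, Scheme.Hom.appTop, Scheme.Hom.app_eq_appLE]; rfl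
    rw [h1]
    exact congrArg (fun φ => φ.hom w) this.symm
  have he : ∀ r, ∃ w, e.inv w = r := fun r => ⟨e.hom r, by simp⟩
  have he' : Function.Injective e'.inv := (ConcreteCategory.bijective_of_isIso e'.inv).1
  have hei : Function.Injective e.inv := (ConcreteCategory.bijective_of_isIso e.inv).1
  refine ⟨fun hr => ?_, fun hr => ?_, ?_⟩
  · refine exists_eq_mul_of_isPushout hp (fun b => ?_) (fun r hr => ?_) hr
    · obtain ⟨w, hw⟩ := wittResidue_surjective (k := k) (p := p) (e'.hom b)
      exact ⟨e.inv w, by rw [hge, hw]; simp⟩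
    · obtain ⟨w, rfl⟩ := he r
      rw [hge] at hr
      obtain ⟨b, rfl⟩ := exists_eq_mul_of_wittResidue_eq_zero (he' (hr.trans (map_zero _).symm))
      exact ⟨e.inv b, by rw [map_mul, map_natCast]⟩
  · refine eq_zero_of_flat hp.w (f₂.flat_appLE (isAffineOpen_top _) hV _) (fun r hr => ?_) hr
    obtain ⟨w, rfl⟩ := he r
    rw [hge, wittResidue_eq_zero_of_mul (hei ?_), map_zero]
    rw [map_mul, map_natCast, hr, map_zero]
  · have h1 := congrArg (e.inv ≫ f₂.appLE ⊤ V le_top) (natCast_mul_natCast_witt (k := k) (p := p))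
    rwa [map_mul, map_natCast, map_zero] at h1

omit [CharP k p] in
lemma isClosedImmersion_of_isPullback
    (h : IsPullback ι s f₂ (Spec.map (CommRingCat.ofHom (wittResidue k p)))) :
    IsClosedImmersion ι :=
  MorphismProperty.of_isPullback h.flip
    (IsClosedImmersion.spec_of_surjective _ wittResidue_surjective)

variable {F₂ : X₂ ⟶ X₂}

/-- A lift of the Frobenius fixes the points of the reduction. -/
lemma lift_apply [X.Over (Spec (.of k))] (hF : ι ≫ F₂ = absFrob k p X ≫ ι) (x : X) :
    F₂ (ι x) = ι x := by
  have := congrArg (fun φ : X ⟶ X₂ => φ x) hF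
  rwa [Scheme.Hom.comp_apply, Scheme.Hom.comp_apply] at this

/-- The endomorphism of the stalk at a point of the reduction given by a lift of the Frobenius. -/
def liftStalk [X.Over (Spec (.of k))] (hF : ι ≫ F₂ = absFrob k p X ≫ ι) (x : X) :
    X₂.presheaf.stalk (ι x) ⟶ X₂.presheaf.stalk (ι x) :=
  X₂.presheaf.stalkSpecializes (specializes_of_eq (lift_apply hF x)) ≫ F₂.stalkMap (ι x)

lemma liftStalk_germ [X.Over (Spec (.of k))] (hF : ι ≫ F₂ = absFrob k p X ≫ ι) (x : X)
    {V : X₂.Opens} (hx : ι x ∈ V) (hx' : ι x ∈ F₂ ⁻¹ᵁ V) (r : Γ(X₂, V)) :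
    liftStalk hF x (X₂.presheaf.germ V (ι x) hx r) =
      X₂.presheaf.germ (F₂ ⁻¹ᵁ V) (ι x) hx' (F₂.app V r) := by
  rw [liftStalk, CommRingCat.comp_apply, TopCat.Presheaf.germ_stalkSpecializes_apply,
    Scheme.Hom.germ_stalkMap_apply]

lemma mem_preimage_lift [X.Over (Spec (.of k))] (hF : ι ≫ F₂ = absFrob k p X ≫ ι) {x : X}
    {V : X₂.Opens} (hx : ι x ∈ V) : ι x ∈ F₂ ⁻¹ᵁ V := by
  change F₂ (ι x) ∈ V
  rwa [lift_apply hF]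

/-- A lift of the Frobenius of a scheme induces lifts of the Frobenius of the local rings. -/
lemma isFrobeniusLift_stalk [PerfectField k] [Flat f₂] [X.Over (Spec (.of k))]
    (h : IsPullback ι s f₂ (Spec.map (CommRingCat.ofHom (wittResidue k p))))
    (hF : ι ≫ F₂ = absFrob k p X ≫ ι) (x : X) :
    IsFrobeniusLift p (ι.stalkMap x).hom (liftStalk hF x).hom := by
  have := isClosedImmersion_of_isPullback h
  have hcomm : ∀ (V : X₂.Opens) (r : Γ(X₂, V)) (hx : ι x ∈ V),
      ι.stalkMap x (X₂.presheaf.germ V (ι x) hx r) = X.presheaf.germ (ι ⁻¹ᵁ V) x hx (ι.app V r) :=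
    fun V r hx => Scheme.Hom.germ_stalkMap_apply ..
  -- Every germ is the germ of a function on an affine neighborhood on which given equations hold.
  refine ⟨ι.stalkMap_surjective x, fun b hb => ?_, fun b hb => ?_, ?_, fun b => ?_⟩
  · obtain ⟨V, hxV, r, rfl⟩ := X₂.presheaf.exists_germ_eq b
    have hb : X.presheaf.germ (ι ⁻¹ᵁ V) x hxV (ι.app V r) =
      X.presheaf.germ (ι ⁻¹ᵁ V) x hxV 0 := ((hcomm V r hxV).symm.trans hb).trans (map_zero _).symm
    obtain ⟨W, hxW, iW, iW', hW⟩ := X.presheaf.germ_eq x _ _ _ _ hb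
    obtain ⟨V', hV', hV'W⟩ := exists_preimage_le ι hxW
    obtain ⟨N, hN, hxN, hNV⟩ := exists_isAffineOpen_mem_and_subset (U := V ⊓ V') ⟨hxV, hV'⟩
    have hNV : N ≤ V ⊓ V' := hNV
    have h1 : ι.app N (X₂.presheaf.map (homOfLE (hNV.trans inf_le_left)).op r) = 0 := by
      rw [← CommRingCat.comp_apply, ι.naturality, CommRingCat.comp_apply]
      have hle : ι ⁻¹ᵁ N ≤ W := le_trans (fun y hy => (hNV hy).2) hV'W
      have := congrArg (X.presheaf.map (homOfLE hle).op) hW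
      rw [map_zero, map_zero, ← CommRingCat.comp_apply, ← Functor.map_comp] at this
      exact this
    obtain ⟨t, ht⟩ := (reduction_of_isAffineOpen h hN _).1 h1
    refine ⟨X₂.presheaf.germ N (ι x) hxN t, ?_⟩
    rw [← map_natCast (X₂.presheaf.germ N (ι x) hxN).hom, ← map_mul, ← ht]
    exact (X₂.presheaf.germ_res_apply ..).symm
  · obtain ⟨V, hxV, r, rfl⟩ := X₂.presheaf.exists_germ_eq b
    have hb : X₂.presheaf.germ V (ι x) hxV (p * r) = X₂.presheaf.germ V (ι x) hxV 0 := by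
      rw [map_mul, map_natCast, map_zero]; exact hb
    obtain ⟨W, hxW, iW, iW', hW⟩ := X₂.presheaf.germ_eq (ι x) _ _ _ _ hb
    obtain ⟨N, hN, hxN, hNW⟩ := exists_isAffineOpen_mem_and_subset hxW
    have hNW : N ≤ W := hNW
    have h1 : p * (X₂.presheaf.map (homOfLE (hNW.trans iW.le)).op r) = 0 := by
      have := congrArg (X₂.presheaf.map (homOfLE hNW).op) hW
      rw [map_zero, map_zero, ← CommRingCat.comp_apply, ← Functor.map_comp, map_mul, map_natCast]
        at this
      exact this
    have h2 := (reduction_of_isAffineOpen h hN _).2.1 h1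
    have h3 := hcomm N (X₂.presheaf.map (homOfLE (hNW.trans iW.le)).op r) hxN
    rw [h2, map_zero, X₂.presheaf.germ_res_apply] at h3
    exact h3
  · obtain ⟨N, hN, hxN, -⟩ := exists_isAffineOpen_mem_and_subset (Opens.mem_top (ι x))
    have := congrArg (X₂.presheaf.germ N (ι x) hxN) (reduction_of_isAffineOpen h hN 0).2.2
    rwa [map_mul, map_natCast, map_zero] at this
  · obtain ⟨V, hxV, r, rfl⟩ := X₂.presheaf.exists_germ_eq b
    have h1 := congrArg (fun φ => φ.hom r) (Scheme.Hom.congr_app hF V)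
    have h2 : (ι ≫ F₂).app V r = ι.app _ (F₂.app V r) := rfl
    have h3 : (absFrob k p X ≫ ι).app V r = ι.app V r ^ p := rfl
    change ι.stalkMap x (liftStalk hF x _) = ι.stalkMap x _ ^ p
    rw [liftStalk_germ hF x hxV (mem_preimage_lift hF hxV), hcomm, hcomm, ← h2, ← map_pow, ← h3]
    refine (congrArg _ h1).trans ?_
    exact X.presheaf.germ_res_apply ..

/-- A family `ψ` of Frobenius-semilinear maps on the differentials of the local rings such that,
for every function `a`, the form `ψ(da) - aᵖ⁻¹ da` is locally the differential of a function. -/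
def IsFrobeniusFamily [X.Over (Spec (.of k))]
    (ψ : ∀ x : X, Ω[X.presheaf.stalk x⁄k] →ₛₗ[frobHom k p (X.presheaf.stalk x)]
    Ω[X.presheaf.stalk x⁄k]) : Prop :=
  ∀ (U : X.Opens) (a : Γ(X, U)) (x : X), x ∈ U → ∃ (V : X.Opens) (h : V ≤ U) (_ : x ∈ V)
    (c : Γ(X, V)), ∀ (y : X) (hy : y ∈ V),
      ψ y (KaehlerDifferential.D k _ (germHom k U y (h hy) a)) =
        germHom k U y (h hy) a ^ (p - 1) • KaehlerDifferential.D k _ (germHom k U y (h hy) a) +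
          KaehlerDifferential.D k _ (germHom k V y hy c)

/-- A lift of the Frobenius of `X` induces compatible semilinear maps on the differentials of the
local rings. -/
theorem exists_isFrobeniusFamily_of_frobeniusLifts [PerfectField k] [X.Over (Spec (.of k))]
    (hX : FrobeniusLifts k p X) :
    ∃ ψ : ∀ x : X, Ω[X.presheaf.stalk x⁄k] →ₛₗ[frobHom k p (X.presheaf.stalk x)]
        Ω[X.presheaf.stalk x⁄k], IsFrobeniusFamily ψ := by
  obtain ⟨X₂, f₂, ι, F₂, _, h, -, hF⟩ := hX
  have hq := isFrobeniusLift_stalk h hF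
  choose ψ hψ using fun x => (hq x).exists_semilinear (k := k)
  refine ⟨ψ, fun U a x hx => ?_⟩
  have := isClosedImmersion_of_isPullback h
  have hcomm : ∀ (x : X) (V : X₂.Opens) (r : Γ(X₂, V)) (hx : ι x ∈ V),
      ι.stalkMap x (X₂.presheaf.germ V (ι x) hx r) = X.presheaf.germ (ι ⁻¹ᵁ V) x hx (ι.app V r) :=
    fun x V r hx => Scheme.Hom.germ_stalkMap_apply ..
  -- The function `a` lifts to a function `r` near `x`.
  obtain ⟨b, hb⟩ := (hq x).surjective (X.presheaf.germ U x hx a)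
  obtain ⟨V, hxV, r, rfl⟩ := X₂.presheaf.exists_germ_eq b
  obtain ⟨W, hxW, iW, iW', hW⟩ := X.presheaf.germ_eq x _ _ _ _ ((hcomm x V r hxV).symm.trans hb)
  obtain ⟨V', hV', hV'W⟩ := exists_preimage_le ι hxW
  -- Near `x`, the lift of the Frobenius maps `r` to `rᵖ + p t`.
  obtain ⟨c, hc⟩ := (hq x).exists_eq (X₂.presheaf.germ V (ι x) hxV r)
  obtain ⟨V₁, hxV₁, t, rfl⟩ := X₂.presheaf.exists_germ_eq c
  have hc' := (liftStalk_germ hF x hxV (mem_preimage_lift hF hxV) r).symm.trans hc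
  obtain ⟨N, hxN, hNV, hNV₁⟩ : ∃ N : X₂.Opens, ι x ∈ N ∧ N ≤ V ∧ N ≤ V₁ :=
    ⟨V ⊓ V₁, ⟨hxV, hxV₁⟩, inf_le_left, inf_le_right⟩
  have h1 : X₂.presheaf.germ N (ι x) hxN
      (X₂.presheaf.map (homOfLE hNV).op r ^ p +
        (p : Γ(X₂, N)) * X₂.presheaf.map (homOfLE hNV₁).op t) =
      X₂.presheaf.germ (F₂ ⁻¹ᵁ V) (ι x) (mem_preimage_lift hF hxV) (F₂.app V r) := by
    rw [hc', map_add, map_mul, map_pow, map_natCast, X₂.presheaf.germ_res_apply,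
      X₂.presheaf.germ_res_apply]
  obtain ⟨M, hxM, iM, iM', hM⟩ := X₂.presheaf.germ_eq (ι x) _ _ _ _ h1
  refine ⟨ι ⁻¹ᵁ (V' ⊓ M), fun y hy => iW'.le (hV'W hy.1), ⟨hV', hxM⟩,
    X.presheaf.map (homOfLE fun y hy => hNV₁ (iM.le hy.2) : ι ⁻¹ᵁ (V' ⊓ M) ⟶ ι ⁻¹ᵁ V₁).op
      (ι.app V₁ t), fun y hy => ?_⟩
  have hyV : ι y ∈ V := hNV (iM.le hy.2)
  have hyV₁ : ι y ∈ V₁ := hNV₁ (iM.le hy.2)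
  have h2 := germ_eq_of_map_eq iM iM' hM hy.2
  rw [map_add, map_mul, map_pow, map_natCast, X₂.presheaf.germ_res_apply,
      X₂.presheaf.germ_res_apply] at h2
  have h3 := hψ y (X₂.presheaf.germ V (ι y) hyV r) (X₂.presheaf.germ V₁ (ι y) hyV₁ t)
    ((liftStalk_germ hF y hyV (mem_preimage_lift hF hyV) r).trans h2.symm)
  have h4 : (ι.stalkMap y).hom (X₂.presheaf.germ V (ι y) hyV r) =
      germHom k U y (iW'.le (hV'W hy.1)) a :=
    (hcomm y V r hyV).trans (germ_eq_of_map_eq iW iW' hW (hV'W hy.1))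
  have h5 : (ι.stalkMap y).hom (X₂.presheaf.germ V₁ (ι y) hyV₁ t) =
      germHom k (ι ⁻¹ᵁ (V' ⊓ M)) y hy (X.presheaf.map (homOfLE fun y hy => hNV₁ (iM.le hy.2) :
        ι ⁻¹ᵁ (V' ⊓ M) ⟶ ι ⁻¹ᵁ V₁).op (ι.app V₁ t)) :=
    (hcomm y V₁ t hyV₁).trans (X.presheaf.germ_res_apply ..).symm
  rwa [h4, h5] at h3

end Lifts

/-! ### Sections of kernels, cokernels and homology sheaves -/

section Sections

open Limits

variable {X : Scheme.{u}}

/-- The functor of sections over `U`. -/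
abbrev sectionsFunctor (U : X.Opens) : X.Modules ⥤ Ab.{u} :=
  Scheme.Modules.toPresheaf X ⋙ (CategoryTheory.evaluation _ _).obj (op U)

instance (U : X.Opens) : PreservesLimits (sectionsFunctor U) :=
  have : PreservesLimits ((CategoryTheory.evaluation (Opens X)ᵒᵖ Ab.{u}).obj (op U)) :=
    Limits.evaluationPreservesLimits _
  comp_preservesLimits _ _

instance (U : X.Opens) : PreservesFiniteLimits (sectionsFunctor U) :=
  PreservesLimits.preservesFiniteLimits _

instance (U : X.Opens) : (sectionsFunctor U).PreservesZeroMorphisms where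
  map_zero _ _ := rfl

lemma app_res {M N : X.Modules} (f : M ⟶ N) {U V : X.Opens} (h : V ≤ U) (s : Γ(M, U)) :
    f.app V (M.presheaf.map (homOfLE h).op s) = N.presheaf.map (homOfLE h).op (f.app U s) :=
  congrArg (fun ψ => ψ s) (f.mapPresheaf.naturality (homOfLE h).op)

lemma app_injective {M N : X.Modules} (f : M ⟶ N) [Mono f] (U : X.Opens) :
    Function.Injective (f.app U) := by
  have : Mono ((sectionsFunctor U).map f) := inferInstance
  exact (AddCommGrpCat.mono_iff_injective ((sectionsFunctor U).map f)).1 this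

lemma exists_app_eq_of_exact {S : ShortComplex X.Modules} (hS : S.Exact) [Mono S.f] {U : X.Opens}
    {s : Γ(S.X₂, U)} (hs : S.g.app U s = 0) : ∃ t, S.f.app U t = s := by
  have := hS.map_of_mono_of_preservesKernel (sectionsFunctor U) inferInstance inferInstance
  exact (ShortComplex.ab_exact_iff _).1 this s hs

lemma eq_of_locally_eq (M : X.Modules) {U : X.Opens} {s t : Γ(M, U)}
    (h : ∀ x ∈ U, ∃ (V : X.Opens) (hV : V ≤ U), x ∈ V ∧
      M.presheaf.map (homOfLE hV).op s = M.presheaf.map (homOfLE hV).op t) : s = t := by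
  choose V hV hx hs using h
  refine TopCat.Sheaf.eq_of_locally_eq' ⟨M.presheaf, M.isSheaf⟩ (fun x : U => V x.1 x.2) U
    (fun x => homOfLE (hV _ _)) (fun x hx' => Opens.mem_iSup.2 ⟨⟨x, hx'⟩, hx x hx'⟩) _ _
    fun x => hs _ _

/-- Epimorphisms of sheaves of modules are surjective on sections locally: a section that does not
lift locally has a nonzero image in the sheaf associated with the cokernel of presheaves. -/
lemma exists_app_eq_of_epi {M N : X.Modules} (f : M ⟶ N) [Epi f] {U : X.Opens} (s : Γ(N, U))
    {x : X} (hx : x ∈ U) : ∃ (V : X.Opens) (h : V ≤ U) (t : Γ(M, V)), x ∈ V ∧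
      f.app V t = N.presheaf.map (homOfLE h).op s := by
  let φ := (Scheme.Modules.toPresheafOfModules X).map f
  let Q := cokernel φ
  let adj := PresheafOfModules.sheafificationAdjunction (𝟙 X.ringCatSheaf.obj)
  let η : Q ⟶ ((PresheafOfModules.sheafification (𝟙 X.ringCatSheaf.obj)).obj Q).val :=
    adj.unit.app Q
  let G : X.Modules := (PresheafOfModules.sheafification (𝟙 X.ringCatSheaf.obj)).obj Q
  let g : N ⟶ G := (Scheme.Modules.fullyFaithfulToPresheafOfModules).preimage (cokernel.π φ ≫ η)
  have hg : f ≫ g = 0 := by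
    apply (Scheme.Modules.toPresheafOfModules X).map_injective
    rw [Functor.map_comp, Functor.FullyFaithful.map_preimage]
    change φ ≫ cokernel.π φ ≫ η = _
    rw [cokernel.condition_assoc, zero_comp]
    rfl
  have hg0 : g = 0 := by rwa [← cancel_epi f, comp_zero]
  have h1 : cokernel.π φ ≫ η = 0 := by
    have := (Scheme.Modules.fullyFaithfulToPresheafOfModules (X := X)).map_preimage
      (X := N) (Y := G) (cokernel.π φ ≫ η)
    refine this.symm.trans ?_
    change (Scheme.Modules.toPresheafOfModules X).map g = _
    rw [hg0]; rfl
  have h2 : Presheaf.IsLocallyInjective (Opens.grothendieckTopology X)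
      (CategoryTheory.toSheafify (Opens.grothendieckTopology X) Q.presheaf) := inferInstance
  have h3 : (η.app (op U)) ((cokernel.π φ).app (op U) s) = 0 := by
    exact congrArg (fun ψ : N.val ⟶ G.val => ψ.app (op U) s) h1
  obtain ⟨V, i, hV, hxV⟩ := h2.equalizerSieve_mem (X := op U) ((cokernel.π φ).app (op U) s) 0
    (h3.trans (map_zero _).symm) x hx
  have h4 : (cokernel.π φ).app (op V) (N.presheaf.map i.op s) = 0 := by
    have h5 : Q.presheaf.map i.op ((cokernel.π φ).app (op U) s) = 0 := hV.trans (map_zero _)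
    refine Eq.trans ?_ h5
    exact congrArg (fun ψ => ψ s)
      (((PresheafOfModules.toPresheaf _).map (cokernel.π φ)).naturality i.op)
  have hE : (ShortComplex.mk φ (cokernel.π φ) (cokernel.condition φ)).Exact :=
    ShortComplex.exact_of_g_is_cokernel _ (cokernelIsCokernel φ)
  have hE' := hE.map (PresheafOfModules.evaluation X.ringCatSheaf.obj (op V))
  obtain ⟨t, ht⟩ := (ShortComplex.moduleCat_exact_iff _).1 hE' _ h4
  exact ⟨V, i.le, t, hxV, ht⟩

variable (K : CochainComplex X.Modules ℕ) {i : ℕ} {U : X.Opens}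

lemma exists_iCycles_eq {s : Γ(K.X i, U)} (hs : (K.d i (i + 1)).app U s = 0) :
    ∃ z, (K.iCycles i).app U z = s := by
  have h : (ShortComplex.mk (K.iCycles i) (K.d i (i + 1)) (by simp)).Exact :=
    ShortComplex.exact_of_f_is_kernel _ (K.cyclesIsKernel i (i + 1) (by simp))
  have : Mono (ShortComplex.mk (K.iCycles i) (K.d i (i + 1)) (by simp)).f :=
    inferInstanceAs (Mono (K.iCycles i))
  exact exists_app_eq_of_exact h hs

lemma d_app_iCycles (z : Γ(K.cycles i, U)) :
    (K.d i (i + 1)).app U ((K.iCycles i).app U z) = 0 :=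
  congrArg (fun φ : K.cycles i ⟶ K.X (i + 1) => φ.app U z) (K.iCycles_d i (i + 1))

/-- A cycle is a boundary in the homology sheaf if and only if it is locally a boundary. -/
lemma homologyπ_eq_zero_iff {z : Γ(K.cycles i, U)} :
    (K.homologyπ i).app U z = 0 ↔ ∀ x ∈ U, ∃ (V : X.Opens) (h : V ≤ U)
      (t : Γ(K.X ((ComplexShape.up ℕ).prev i), V)), x ∈ V ∧
        (K.d _ i).app V t = (K.X i).presheaf.map (homOfLE h).op ((K.iCycles i).app U z) := by
  let j := (ComplexShape.up ℕ).prev i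
  let S := ShortComplex.mk (K.toCycles j i) (K.homologyπ i) (by simp)
  have hS : S.Exact := ShortComplex.exact_of_g_is_cokernel _ (K.homologyIsCokernel j i rfl)
  have : Epi S.toCycles := S.exact_iff_epi_toCycles.1 hS
  have hC : (ShortComplex.mk S.iCycles S.g (by simp)).Exact :=
    ShortComplex.exact_of_f_is_kernel _ S.cyclesIsKernel
  have : Mono (ShortComplex.mk S.iCycles S.g (by simp)).f := inferInstanceAs (Mono S.iCycles)
  constructor
  · intro hz x hx
    obtain ⟨w, hw⟩ := exists_app_eq_of_exact hC hz
    obtain ⟨V, hV, t, hxV, ht⟩ := exists_app_eq_of_epi S.toCycles w hx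
    refine ⟨V, hV, t, hxV, ?_⟩
    have h1 : K.d j i = S.toCycles ≫ S.iCycles ≫ K.iCycles i := by
      rw [S.toCycles_i_assoc]; exact (K.toCycles_i j i).symm
    rw [h1]
    change (K.iCycles i).app V (S.iCycles.app V (S.toCycles.app V t)) = _
    rw [ht, app_res, app_res]
    exact congrArg (fun y => (K.X i).presheaf.map (homOfLE hV).op ((K.iCycles i).app U y)) hw
  · intro h
    refine eq_of_locally_eq _ fun x hx => ?_
    obtain ⟨V, hV, t, hxV, ht⟩ := h x hx
    have h1 : (K.toCycles j i).app V t = (K.cycles i).presheaf.map (homOfLE hV).op z := by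
      apply app_injective (K.iCycles i)
      rw [app_res, ← ht, ← K.toCycles_i j i]
      rfl
    refine ⟨V, hV, hxV, ?_⟩
    rw [← app_res, ← h1, map_zero]
    exact congrArg (fun φ : K.X j ⟶ K.homology i => φ.app V t) S.zero

end Sections

/-! ### Coordinates on a smooth scheme -/

section SchemeCoordinates

variable {k : Type u} [Field k] {p : ℕ} [CharP k p] [Fact p.Prime]

omit [CharP k p] [Fact p.Prime] in
lemma Coordinates.formsMap_basis {A B : Type u} [CommRing A] [Algebra k A] [CommRing B]
    [Algebra k B] {n : ℕ} (c : Coordinates k p A n) (c' : Coordinates k p B n) (g : A →ₐ[k] B)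
    (h : ∀ i, c'.x i = g (c.x i)) (s : Finset (Fin n)) :
    formsMap g (c.basis.ExteriorAlgebra s) = c'.basis.ExteriorAlgebra s := by
  rw [ExteriorAlgebra.basis_apply, ExteriorAlgebra.basis_apply]
  unfold ExteriorAlgebra.ιMulti_family
  rw [ExteriorAlgebra.ιMulti_apply, ExteriorAlgebra.ιMulti_apply, map_list_prod, List.map_ofFn]
  congr 2
  funext i
  simp only [Function.comp_apply, c.basis_apply, c'.basis_apply, h]
  exact formsMap_dFun g _

variable {X : Scheme.{u}} [X.Over (Spec (.of k))] {n : ℕ}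

omit [CharP k p] in
/-- Coordinates on an affine open set are coordinates of the local rings. -/
lemma Coordinates.exists_stalk {V : X.Opens} (hV : IsAffineOpen V) (c : Coordinates k p Γ(X, V) n)
    {y : X} (hy : y ∈ V) : ∃ c' : Coordinates k p (X.presheaf.stalk y) n,
      ∀ i, c'.x i = germHom k V y hy (c.x i) := by
  let := TopCat.Presheaf.algebra_section_stalk X.presheaf (⟨y, hy⟩ : V)
  have := hV.isLocalization_stalk ⟨y, hy⟩
  have : IsScalarTower k Γ(X, V) (X.presheaf.stalk y) :=
    .of_algebraMap_eq fun a => ((germHom k V y hy).commutes a).symm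
  exact ⟨c.localize (hV.primeIdealOf ⟨y, hy⟩).asIdeal.primeCompl, fun i => rfl⟩

lemma exists_coordinates [PerfectField k] [SmoothOfRelativeDimension n (X ↘ Spec (.of k))]
    (x : X) : ∃ V : X.Opens, IsAffineOpen V ∧ x ∈ V ∧ Nonempty (Coordinates k p Γ(X, V) n) := by
  obtain ⟨U, hU, V, hV, hx, e, hf⟩ :=
    SmoothOfRelativeDimension.exists_isStandardSmoothOfRelativeDimension (n := n)
      (f := X ↘ Spec (.of k)) x
  obtain rfl : U = ⊤ := by
    refine top_le_iff.1 fun y _ => ?_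
    rw [Subsingleton.elim (α := PrimeSpectrum k) y ((X ↘ Spec (.of k)) x)]
    exact e hx
  have h1 : structHom k X V = (Scheme.ΓSpecIso (.of k)).inv ≫ (X ↘ Spec (.of k)).appLE ⊤ V e := rfl
  have h2 : (structHom k X V).hom.IsStandardSmoothOfRelativeDimension n := by
    rw [h1]
    exact RingHom.isStandardSmoothOfRelativeDimension_respectsIso.2 _
      (Scheme.ΓSpecIso (.of k)).symm.commRingCatIsoToRingEquiv hf
  have h3 : Algebra.IsStandardSmoothOfRelativeDimension n k Γ(X, V) := h2
  exact ⟨V, hV, hx, nonempty_coordinates⟩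

variable (k p n) in
lemma exists_coordinates_le [PerfectField k] [SmoothOfRelativeDimension n (X ↘ Spec (.of k))]
    {x : X} {W : X.Opens} (hx : x ∈ W) :
    ∃ V ≤ W, IsAffineOpen V ∧ x ∈ V ∧ Nonempty (Coordinates k p Γ(X, V) n) := by
  obtain ⟨V, hV, hxV, ⟨c⟩⟩ := exists_coordinates (k := k) (p := p) (n := n) x
  obtain ⟨f, hf, hxf⟩ := hV.exists_basicOpen_le ⟨x, hx⟩ hxV
  refine ⟨X.basicOpen f, hf, hV.basicOpen f, hxf, ?_⟩
  have := hV.isLocalization_basicOpen f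
  have : IsScalarTower k Γ(X, V) Γ(X, X.basicOpen f) :=
    .of_algebraMap_eq fun a => ((resHom k (X.basicOpen_le f)).commutes a).symm
  exact ⟨c.localize (Submonoid.powers f)⟩

end SchemeCoordinates

/-! ### Families of forms on the local rings -/

section LocalForms

variable {k : Type u} [Field k] {X : Scheme.{u}} [X.Over (Spec (.of k))]

open Classical in
/-- The extension by zero of a family of forms on the local rings of the points of `U`. -/
def extendZero {U : X.Opens} (s : ∀ y : U, Forms k (X.presheaf.stalk y.1)) (y : X) :
    Forms k (X.presheaf.stalk y) :=
  if h : y ∈ U then s ⟨y, h⟩ else 0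

lemma extendZero_apply {U : X.Opens} (s : ∀ y : U, Forms k (X.presheaf.stalk y.1)) {y : X}
    (hy : y ∈ U) : extendZero s y = s ⟨y, hy⟩ := dif_pos hy

/-- Near the point `x`, the family `s` of forms on the local rings is the family of germs of a form
on the ring of functions on an open set. -/
def IsLocalForm (x : X) (s : ∀ y : X, Forms k (X.presheaf.stalk y)) : Prop :=
  ∃ (V : X.Opens) (t : Forms k Γ(X, V)), x ∈ V ∧
    ∀ (y : X) (hy : y ∈ V), s y = formsMap (germHom k V y hy) t

/-- The germs of a form on the ring of functions on an open set, extended by zero. -/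
def germs {V : X.Opens} (t : Forms k Γ(X, V)) : ∀ y : X, Forms k (X.presheaf.stalk y) :=
  extendZero fun y => formsMap (germHom k V y.1 y.2) t

lemma germs_apply {V : X.Opens} (t : Forms k Γ(X, V)) {y : X} (hy : y ∈ V) :
    germs t y = formsMap (germHom k V y hy) t := extendZero_apply _ hy

lemma isLocalForm_germs {V : X.Opens} (t : Forms k Γ(X, V)) {x : X} (hx : x ∈ V) :
    IsLocalForm x (germs t) := ⟨V, t, hx, fun _ hy => germs_apply t hy⟩

lemma eventually_mem {V : X.Opens} {x : X} (hx : x ∈ V) : ∀ᶠ y in nhds x, y ∈ V :=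
  V.2.mem_nhds hx

lemma exists_opens_of_eventually {x : X} {P : X → Prop} (h : ∀ᶠ y in nhds x, P y) :
    ∃ V : X.Opens, x ∈ V ∧ ∀ y ∈ V, P y := by
  obtain ⟨V, h1, h2, h3⟩ := eventually_nhds_iff.1 h
  exact ⟨⟨V, h2⟩, h3, h1⟩

namespace IsLocalForm

variable {x : X} {s s' : ∀ y : X, Forms k (X.presheaf.stalk y)}

lemma exists_le (h : IsLocalForm x s) {W : X.Opens} (hx : x ∈ W) :
    ∃ V ≤ W, ∃ t : Forms k Γ(X, V), x ∈ V ∧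
      ∀ (y : X) (hy : y ∈ V), s y = formsMap (germHom k V y hy) t := by
  obtain ⟨V, t, hxV, ht⟩ := h
  refine ⟨V ⊓ W, inf_le_right, formsMap (resHom k inf_le_left) t, ⟨hxV, hx⟩, fun y hy => ?_⟩
  rw [formsMap_germHom_res, ht]

lemma congr (h : IsLocalForm x s) (h' : ∀ᶠ y in nhds x, s y = s' y) : IsLocalForm x s' := by
  obtain ⟨W, hxW, hW⟩ := exists_opens_of_eventually h'
  obtain ⟨V, hV, t, hxV, ht⟩ := h.exists_le hxW
  exact ⟨V, t, hxV, fun y hy => by rw [← hW y (hV hy), ht]⟩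

lemma exists_common (h : IsLocalForm x s) (h' : IsLocalForm x s') :
    ∃ (V : X.Opens) (t t' : Forms k Γ(X, V)), x ∈ V ∧ ∀ (y : X) (hy : y ∈ V),
      s y = formsMap (germHom k V y hy) t ∧ s' y = formsMap (germHom k V y hy) t' := by
  obtain ⟨V, t, hxV, ht⟩ := h
  obtain ⟨W, hW, t', hxW, ht'⟩ := h'.exists_le hxV
  refine ⟨W, formsMap (resHom k hW) t, t', hxW, fun y hy => ⟨?_, ht' y hy⟩⟩
  rw [formsMap_germHom_res, ht]

lemma add (h : IsLocalForm x s) (h' : IsLocalForm x s') : IsLocalForm x fun y => s y + s' y := by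
  obtain ⟨V, t, t', hxV, ht⟩ := h.exists_common h'
  exact ⟨V, t + t', hxV, fun y hy => by
    rw [map_add, ← (ht y hy).1, ← (ht y hy).2]⟩

lemma sub (h : IsLocalForm x s) (h' : IsLocalForm x s') : IsLocalForm x fun y => s y - s' y := by
  obtain ⟨V, t, t', hxV, ht⟩ := h.exists_common h'
  exact ⟨V, t - t', hxV, fun y hy => by
    rw [map_sub, ← (ht y hy).1, ← (ht y hy).2]⟩

lemma mul (h : IsLocalForm x s) (h' : IsLocalForm x s') : IsLocalForm x fun y => s y * s' y := by
  obtain ⟨V, t, t', hxV, ht⟩ := h.exists_common h'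
  exact ⟨V, t * t', hxV, fun y hy => by
    rw [map_mul, ← (ht y hy).1, ← (ht y hy).2]⟩

protected lemma extD (h : IsLocalForm x s) : IsLocalForm x fun y => extD (s y) := by
  obtain ⟨V, t, hxV, ht⟩ := h
  exact ⟨V, extD t, hxV, fun y hy => by rw [formsMap_extD, ← ht y hy]⟩

lemma degProj (h : IsLocalForm x s) (i : ℕ) : IsLocalForm x fun y => degProj i (s y) := by
  obtain ⟨V, t, hxV, ht⟩ := h
  exact ⟨V, DeRham.degProj i t, hxV, fun y hy => by rw [← degProj_formsMap, ← ht y hy]⟩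

/-- A property of local forms that holds for functions and their differentials and that is
compatible with sums and products holds for all local forms. -/
lemma map {F : ∀ y : X, Forms k (X.presheaf.stalk y) →+* Forms k (X.presheaf.stalk y)}
    (hfun : ∀ (V : X.Opens) (a : Γ(X, V)) (x : X), x ∈ V →
      IsLocalForm x fun y => F y (germs (ofFun a) y))
    (hd : ∀ (V : X.Opens) (a : Γ(X, V)) (x : X), x ∈ V →
      IsLocalForm x fun y => F y (germs (dFun k a) y))
    (h : IsLocalForm x s) : IsLocalForm x fun y => F y (s y) := by
  obtain ⟨V, t, hxV, ht⟩ := h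
  have h1 : IsLocalForm x fun y => F y (germs t y) := by
    induction t using forms_induction generalizing s with
    | hfun a => exact hfun V a x hxV
    | hd a => exact hd V a x hxV
    | hadd t t' h h' =>
      refine ((h (s := germs t) fun _ hy => germs_apply t hy).add
        (h' (s := germs t') fun _ hy => germs_apply t' hy)).congr ?_
      filter_upwards [eventually_mem hxV] with y hy
      rw [germs_apply _ hy, germs_apply _ hy, germs_apply _ hy, map_add, map_add]
    | hmul t t' h h' =>
      refine ((h (s := germs t) fun _ hy => germs_apply t hy).mul
        (h' (s := germs t') fun _ hy => germs_apply t' hy)).congr ?_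
      filter_upwards [eventually_mem hxV] with y hy
      rw [germs_apply _ hy, germs_apply _ hy, germs_apply _ hy, map_mul, map_mul]
  refine h1.congr ?_
  filter_upwards [eventually_mem hxV] with y hy
  rw [germs_apply _ hy, ht y hy]

end IsLocalForm

lemma exists_isLocalForm {x : X} (z : Forms k (X.presheaf.stalk x)) :
    ∃ s : ∀ y : X, Forms k (X.presheaf.stalk y), IsLocalForm x s ∧ s x = z := by
  have hg : ∀ a : X.presheaf.stalk x, ∃ (V : X.Opens) (hx : x ∈ V) (b : Γ(X, V)),
      germHom k V x hx b = a := fun a => X.presheaf.exists_germ_eq a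
  induction z using forms_induction with
  | hfun a =>
    obtain ⟨V, hx, b, rfl⟩ := hg a
    exact ⟨germs (ofFun b), isLocalForm_germs _ hx, by rw [germs_apply _ hx, formsMap_ofFun]⟩
  | hd a =>
    obtain ⟨V, hx, b, rfl⟩ := hg a
    exact ⟨germs (dFun k b), isLocalForm_germs _ hx, by rw [germs_apply _ hx, formsMap_dFun]⟩
  | hadd z z' h h' =>
    obtain ⟨s, hs, rfl⟩ := h
    obtain ⟨s', hs', rfl⟩ := h'
    exact ⟨_, hs.add hs', rfl⟩
  | hmul z z' h h' =>
    obtain ⟨s, hs, rfl⟩ := h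
    obtain ⟨s', hs', rfl⟩ := h'
    exact ⟨_, hs.mul hs', rfl⟩

lemma isForm_iff {i : ℕ} {U : X.Opens} (s : ∀ y : U, Forms k (X.presheaf.stalk y.1)) :
    (isForm k X i).pred s ↔ ∀ (x : X) (hx : x ∈ U), IsLocalForm x (extendZero s) ∧
      s ⟨x, hx⟩ ∈ ⋀[X.presheaf.stalk x]^i (Ω[X.presheaf.stalk x⁄k]) := by
  refine ⟨fun h x hx => ?_, fun h x => ?_⟩
  · obtain ⟨V, hxV, t, ht, hs⟩ := h ⟨x, hx⟩
    refine ⟨(isLocalForm_germs t hxV).congr ?_, ?_⟩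
    · filter_upwards [eventually_mem hxV, eventually_mem hx] with y hy hU
      rw [germs_apply _ hy, extendZero_apply _ hU, hs]
    · rw [hs x hx hxV]; exact formsMap_mem _ ht
  · obtain ⟨V, hV, t, hxV, ht⟩ := (h x.1 x.2).1.exists_le x.2
    refine ⟨V, hxV, degProj i t, degProj_mem i t, fun y hU hy => ?_⟩
    rw [← degProj_formsMap, ← ht y hy, extendZero_apply _ hU, degProj_same (h y hU).2]

lemma formSections_isLocalForm {i : ℕ} {U : X.Opens} (s : formSections k X i U) {x : X}
    (hx : x ∈ U) : IsLocalForm x (extendZero s.1) := ((isForm_iff s.1).1 s.2 x hx).1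

lemma formSections_mem {i : ℕ} {U : X.Opens} (s : formSections k X i U) (x : U) :
    s.1 x ∈ ⋀[X.presheaf.stalk x.1]^i (Ω[X.presheaf.stalk x.1⁄k]) :=
  ((isForm_iff s.1).1 s.2 x.1 x.2).2

/-- A local form of degree `i` is a section of the sheaf of forms near the point. -/
lemma IsLocalForm.exists_section {x : X} {s : ∀ y : X, Forms k (X.presheaf.stalk y)}
    (h : IsLocalForm x s) (i : ℕ) (U : X.Opens) (hx : x ∈ U) : ∃ V ≤ U, x ∈ V ∧
      ∃ t : formSections k X i V, ∀ y : V, t.1 y = DeRham.degProj i (s y.1) := by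
  obtain ⟨V, hV, t, hxV, ht⟩ := (h.degProj i).exists_le hx
  refine ⟨V, hV, hxV, ⟨fun y => DeRham.degProj i (s y.1), fun y =>
    ⟨V, y.2, DeRham.degProj i t, degProj_mem i t, fun z _ hz => ?_⟩⟩, fun y => rfl⟩
  rw [← degProj_formsMap, ← ht z hz, degProj_same (degProj_mem i _)]

variable {p : ℕ} [CharP k p] [Fact p.Prime] [PerfectField k] {n : ℕ}
  [SmoothOfRelativeDimension n (X ↘ Spec (.of k))]

variable (p n) in
include p n in
/-- Two local forms with the same value at a point agree near that point: this can be checked on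
the coefficients with respect to local coordinates. -/
lemma IsLocalForm.eventually_eq {x : X} {s s' : ∀ y : X, Forms k (X.presheaf.stalk y)}
    (h : IsLocalForm x s) (h' : IsLocalForm x s') (hx : s x = s' x) :
    ∀ᶠ y in nhds x, s y = s' y := by
  obtain ⟨W, t, hxW, ht⟩ := h.sub h'
  obtain ⟨V, hV, hVa, hxV, ⟨c⟩⟩ := exists_coordinates_le k p n hxW
  set r := formsMap (resHom k hV) t with hr
  have ht : ∀ (y : X) (hy : y ∈ V), s y - s' y = formsMap (germHom k V y hy) r := fun y hy => by
    rw [hr, formsMap_germHom_res, ← ht y (hV hy)]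
  have hsum : ∀ (y : X) (hy : y ∈ V), ∃ c' : Coordinates k p (X.presheaf.stalk y) n,
      formsMap (germHom k V y hy) r = ∑ j, germHom k V y hy (c.basis.ExteriorAlgebra.repr r j) •
        c'.basis.ExteriorAlgebra j := by
    intro y hy
    obtain ⟨c', hc'⟩ := c.exists_stalk hVa hy
    refine ⟨c', ?_⟩
    conv_lhs => rw [← c.basis.ExteriorAlgebra.sum_repr r, map_sum]
    refine Finset.sum_congr rfl fun j _ => ?_
    rw [ofFun_smul, map_mul, formsMap_ofFun, c.formsMap_basis c' _ hc', ofFun_smul]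
  have h0 : ∀ j, ∀ᶠ y in nhds x, ∀ hy : y ∈ V,
      germHom k V y hy (c.basis.ExteriorAlgebra.repr r j) = 0 := by
    intro j
    obtain ⟨c', hc'⟩ := hsum x hxV
    rw [← ht x hxV, hx, sub_self] at hc'
    have h1 := Fintype.linearIndependent_iff.1 c'.basis.ExteriorAlgebra.linearIndependent _
      hc'.symm j
    obtain ⟨N, hxN, i1, i2, hN⟩ := X.presheaf.germ_eq x hxV hxV _ _
      (h1.trans (map_zero (germHom k V x hxV)).symm)
    filter_upwards [eventually_mem hxN] with y hy hyV
    exact (germ_eq_of_map_eq i1 i2 hN hy).trans (map_zero (germHom k V y hyV))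
  filter_upwards [Filter.eventually_all.2 h0, eventually_mem hxV] with y hy hyV
  obtain ⟨c', hc'⟩ := hsum y hyV
  rw [← sub_eq_zero, ht y hyV, hc']
  exact Finset.sum_eq_zero fun j _ => by rw [hy j hyV, zero_smul]

variable (p n) in
include p n in
/-- A local form that is exact at a point is exact near that point. -/
lemma IsLocalForm.exists_extD {x : X} {s : ∀ y : X, Forms k (X.presheaf.stalk y)}
    (h : IsLocalForm x s) (hx : s x ∈ exactForms k (X.presheaf.stalk x)) :
    ∃ t : ∀ y : X, Forms k (X.presheaf.stalk y), IsLocalForm x t ∧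
      ∀ᶠ y in nhds x, s y = extD (t y) := by
  obtain ⟨z, hz⟩ := hx
  obtain ⟨t, ht, rfl⟩ := exists_isLocalForm z
  exact ⟨t, ht, h.eventually_eq p n ht.extD hz.symm⟩

end LocalForms

/-! ### The splitting on the local rings -/

section Family

variable {k : Type u} [Field k] {p : ℕ} [CharP k p] [Fact p.Prime]
variable {X : Scheme.{u}} [X.Over (Spec (.of k))]

variable {ψ : ∀ x : X, Ω[X.presheaf.stalk x⁄k] →ₛₗ[frobHom k p (X.presheaf.stalk x)]
    Ω[X.presheaf.stalk x⁄k]}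

namespace IsFrobeniusFamily

variable (hψ : IsFrobeniusFamily ψ)

include hψ

lemma exists_twist_dFun {U : X.Opens} (a : Γ(X, U)) {x : X} (hx : x ∈ U) :
    ∃ (V : X.Opens) (h : V ≤ U) (_ : x ∈ V) (c : Γ(X, V)), ∀ (y : X) (hy : y ∈ V),
      twist (ψ y) (dFun k (germHom k U y (h hy) a)) =
        formsMap (germHom k V y hy) (ofFun (resHom k h a ^ (p - 1)) * dFun k (resHom k h a) +
          dFun k c) := by
  obtain ⟨V, h, hxV, c, hc⟩ := hψ U a x hx
  refine ⟨V, h, hxV, c, fun y hy => ?_⟩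
  have h1 : germHom k V y hy (resHom k h a) = germHom k U y (h hy) a :=
    congrArg (fun φ : Γ(X, U) →ₐ[k] X.presheaf.stalk y => φ a) (germHom_res k h y hy)
  rw [twist_dFun, hc, map_add, map_smul, map_add, map_mul, formsMap_dFun, formsMap_dFun,
    formsMap_ofFun, map_pow, h1, ofFun_smul]
  rfl

lemma sub_mem (x : X) (a : X.presheaf.stalk x) :
    ExteriorAlgebra.ι _ (ψ x (KaehlerDifferential.D k _ a)) - ofFun (a ^ (p - 1)) * dFun k a ∈
      exactForms k (X.presheaf.stalk x) := by
  obtain ⟨U, hx, a, rfl⟩ := X.presheaf.exists_germ_eq a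
  obtain ⟨V, h, hxV, c, hc⟩ := hψ U a x hx
  have h1 := hc x hxV
  refine ⟨ofFun (germHom k V x hxV c), ?_⟩
  rw [extD_ofFun, eq_sub_iff_add_eq', ← ofFun_smul]
  exact ((congrArg (ExteriorAlgebra.ι _) h1).trans (by rw [map_add, map_smul]; rfl)).symm

lemma closed (x : X) (z : Forms k (X.presheaf.stalk x)) : extD (twist (ψ x) z) = 0 := by
  refine extD_twist _ (KaehlerDifferential.span_range_derivation k _) ?_ z
  rintro _ ⟨a, rfl⟩
  obtain ⟨b, hb⟩ := hψ.sub_mem x a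
  rw [eq_sub_iff_add_eq'] at hb
  rw [← hb, map_add, extD_extD, extD_mul, extD_dFun, extD_ofFun,
    Coordinates.dFun_pow_mul_dFun]
  simp

lemma isLocalForm_twist {x : X} {s : ∀ y : X, Forms k (X.presheaf.stalk y)}
    (hs : IsLocalForm x s) : IsLocalForm x fun y => twist (ψ y) (s y) := by
  refine hs.map (F := fun y => twist (ψ y)) (fun V a x hx => ?_) fun V a x hx => ?_
  · refine ⟨V, ofFun (a ^ p), hx, fun y hy => ?_⟩
    dsimp only
    rw [germs_apply _ hy, formsMap_ofFun, formsMap_ofFun, twist_ofFun, map_pow]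
  · obtain ⟨W, hW, hxW, c, hc⟩ := hψ.exists_twist_dFun a hx
    refine ⟨W, _, hxW, fun y hy => Eq.trans ?_ (hc y hy)⟩
    dsimp only
    rw [germs_apply _ (hW hy), formsMap_dFun]

end IsFrobeniusFamily

variable [PerfectField k] {n : ℕ} [SmoothOfRelativeDimension n (X ↘ Spec (.of k))]

variable (k p n) in
lemma nonempty_stalk_coordinates (x : X) :
    Nonempty (Coordinates k p (X.presheaf.stalk x) n) := by
  obtain ⟨V, hV, hx, ⟨c⟩⟩ := exists_coordinates (k := k) (p := p) (n := n) x
  obtain ⟨c', -⟩ := c.exists_stalk hV hx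
  exact ⟨c'⟩

/-- The form of degree `i` dual to `ω`, chosen by `Classical.epsilon`. It exists and is unique on the
local rings, see `IsFrobeniusFamily.isDual_dual` and `IsFrobeniusFamily.dual_eq`. -/
def dual {A : Type u} [CommRing A] [Algebra k A] (ψ : Ω[A⁄k] →ₛₗ[frobHom k p A] Ω[A⁄k]) (n i : ℕ)
    (ω : Forms k A) : Forms k A :=
  Classical.epsilon (IsDual ψ n i ω)

namespace IsFrobeniusFamily

variable [IsIntegral X] (hψ : IsFrobeniusFamily ψ)

include hψ

lemma isDual_dual {x : X} {i : ℕ} {ω : Forms k (X.presheaf.stalk x)}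
    (hω : ω ∈ ⋀[X.presheaf.stalk x]^i (Ω[X.presheaf.stalk x⁄k])) :
    IsDual (ψ x) n i ω (dual (ψ x) n i ω) := by
  obtain ⟨c⟩ := nonempty_stalk_coordinates k p n x
  exact Classical.epsilon_spec (c.exists_isDual (hψ.closed x) (hψ.sub_mem x) hω)

lemma dual_eq {x : X} {i : ℕ} {ω η : Forms k (X.presheaf.stalk x)}
    (h : IsDual (ψ x) n i ω η) : dual (ψ x) n i ω = η := by
  obtain ⟨c⟩ := nonempty_stalk_coordinates k p n x
  exact IsDual.unique c (hψ.closed x) (hψ.sub_mem x) (Classical.epsilon_spec ⟨η, h⟩) h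

/-- Duality spreads out from a point: it amounts to the exactness of finitely many local forms. -/
lemma isLocalForm_dual {x : X} {i : ℕ} {s : ∀ y : X, Forms k (X.presheaf.stalk y)}
    (hs : IsLocalForm x s) (hi : s x ∈ ⋀[X.presheaf.stalk x]^i (Ω[X.presheaf.stalk x⁄k])) :
    IsLocalForm x fun y => dual (ψ y) n i (s y) := by
  obtain ⟨V, hV, hxV, ⟨c⟩⟩ := exists_coordinates (k := k) (p := p) (n := n) x
  have hdual := hψ.isDual_dual (n := n) hi
  obtain ⟨η, hη, hηx⟩ := exists_isLocalForm (dual (ψ x) n i (s x))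
  replace hη := hη.degProj i
  replace hηx : degProj i (η x) = dual (ψ x) n i (s x) := by rw [hηx, degProj_same hdual.1]
  -- It suffices to pair with the wedge products `e t` of the differentials of local coordinates.
  let e := fun t : Finset (Fin n) => germs (c.basis.ExteriorAlgebra t)
  have he : ∀ t, IsLocalForm x (e t) := fun t => isLocalForm_germs _ hxV
  have h1 : ∀ t : Finset (Fin n), t.card + i = n → ∀ᶠ y in nhds x,
      twist (ψ y) (e t y) * s y - twist (ψ y) (e t y * degProj i (η y)) ∈
        exactForms k (X.presheaf.stalk y) := by
    intro t ht
    have hloc := ((hψ.isLocalForm_twist (he t)).mul hs).sub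
      (hψ.isLocalForm_twist ((he t).mul hη))
    obtain ⟨β, -, hβ⟩ := hloc.exists_extD p n (by
      rw [hηx]
      refine hdual.2 t.card ht _ ?_
      change germs _ x ∈ _
      rw [germs_apply _ hxV]
      exact formsMap_mem _ (basis_mem_exteriorPower _ t))
    filter_upwards [hβ] with y hy
    exact ⟨β y, hy.symm⟩
  refine hη.congr ?_
  filter_upwards [eventually_mem hxV, Filter.eventually_all.2 fun t =>
    Filter.eventually_imp_distrib_left.2 (h1 t)] with y hy h2
  obtain ⟨c', hc'⟩ := c.exists_stalk hV hy
  refine (hψ.dual_eq (c'.isDual_of_basis (degProj_mem i _) fun t ht => ?_)).symm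
  rw [← c.formsMap_basis c' _ hc', ← germs_apply _ hy]
  exact h2 t ht

end IsFrobeniusFamily

end Family

/-! ### The splitting as a morphism of complexes -/

section Complexes

variable {k : Type u} [Field k] {p : ℕ} [CharP k p] [Fact p.Prime]
variable {X : Scheme.{u}} [X.Over (Spec (.of k))]
variable {ψ : ∀ x : X, Ω[X.presheaf.stalk x⁄k] →ₛₗ[frobHom k p (X.presheaf.stalk x)]
    Ω[X.presheaf.stalk x⁄k]}

/-- The map `⋀ψ` on differential forms over `U`. -/
def twistSections (hψ : IsFrobeniusFamily ψ) (i : ℕ) (U : X.Opens) :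
    formSections k X i U →+ formSections k X i U where
  toFun s := ⟨fun y => twist (ψ y) (s.1 y), by
    refine (isForm_iff (i := i) fun y : U => twist (ψ y) (s.1 y)).2 fun x hx =>
      ⟨(hψ.isLocalForm_twist (formSections_isLocalForm s hx)).congr ?_,
        twist_mem _ (formSections_mem s ⟨x, hx⟩)⟩
    filter_upwards [eventually_mem hx] with y hy
    rw [extendZero_apply _ hy, extendZero_apply _ hy]⟩
  map_zero' := Subtype.ext (funext fun _ => map_zero _)
  map_add' _ _ := Subtype.ext (funext fun _ => map_add _ _ _)

lemma twistSections_smul (hψ : IsFrobeniusFamily ψ) (i : ℕ) {U : X.Opens} (a : Γ(X, U))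
    (s : formSections k X i U) :
    twistSections hψ i U (a • s) = a ^ p • twistSections hψ i U s := by
  refine Subtype.ext (funext fun y => ?_)
  change twist (ψ y) (ofFun (X.presheaf.germ U y.1 y.2 a) * s.1 y) =
    ofFun (X.presheaf.germ U y.1 y.2 (a ^ p)) * twist (ψ y) (s.1 y)
  rw [map_mul, twist_ofFun, map_pow]

variable (k p X) in
lemma frobDeRham_d_app (i : ℕ) {U : X.Opens} (s : formSections k X i U) :
    ((frobDeRham k p X).d i (i + 1)).app U (frobSec k p s) = frobSec k p (extDer k i s) := by
  have : (frobDeRham k p X).d i (i + 1) = frobExtDer k p X i :=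
    CochainComplex.of_d
      (fun i => (Scheme.Modules.pushforward (absFrob k p X)).obj (Omega k X i)) _ i
  rw [this]
  rfl

/-- The splitting `σ`, given by `⋀ψ` on the local rings. -/
def splitting (hψ : IsFrobeniusFamily ψ) : hodgeComplex k X ⟶ frobDeRham k p X where
  f i :=
    { val := PresheafOfModules.homMk (M₁ := (Omega k X i).val)
        (M₂ := ((Scheme.Modules.pushforward (absFrob k p X)).obj (Omega k X i)).val)
        { app U := AddCommGrpCat.ofHom (twistSections hψ i U.unop)
          naturality _ _ _ := rfl }
        fun _ a s => twistSections_smul hψ i a s }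
  comm' i j hij := by
    obtain rfl : i + 1 = j := hij
    refine Eq.trans ?_ Limits.zero_comp.symm
    refine Scheme.Modules.hom_ext _ _ fun U => ?_
    ext s
    refine (frobDeRham_d_app k p X i (twistSections hψ i U s)).trans ?_
    exact Subtype.ext (funext fun y => hψ.closed y.1 (s.1 y))

lemma onForms_splitting (hψ : IsFrobeniusFamily ψ) {i : ℕ} {U : X.Opens}
    (s : formSections k X i U) : onForms (splitting hψ) s = twistSections hψ i U s := rfl

variable [PerfectField k] (n : ℕ) [SmoothOfRelativeDimension n (X ↘ Spec (.of k))] [IsIntegral X]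

/-- The map on differential forms over `U` given by duality. -/
def dualSections (hψ : IsFrobeniusFamily ψ) (i : ℕ) (U : X.Opens) :
    formSections k X i U →+ formSections k X i U where
  toFun s := ⟨fun y => dual (ψ y) n i (s.1 y), by
    refine (isForm_iff (i := i) fun y : U => dual (ψ y) n i (s.1 y)).2 fun x hx =>
      ⟨(hψ.isLocalForm_dual (n := n) (formSections_isLocalForm s hx) (i := i) ?_).congr ?_,
        (hψ.isDual_dual (formSections_mem s ⟨x, hx⟩)).1⟩
    · rw [extendZero_apply _ hx]; exact formSections_mem s ⟨x, hx⟩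
    · filter_upwards [eventually_mem hx] with y hy
      rw [extendZero_apply _ hy, extendZero_apply _ hy]⟩
  map_zero' := Subtype.ext (funext fun _ => hψ.dual_eq IsDual.zero)
  map_add' s t := Subtype.ext (funext fun y => hψ.dual_eq
    ((hψ.isDual_dual (formSections_mem s y)).add (hψ.isDual_dual (formSections_mem t y))))

lemma dualSections_smul (hψ : IsFrobeniusFamily ψ) (i : ℕ) {U : X.Opens} (a : Γ(X, U))
    (s : formSections k X i U) :
    dualSections n hψ i U (a ^ p • s) = a • dualSections n hψ i U s := by
  refine Subtype.ext (funext fun y => ?_)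
  change dual (ψ y) n i (ofFun (X.presheaf.germ U y.1 y.2 (a ^ p)) * s.1 y) =
    ofFun (X.presheaf.germ U y.1 y.2 a) * dual (ψ y) n i (s.1 y)
  rw [map_pow]
  exact hψ.dual_eq ((hψ.isDual_dual (formSections_mem s y)).pow_mul _)

/-- The retraction `ρ`, given by duality on the local rings. -/
def retraction (hψ : IsFrobeniusFamily ψ) : frobDeRham k p X ⟶ hodgeComplex k X where
  f i :=
    { val := PresheafOfModules.homMk
        (M₁ := ((Scheme.Modules.pushforward (absFrob k p X)).obj (Omega k X i)).val)
        (M₂ := (Omega k X i).val)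
        { app U := AddCommGrpCat.ofHom (dualSections n hψ i U.unop)
          naturality _ _ _ := rfl }
        fun _ a s => dualSections_smul n hψ i a s }
  comm' i j hij := by
    obtain rfl : i + 1 = j := hij
    refine Limits.comp_zero.trans ?_
    refine Scheme.Modules.hom_ext _ _ fun U => ?_
    ext s
    refine Eq.trans ?_ (congrArg (dualSections n hψ (i + 1) U) (frobDeRham_d_app k p X i s)).symm
    exact Subtype.ext (funext fun y => (hψ.dual_eq (isDual_extD (hψ.closed y.1) (s.1 y))).symm)

lemma onFrobForms_retraction (hψ : IsFrobeniusFamily ψ) {i : ℕ} {U : X.Opens}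
    (s : formSections k X i U) : onFrobForms (retraction n hψ) s = dualSections n hψ i U s := rfl

lemma splitting_comp_retraction (hψ : IsFrobeniusFamily ψ) :
    splitting hψ ≫ retraction n hψ = 𝟙 (hodgeComplex k X) := by
  refine HomologicalComplex.hom_ext _ _ fun i => Scheme.Modules.hom_ext _ _ fun U => ?_
  ext s
  exact Subtype.ext (funext fun y => hψ.dual_eq (isDual_twist (formSections_mem s y)))

end Complexes

/-! ### Cohomology classes -/

section Isomorphisms

variable {X : Scheme.{u}} {M N : X.Modules} (f : M ⟶ N)

lemma mono_of_app_eq_zero (h : ∀ (U : X.Opens) (s : Γ(M, U)), f.app U s = 0 → s = 0) : Mono f :=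
  Preadditive.mono_of_cancel_zero _ fun g hg => Scheme.Modules.hom_ext _ _ fun U => by
    ext s
    exact h U _ (congrArg (fun φ => φ.app U s) hg)

lemma epi_of_exists_app_eq (h : ∀ (U : X.Opens) (s : Γ(N, U)) (x : X), x ∈ U →
    ∃ (V : X.Opens) (hV : V ≤ U) (t : Γ(M, V)), x ∈ V ∧
      f.app V t = N.presheaf.map (homOfLE hV).op s) : Epi f :=
  Preadditive.epi_of_cancel_zero _ fun g hg => Scheme.Modules.hom_ext _ _ fun U => by
    ext s
    refine eq_of_locally_eq _ fun x hx => ?_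
    obtain ⟨V, hV, t, hxV, ht⟩ := h U s x hx
    refine ⟨V, hV, hxV, ?_⟩
    rw [← app_res, ← app_res, ← ht]
    exact congrArg (fun φ => φ.app V t) hg

end Isomorphisms

section Classes

variable {k : Type u} [Field k] {p : ℕ} [CharP k p] [Fact p.Prime]
variable {X : Scheme.{u}} [X.Over (Spec (.of k))]
variable {ψ : ∀ x : X, Ω[X.presheaf.stalk x⁄k] →ₛₗ[frobHom k p (X.presheaf.stalk x)]
    Ω[X.presheaf.stalk x⁄k]}
variable [PerfectField k] {n : ℕ} [SmoothOfRelativeDimension n (X ↘ Spec (.of k))]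

variable (p n) in
include p n in
/-- A form that is exact on all local rings is locally the differential of a form. -/
lemma exists_extDer_eq {i : ℕ} {U : X.Opens} (ω : formSections k X (i + 1) U)
    (h : ∀ y : U, ω.1 y ∈ exactForms k (X.presheaf.stalk y.1)) {x : X} (hx : x ∈ U) :
    ∃ (V : X.Opens) (hV : V ≤ U) (t : formSections k X i V), x ∈ V ∧
      extDer k i t = formRes k (i + 1) hV ω := by
  obtain ⟨t, ht, hωt⟩ := (formSections_isLocalForm ω hx).exists_extD p n
    (by rw [extendZero_apply _ hx]; exact h ⟨x, hx⟩)
  obtain ⟨W, hxW, hW⟩ := exists_opens_of_eventually hωt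
  obtain ⟨V, hV, hxV, r, hr⟩ := ht.exists_section i (U ⊓ W) ⟨hx, hxW⟩
  refine ⟨V, hV.trans inf_le_left, r, hxV, Subtype.ext (funext fun y => ?_)⟩
  have hyU : y.1 ∈ U := (hV y.2).1
  change extD (r.1 y) = ω.1 ⟨y.1, hyU⟩
  have h1 := hW y.1 (hV y.2).2
  rw [extendZero_apply _ hyU] at h1
  rw [hr, ← degProj_succ_extD, ← h1, degProj_same (formSections_mem ω ⟨y.1, hyU⟩)]

variable (n) in
include n in
/-- The class of a closed form vanishes if and only if the form is exact on all local rings. -/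
lemma homologyπ_frobDeRham_eq_zero_iff {i : ℕ} {U : X.Opens} (ω : formSections k X i U)
    {z : Γ((frobDeRham k p X).cycles i, U)}
    (hz : ((frobDeRham k p X).iCycles i).app U z = frobSec k p ω) :
    ((frobDeRham k p X).homologyπ i).app U z = 0 ↔
      ∀ y : U, ω.1 y ∈ exactForms k (X.presheaf.stalk y.1) := by
  rw [homologyπ_eq_zero_iff, hz]
  cases i with
  | zero =>
    -- There are no boundaries in degree `0`, and exact forms of degree `0` vanish.
    rw [CochainComplex.prev_nat_zero, (frobDeRham k p X).shape 0 0 (by simp)]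
    constructor
    · intro h y
      obtain ⟨V, hV, t, hyV, ht⟩ := h y.1 y.2
      have h1 : ω.1 y = 0 := congrFun (congrArg Subtype.val
        (show (0 : formSections k X 0 V) = formRes k 0 hV ω from ht)).symm ⟨y.1, hyV⟩
      rw [h1]
      exact zero_mem _
    · intro h x hx
      refine ⟨U, le_rfl, 0, hx, ?_⟩
      have h1 : ω = 0 := Subtype.ext (funext fun y =>
        eq_zero_of_mem_exactForms_zero (h y) (formSections_mem ω y))
      rw [h1, map_zero, map_zero, map_zero]
  | succ i =>
    rw [CochainComplex.prev_nat_succ]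
    constructor
    · intro h y
      obtain ⟨V, hV, t, hyV, ht⟩ := h y.1 y.2
      have h1 : extDer k i (t : formSections k X i V) = formRes k (i + 1) hV ω :=
        (frobDeRham_d_app k p X i (t : formSections k X i V)).symm.trans ht
      exact ⟨_, congrFun (congrArg Subtype.val h1) ⟨y.1, hyV⟩⟩
    · intro h x hx
      obtain ⟨V, hV, t, hxV, ht⟩ := exists_extDer_eq p n ω h hx
      exact ⟨V, hV, frobSec k p t, hxV, (frobDeRham_d_app k p X i t).trans
        (congrArg (frobSec k p) ht)⟩

omit [PerfectField k] in
lemma extD_eq_zero_of_iCycles_eq {i : ℕ} {U : X.Opens} {ω : formSections k X i U}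
    {z : Γ((frobDeRham k p X).cycles i, U)}
    (hz : ((frobDeRham k p X).iCycles i).app U z = frobSec k p ω) (y : U) :
    extD (ω.1 y) = 0 := by
  have h := d_app_iCycles (frobDeRham k p X) z
  rw [hz, frobDeRham_d_app] at h
  exact congrFun (congrArg Subtype.val (show extDer k i ω = 0 from h)) y

variable (n) in
include n in
/-- A form represents the class of `σ(ω)` if and only if it is closed and differs from `σ(ω)` by
an exact form on each local ring. -/
lemma hasClass_iff (hψ : IsFrobeniusFamily ψ) {i : ℕ} {U : X.Opens}
    (ω ω' : formSections k X i U) :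
    HasClass k p ω' ((cohomologyMap (splitting hψ) i).app U (sec k ω)) ↔
      ∀ y : U, extD (ω'.1 y) = 0 ∧
        ω'.1 y - twist (ψ y) (ω.1 y) ∈ exactForms k (X.presheaf.stalk y.1) := by
  let l := (frobDeRham k p X).liftCycles ((splitting hψ).f i) (i + 1) (by simp)
    (((splitting hψ).comm i (i + 1)).trans Limits.zero_comp)
  have h0 : ((frobDeRham k p X).iCycles i).app U (l.app U (sec k ω)) =
      frobSec k p (twistSections hψ i U ω) :=
    congrArg (fun φ : Omega k X i ⟶ (frobDeRham k p X).X i => φ.app U (sec k ω))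
      ((frobDeRham k p X).liftCycles_i ((splitting hψ).f i) (i + 1) (by simp)
        (((splitting hψ).comm i (i + 1)).trans Limits.zero_comp))
  have h1 : (cohomologyMap (splitting hψ) i).app U (sec k ω) =
      ((frobDeRham k p X).homologyπ i).app U (l.app U (sec k ω)) := rfl
  have h2 : ∀ z : Γ((frobDeRham k p X).cycles i, U),
      ((frobDeRham k p X).iCycles i).app U z = frobSec k p ω' →
      (((frobDeRham k p X).homologyπ i).app U z =
          (cohomologyMap (splitting hψ) i).app U (sec k ω) ↔
        ∀ y : U, ω'.1 y - twist (ψ y) (ω.1 y) ∈ exactForms k (X.presheaf.stalk y.1)) := by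
    intro z hz
    have h3 : ((frobDeRham k p X).iCycles i).app U (z - l.app U (sec k ω)) =
        frobSec k p (ω' - twistSections hψ i U ω) := by
      rw [map_sub, map_sub, hz, h0]
    rw [h1, ← sub_eq_zero, ← map_sub, homologyπ_frobDeRham_eq_zero_iff n _ h3]
    rfl
  constructor
  · rintro ⟨z, hz, hc⟩ y
    exact ⟨extD_eq_zero_of_iCycles_eq hz y, (h2 z hz).1 hc y⟩
  · intro h
    obtain ⟨z, hz⟩ := exists_iCycles_eq (frobDeRham k p X) (s := frobSec k p ω') (by
      rw [frobDeRham_d_app]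
      exact Subtype.ext (funext fun y => (h y).1))
    exact ⟨z, hz, (h2 z hz).2 fun y => (h y).2⟩

end Classes

/-! ### The splitting on cohomology -/

section Cohomology

variable {k : Type u} [Field k] {p : ℕ} [CharP k p] [Fact p.Prime]
variable {X : Scheme.{u}} [X.Over (Spec (.of k))]
variable {ψ : ∀ x : X, Ω[X.presheaf.stalk x⁄k] →ₛₗ[frobHom k p (X.presheaf.stalk x)]
    Ω[X.presheaf.stalk x⁄k]}
variable [PerfectField k] (n : ℕ) [SmoothOfRelativeDimension n (X ↘ Spec (.of k))] [IsIntegral X]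

include n

lemma mono_cohomologyMap (hψ : IsFrobeniusFamily ψ) (i : ℕ) :
    Mono (cohomologyMap (splitting hψ) i) := by
  refine mono_of_app_eq_zero _ fun U s hs => ?_
  obtain ⟨s, rfl⟩ := (sec k).surjective s
  have h : HasClass k p (0 : formSections k X i U)
      ((cohomologyMap (splitting hψ) i).app U (sec k s)) :=
    ⟨0, (map_zero _).trans (map_zero _).symm, (map_zero _).trans hs.symm⟩
  rw [hasClass_iff n hψ] at h
  refine (congrArg (sec k) (Subtype.ext (funext fun y => ?_))).trans (map_zero _)
  obtain ⟨c⟩ := nonempty_stalk_coordinates k p n y.1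
  refine c.eq_zero_of_twist_mem (hψ.closed y.1) (hψ.sub_mem y.1) ?_
  have h1 := neg_mem (h y).2
  rw [neg_sub] at h1
  exact (sub_zero (twist (ψ y.1) _)) ▸ h1

omit [IsIntegral X] in
lemma epi_cohomologyMap (hψ : IsFrobeniusFamily ψ) (i : ℕ) :
    Epi (cohomologyMap (splitting hψ) i) := by
  refine epi_of_exists_app_eq _ fun U s x hx => ?_
  obtain ⟨V, hV, z, hxV, hz⟩ :=
    exists_app_eq_of_epi ((frobDeRham k p X).homologyπ i) s hx
  obtain ⟨ω, hω⟩ : ∃ ω : formSections k X i V,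
      ((frobDeRham k p X).iCycles i).app V z = frobSec k p ω := ⟨_, rfl⟩
  have hcl := extD_eq_zero_of_iCycles_eq hω
  obtain ⟨c⟩ := nonempty_stalk_coordinates k p n x
  -- The form `ω` is cohomologous to some `σ(η)` at the point `x`, hence near `x`.
  obtain ⟨η, hη⟩ := c.exists_sub_twist_mem (hψ.closed x) (hψ.sub_mem x) (hcl ⟨x, hxV⟩)
  obtain ⟨t, ht, rfl⟩ := exists_isLocalForm η
  obtain ⟨r, -, hr⟩ := ((formSections_isLocalForm ω hxV).sub (hψ.isLocalForm_twist ht)).exists_extD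
    p n (by rw [extendZero_apply _ hxV]; exact hη)
  obtain ⟨W, hxW, hW⟩ := exists_opens_of_eventually hr
  obtain ⟨V', hV', hxV', τ, hτ⟩ := ht.exists_section i (V ⊓ W) ⟨hxV, hxW⟩
  have hV'V : V' ≤ V := hV'.trans inf_le_left
  have hclass : HasClass k p (formRes k i hV'V ω)
      ((cohomologyMap (splitting hψ) i).app V' (sec k τ)) := by
    rw [hasClass_iff n hψ]
    refine fun y => ⟨hcl ⟨y.1, hV'V y.2⟩, ?_⟩
    have h1 := hW y.1 (hV' y.2).2
    rw [extendZero_apply _ (hV'V y.2)] at h1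
    rw [hτ, ← degProj_twist]
    have h2 := degProj_mem_exactForms i
      (show ω.1 ⟨y.1, hV'V y.2⟩ - twist (ψ y.1) (t y.1) ∈ exactForms k _ from ⟨_, h1.symm⟩)
    rw [map_sub, degProj_same (formSections_mem ω ⟨y.1, hV'V y.2⟩)] at h2
    exact h2
  obtain ⟨z', hz', hc⟩ := hclass
  refine ⟨V', hV'V.trans hV, sec k τ, hxV', hc.symm.trans ?_⟩
  have h3 : z' = ((frobDeRham k p X).cycles i).presheaf.map (homOfLE hV'V).op z := by
    apply app_injective ((frobDeRham k p X).iCycles i)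
    rw [app_res, hω, hz']
    rfl
  rw [h3, app_res, hz, ← AddCommGrpCat.comp_apply, ← Functor.map_comp]
  rfl

lemma isIso_cohomologyMap (hψ : IsFrobeniusFamily ψ) (i : ℕ) :
    IsIso (cohomologyMap (splitting hψ) i) :=
  have := mono_cohomologyMap n hψ i
  have := epi_cohomologyMap n hψ i
  isIso_of_mono_of_epi _

/-- The source has zero differentials, so `cohomologyMap` is the map on homology up to
isomorphisms. -/
lemma quasiIso_splitting (hψ : IsFrobeniusFamily ψ) : QuasiIso (splitting hψ) := by
  rw [quasiIso_iff]
  intro i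
  rw [quasiIsoAt_iff_isIso_homologyMap]
  have h1 : IsIso ((hodgeComplex k X).iCycles i) :=
    (hodgeComplex k X).isIso_iCycles i (i + 1) (by simp) rfl
  have h2 : IsIso ((hodgeComplex k X).homologyπ i) :=
    (hodgeComplex k X).isIso_homologyπ _ i rfl rfl
  have h3 := isIso_cohomologyMap n hψ i
  have h4 : (hodgeComplex k X).iCycles i ≫ cohomologyMap (splitting hψ) i =
      (hodgeComplex k X).homologyπ i ≫ HomologicalComplex.homologyMap (splitting hψ) i := by
    rw [HomologicalComplex.homologyπ_naturality]
    refine (Category.assoc _ _ _).symm.trans (congrArg (· ≫ _) ?_)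
    rw [← cancel_mono ((frobDeRham k p X).iCycles i), HomologicalComplex.cyclesMap_i]
    exact (Category.assoc _ _ _).trans
      (congrArg (_ ≫ ·) ((frobDeRham k p X).liftCycles_i _ (i + 1) _ _))
  have h5 : IsIso ((hodgeComplex k X).homologyπ i ≫
      HomologicalComplex.homologyMap (splitting hψ) i) :=
    h4 ▸ IsIso.comp_isIso' h1 h3
  exact IsIso.of_isIso_comp_left ((hodgeComplex k X).homologyπ i) _

lemma isInverseCartier_splitting (hψ : IsFrobeniusFamily ψ) :
    IsInverseCartier k p (cohomologyMap (splitting hψ)) where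
  isIso := isIso_cohomologyMap n hψ
  one U := by
    rw [hasClass_iff n hψ]
    intro y
    have h1 : (funForm k (1 : Γ(X, U))).1 y = 1 := by
      change ofFun (X.presheaf.germ U y.1 y.2 1) = 1
      rw [map_one, ofFun, map_one]
    have h2 : extD (1 : Forms k (X.presheaf.stalk y.1)) = 0 := by
      simpa using hψ.closed y.1 1
    rw [h1, h2, map_one, sub_self]
    exact ⟨rfl, zero_mem _⟩
  wedge {i j U} ω ω' η η' h h' := by
    rw [hasClass_iff n hψ] at h h' ⊢
    intro y
    change extD (ω'.1 y * η'.1 y) = 0 ∧ ω'.1 y * η'.1 y - twist (ψ y.1) (ω.1 y * η.1 y) ∈ _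
    refine ⟨by rw [extD_mul, (h y).1, (h' y).1]; simp, ?_⟩
    rw [map_mul]
    exact mul_sub_mul_mem_exactForms (h y).1 (hψ.closed _ _) (h y).2 (h' y).2
  d U a := by
    rw [hasClass_iff n hψ]
    intro y
    have h1 : (dForm k a).1 y = dFun k (X.presheaf.germ U y.1 y.2 a) := extD_ofFun _
    have h2 : (a ^ (p - 1) • dForm k a).1 y =
        ofFun (X.presheaf.germ U y.1 y.2 a ^ (p - 1)) * dFun k (X.presheaf.germ U y.1 y.2 a) := by
      change ofFun (X.presheaf.germ U y.1 y.2 (a ^ (p - 1))) * (dForm k a).1 y = _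
      rw [h1, map_pow]
    rw [h1, h2, twist_dFun]
    refine ⟨?_, ?_⟩
    · rw [extD_mul, extD_dFun, extD_ofFun, Coordinates.dFun_pow_mul_dFun, mul_zero, add_zero]
    · rw [← neg_sub]
      exact neg_mem (hψ.sub_mem y.1 _)

/-- Duality for sections amounts to duality on the local rings, because forms on a local ring spread
out and forms of top degree are closed. -/
lemma isGivenByDuality_retraction (hψ : IsFrobeniusFamily ψ) :
    IsGivenByDuality n (cohomologyMap (splitting hψ)) (splitting hψ) (retraction n hψ) := by
  intro i j hij U ω η
  simp only [hasClass_iff n hψ, onForms_splitting, onFrobForms_retraction]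
  constructor
  · rintro rfl V h z y
    obtain ⟨c⟩ := nonempty_stalk_coordinates k p n y.1
    have hz := formSections_mem z y
    have hω := formSections_mem ω ⟨y.1, h y.2⟩
    change extD (twist (ψ y.1) (z.1 y) * ω.1 ⟨y.1, h y.2⟩) = 0 ∧
      twist (ψ y.1) (z.1 y) * ω.1 ⟨y.1, h y.2⟩ -
        twist (ψ y.1) (z.1 y * dual (ψ y.1) n i (ω.1 ⟨y.1, h y.2⟩)) ∈ _
    exact ⟨exteriorPower_eq_zero c.basis (extD_mem (forms_mul_mem (twist_mem _ hz) hω))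
      (by omega), (hψ.isDual_dual hω).2 j hij _ hz⟩
  · intro h
    refine Subtype.ext (funext fun y => (hψ.dual_eq ⟨formSections_mem η y, ?_⟩).symm)
    intro j' hj' z hz
    obtain rfl : j' = j := by omega
    obtain ⟨s, hs, rfl⟩ := exists_isLocalForm z
    obtain ⟨V, hV, hyV, t, ht⟩ := hs.exists_section j' U y.2
    have h1 := (h V hV t ⟨y.1, hyV⟩).2
    change twist (ψ y.1) (t.1 ⟨y.1, hyV⟩) * ω.1 y - twist (ψ y.1) (t.1 ⟨y.1, hyV⟩ * η.1 y) ∈ _ at h1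
    rwa [ht, degProj_same hz] at h1

end Cohomology

end DeRham

end

theorem mainTheorem3 (p : ℕ) [Fact p.Prime] (k : Type u) [Field k] [CharP k p] [PerfectField k]
    (n : ℕ) (X : Scheme.{u}) [X.Over (Spec (.of k))] [IsIntegral X]
    [IsSeparated (X ↘ Spec (.of k))] [QuasiCompact (X ↘ Spec (.of k))]
    [SmoothOfRelativeDimension n (X ↘ Spec (.of k))] (hF : FrobeniusLifts k p X) :
    ∃ (σ : hodgeComplex k X ⟶ frobDeRham k p X) (ρ : frobDeRham k p X ⟶ hodgeComplex k X),
      QuasiIso σ ∧ IsInverseCartier k p (cohomologyMap σ) ∧ σ ≫ ρ = 𝟙 (hodgeComplex k X) ∧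
      IsGivenByDuality n (cohomologyMap σ) σ ρ := by
  obtain ⟨ψ, hψ⟩ := exists_isFrobeniusFamily_of_frobeniusLifts hF
  exact ⟨splitting hψ, retraction n hψ, quasiIso_splitting n hψ, isInverseCartier_splitting n hψ,
    splitting_comp_retraction n hψ, isGivenByDuality_retraction n hψ⟩
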